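/- Let $G$ be a locally finite bipartite graph (multiple edges allowed) embedded in the oriented plane so that every face is a bounded topological disc. Fix a colouring of its vertices in black and white such that every edge joins a black vertex to a white one. The quad-graph of $G$ has the vertices and the faces of $G$ as vertices, one edge for each corner of $G$ (incidence of a vertex and a face), and one quadrilateral face for each edge of $G$. A train-track of $G$ is a maximal path of adjacent quadrilaterals which enters and leaves each quadrilateral through opposite sides, seen as a curve in the plane; train-tracks intersect at edges of $G$. They are oriented consistently, i.e. so that they turn counterclockwise around white vertices and clockwise around black ones. The strands of a train-track are its pieces joining two consecutive edges of $G$; each strand lies in one corner of $G$. The graph $G$ is called minimal if no train-track intersects itself and there is no parallel bigon, i.e. no pair of oriented train-tracks that intersect at two points $x\neq y$ and are both oriented from $x$ to $y$. Suppose that no train-track of $G$ forms a closed loop. Two oriented train-tracks are parallel if either they intersect infinitely many times in the same direction (there are infinitely many intersection points that both traverse in the same order), or they are disjoint and there is a topological disc which they cross in the same direction. They are anti-parallel if the first is parallel to the reverse of the second. For three distinct, pairwise non-parallel train-tracks, take a compact disc $B$ outside of which these train-tracks do not meet, apart from possible anti-parallel ones (for which one only asks that the parts following the outgoing points do not meet);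 the global cyclic order of the three train-tracks is the counterclockwise cyclic order on $\partial B$ of their outgoing points, i.e. the points where they leave $B$ for the last time. It does not depend on $B$, and is a partial cyclic order on the set of train-tracks. For a vertex $v$, let $T(v)$ be the set of strands turning around $v$, with its local cyclic order, the counterclockwise order of their outgoing points around $v$. For a face $f$, let $T^\bullet(f)$ (resp. $T^\circ(f)$) be the set of strands in $f$ turning around a black (resp. white) vertex of $\partial f$, with its local cyclic order, the counterclockwise order of their outgoing points around $f$. The global cyclic order is said to restrict to the local cyclic order on such a set of strands if, for any three of these strands belonging to three distinct train-tracks, the train-tracks are in the global cyclic order if and only if the strands are in the local cyclic order. **Corollary.** Let $G$ be as above, without train-track loops and without vertices of degree $1$. Assume that: 1. for every vertex $v$ of $G$, the strands in $T(v)$ belong to distinct train-tracks, and the global cyclic order restricts to the local cyclic order on $T(v)$; 2. for every face $f$ of $G$, there is a pair of strands in $T^\bullet(f)$ belonging to distinct non-parallel train-tracks, and similarly for $T^\circ(f)$; and the global cyclic order restricts to the local cyclic orders on $T^\bullet(f)$ and on $T^\circ(f)$. Then $G$ is minimal. -/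

import Mathlib

/-- An infinite, connected, locally finite graph (loops and multiple edges allowed) embedded in the
oriented plane so that every face is a bounded topological disc, encoded as a combinatorial map.
`D` is the set of darts (oriented edges): `rev` reverses a dart, and `rot` sends a dart to the next
one counterclockwise around its origin. Vertices are the orbits of `rot`, edges the orbits of `rev`,
and faces the orbits of `rot⁻¹ * rev`, which runs along the boundary of the face lying to the left of
a dart. -/
structure PlaneMap (D : Type*) where
  rev : Equiv.Perm D
  rot : Equiv.Perm D
  rev_rev : ∀ d, rev (rev d) = d
  rev_ne : ∀ d, rev d ≠ d

namespace PlaneMap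

variable {D : Type*} (M : PlaneMap D)

/-- The next dart along the boundary of the face to the left, that face being kept on the left
(so that the boundary of the face is followed counterclockwise). -/
def faceNext : Equiv.Perm D := M.rot⁻¹ * M.rev

/-- The two darts have the same origin. -/
def SameVertex (d e : D) : Prop := M.rot.SameCycle d e

/-- The two darts have the same face on their left. -/
def SameFace (d e : D) : Prop := M.faceNext.SameCycle d e

/-- The vertices of the graph. -/
def Vertex : Type _ := Quotient (Equiv.Perm.SameCycle.setoid M.rot)

/-- The faces of the graph, i.e. the vertices of the dual graph. -/
def Face : Type _ := Quotient (Equiv.Perm.SameCycle.setoid M.faceNext)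

/-- The origin of a dart. -/
def vertexOf (d : D) : M.Vertex := Quotient.mk _ d

/-- The face to the left of a dart. -/
def faceOf (d : D) : M.Face := Quotient.mk _ d

/-- A walk: each dart starts where the preceding one ends. -/
def IsWalk (l : List D) : Prop := l.IsChain (fun d e => M.SameVertex (M.rev d) e)

/-- A closed walk: moreover the last dart ends where the first one starts. -/
def IsClosedWalk (l : List D) : Prop :=
  M.IsWalk l ∧ ∀ a ∈ l.getLast?, ∀ b ∈ l.head?, M.SameVertex (M.rev a) b

/-- The boundary walk of the face to the left of `d`, starting with `d`. -/
noncomputable def faceWalk (d : D) : List D :=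
  (List.range (Function.minimalPeriod M.faceNext d)).map (fun i => (M.faceNext ^ i) d)

/-- Homotopy of walks in the cell complex formed by vertices, edges and faces: it is generated by
inserting or deleting an edge followed by its reverse, or the boundary walk of a face. -/
inductive Homotopic : List D → List D → Prop
  | refl (l : List D) : Homotopic l l
  | symm {l l' : List D} : Homotopic l l' → Homotopic l' l
  | trans {l l' l'' : List D} : Homotopic l l' → Homotopic l' l'' → Homotopic l l''
  | spur (u : List D) (d : D) (w : List D) :
      M.IsWalk (u ++ d :: M.rev d :: w) → Homotopic (u ++ d :: M.rev d :: w) (u ++ w)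
  | face (u : List D) (d : D) (w : List D) :
      M.IsWalk (u ++ (M.faceWalk d ++ w)) → Homotopic (u ++ (M.faceWalk d ++ w)) (u ++ w)

/-- The surface obtained by gluing discs along the face walks is the plane: vertices have finite
degree, faces are bounded (finite degree), and the surface is connected, not compact and simply
connected. -/
structure IsPlanar : Prop where
  infinite : Infinite D
  vertex_finite : ∀ d, {e | M.SameVertex d e}.Finite
  face_finite : ∀ d, {e | M.SameFace d e}.Finite
  connected : ∀ d e, Relation.ReflTransGen (fun a b => b = M.rev a ∨ b = M.rot a) d e
  simplyConnected : ∀ l, M.IsClosedWalk l → M.Homotopic l []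

/-- The cyclic order of the elements of one orbit of a permutation `p`: starting at `x` and
applying `p` repeatedly, one meets `y`, then `z`, before being back at `x` (all three distinct). -/
def OrbitOrder (p : Equiv.Perm D) (x y z : D) : Prop :=
  ∃ i j : ℕ, 0 < i ∧ i < j ∧ j < Function.minimalPeriod p x ∧ (p ^ i) x = y ∧ (p ^ j) x = z

/-- A compact disc in the plane made of quadrilaterals of the quad-graph. The quadrilaterals are the
edges of the graph; the edges of the quad-graph are the corners of the graph, and the corner at the
origin of `d` between `d` and `M.rot d` (in the face to the left of `d`) is denoted by `d`. Its two
adjacent quadrilaterals are the edges of `d` and of `M.rot d`.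

The boundary of the disc is a simple closed walk `bdry 0, bdry 1, …, bdry (2 * len) = bdry 0` in the
quad-graph, followed counterclockwise (with the disc on the left). Corners of even index are followed
from a face to a vertex, and corners of odd index from a vertex to a face. -/
structure Disc where
  /-- the darts of the edges whose quadrilaterals form the disc -/
  quads : Set D
  quads_finite : quads.Finite
  rev_mem : ∀ d, M.rev d ∈ quads ↔ d ∈ quads
  len : ℕ
  len_pos : 0 < len
  bdry : ℕ → D
  bdry_closed : bdry (2 * len) = bdry 0
  vertex_step : ∀ i < len, M.SameVertex (bdry (2 * i)) (bdry (2 * i + 1))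
  face_step : ∀ i < len, M.SameFace (bdry (2 * i + 1)) (bdry (2 * i + 2))
  vertex_simple : ∀ i < len, ∀ j < len, M.SameVertex (bdry (2 * i)) (bdry (2 * j)) → i = j
  face_simple : ∀ i < len, ∀ j < len, M.SameFace (bdry (2 * i + 1)) (bdry (2 * j + 1)) → i = j
  left_even : ∀ i < len, bdry (2 * i) ∈ quads ∧ M.rot (bdry (2 * i)) ∉ quads
  left_odd : ∀ i < len, M.rot (bdry (2 * i + 1)) ∈ quads ∧ bdry (2 * i + 1) ∉ quads
  /-- every corner that separates the disc from its complement is on the boundary walk -/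
  complete : ∀ d, ¬ (d ∈ quads ↔ M.rot d ∈ quads) → ∃ i < 2 * len, bdry i = d

end PlaneMap

/-- A bipartite plane graph: `white d` says whether the origin of the dart `d` is a white vertex (it
is black otherwise), and every edge joins a white vertex to a black one. -/
structure BipartitePlaneGraph (D : Type*) extends PlaneMap D where
  planar : toPlaneMap.IsPlanar
  white : D → Bool
  white_rot : ∀ d, white (rot d) = white d
  white_rev : ∀ d, white (rev d) = !white d

namespace BipartitePlaneGraph

variable {D : Type*} (G : BipartitePlaneGraph D)

/-- Train-track strands, i.e. edges of the graph of train-tracks, correspond to corners of the graph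
and so to darts: the strand `s` turns around the origin of `s`, inside the face to the left of `s`,
and joins the edges of `s` and `rot s`. It is oriented counterclockwise around a white vertex
(from `s` to `rot s`), and clockwise around a black one (from `rot s` to `s`).

`exitEdge s` is the edge at which the strand `s` ends, given by its dart with white origin. -/
def exitEdge (s : D) : D := if G.white s then G.rot s else G.rev s

/-- The strand following a given one on its train-track: the train-track crosses the edge
`exitEdge s` and then turns around the other end-point of this edge, on its other side. -/
def nextStrand : Equiv.Perm D where
  toFun s := if G.white s then G.rot.symm (G.rev (G.rot s)) else G.rev s
  invFun s := if G.white s then G.rev s else G.rot.symm (G.rev (G.rot s))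
  left_inv s := by
    have h (d : D) : G.white (G.rot.symm d) = G.white d := by
      simpa using (G.white_rot (G.rot.symm d)).symm
    cases hs : G.white s <;> simp [hs, h, G.white_rot, G.white_rev, G.rev_rev]
  right_inv s := by
    have h (d : D) : G.white (G.rot.symm d) = G.white d := by
      simpa using (G.white_rot (G.rot.symm d)).symm
    cases hs : G.white s <;> simp [hs, h, G.white_rot, G.white_rev, G.rev_rev]

/-- The two strands belong to the same train-track. The (consistently oriented) train-tracks are the
orbits of `nextStrand`; below, a train-track is given by any of its strands. -/
def SameTrack (s t : D) : Prop := G.nextStrand.SameCycle s t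

/-- No train-track forms a closed loop. -/
def NoTrackLoops : Prop := ∀ s, ∀ n : ℕ, 0 < n → (G.nextStrand ^ n) s ≠ s

/-- No vertex has degree one. -/
def NoDegreeOne : Prop := ∀ d, G.rot d ≠ d

/-- Some train-track intersects itself: it passes twice through the same edge. -/
def HasSelfIntersection : Prop :=
  ∃ s t, s ≠ t ∧ G.SameTrack s t ∧ G.exitEdge s = G.exitEdge t

/-- Some pair of oriented train-tracks intersect at two distinct edges, both being oriented from the
first one to the second one. -/
def HasParallelBigon : Prop :=
  ∃ s t, ¬ G.SameTrack s t ∧ G.exitEdge s = G.exitEdge t ∧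
    ∃ m n : ℕ, 0 < m ∧ 0 < n ∧
      G.exitEdge ((G.nextStrand ^ m) s) = G.exitEdge ((G.nextStrand ^ n) t) ∧
      G.exitEdge ((G.nextStrand ^ m) s) ≠ G.exitEdge s

/-- Minimal bipartite plane graphs. -/
def IsMinimal : Prop := ¬ G.HasSelfIntersection ∧ ¬ G.HasParallelBigon

/-- The train-tracks of `s` and `t` are disjoint. -/
def DisjointTracks (s t : D) : Prop :=
  ∀ m n : ℤ, G.exitEdge ((G.nextStrand ^ m) s) ≠ G.exitEdge ((G.nextStrand ^ n) t)

/-- The vertices of the quad-graph, i.e. the faces of the graph of train-tracks. -/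
abbrev QuadVertex : Type _ := G.Vertex ⊕ G.Face

/-- The face of the graph of train-tracks to the left of an oriented strand. -/
def leftOf (s : D) : G.QuadVertex :=
  if G.white s then Sum.inl (G.vertexOf s) else Sum.inr (G.faceOf s)

/-- The face of the graph of train-tracks to the right of an oriented strand. -/
def rightOf (s : D) : G.QuadVertex :=
  if G.white s then Sum.inr (G.faceOf s) else Sum.inl (G.vertexOf s)

/-- Two faces of the graph of train-tracks are joined by a path in the plane that does not meet the
train-tracks of `s` and `t`. -/
def JoinedAvoiding (s t : D) : G.QuadVertex → G.QuadVertex → Prop :=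
  Relation.EqvGen (fun a b => ∃ u, ¬ G.SameTrack s u ∧ ¬ G.SameTrack t u ∧
    a = G.leftOf u ∧ b = G.rightOf u)

/-- Two oriented train-tracks are parallel if there are infinitely many intersection points that they
meet in the same order, or if they are disjoint and cross a topological disc in the same direction.
Such a disc is a thin neighbourhood of a path joining a strand `x` of the first train-track to a
strand `y` of the second one without meeting them in between; the two are crossed in the same
direction when this path leaves `x` on one side and arrives at `y` on the opposite side. -/
def Parallel (s t : D) : Prop :=
  (∃ C : Set (ℤ × ℤ), C.Infinite ∧
    (∀ c ∈ C, G.exitEdge ((G.nextStrand ^ c.1) s) = G.exitEdge ((G.nextStrand ^ c.2) t)) ∧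
    ∀ c ∈ C, ∀ c' ∈ C, c.1 < c'.1 ↔ c.2 < c'.2) ∨
  (G.DisjointTracks s t ∧ ∃ x y, G.SameTrack s x ∧ G.SameTrack t y ∧
    (G.JoinedAvoiding s t (G.rightOf x) (G.leftOf y) ∨
      G.JoinedAvoiding s t (G.leftOf x) (G.rightOf y)))

/-- Two oriented train-tracks are anti-parallel if the first one is parallel to the reverse of the
second one. -/
def AntiParallel (s t : D) : Prop :=
  (∃ C : Set (ℤ × ℤ), C.Infinite ∧
    (∀ c ∈ C, G.exitEdge ((G.nextStrand ^ c.1) s) = G.exitEdge ((G.nextStrand ^ c.2) t)) ∧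
    ∀ c ∈ C, ∀ c' ∈ C, c.1 < c'.1 ↔ c'.2 < c.2) ∨
  (G.DisjointTracks s t ∧ ∃ x y, G.SameTrack s x ∧ G.SameTrack t y ∧
    (G.JoinedAvoiding s t (G.rightOf x) (G.rightOf y) ∨
      G.JoinedAvoiding s t (G.leftOf x) (G.leftOf y)))

/-- The train-track of `s` leaves the disc `B` for the last time at the boundary point of index `p`,
its outgoing point. -/
def LeavesAt (B : G.Disc) (s : D) (p : ℕ) : Prop :=
  p < 2 * B.len ∧ G.SameTrack s (B.bdry p) ∧
    ∀ n : ℕ, G.exitEdge ((G.nextStrand ^ n) (B.bdry p)) ∉ B.quads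

/-- The train-tracks of `s` and `t`, which leave the disc `B` at the boundary points of index `p` and
`q`, do not meet outside `B`, unless they are anti-parallel; in the latter case, at least
their parts following these points do not meet. -/
def SeparatedOutside (B : G.Disc) (s t : D) (p q : ℕ) : Prop :=
  (¬ G.AntiParallel s t → ∀ m n : ℤ,
    G.exitEdge ((G.nextStrand ^ m) s) = G.exitEdge ((G.nextStrand ^ n) t) →
    G.exitEdge ((G.nextStrand ^ m) s) ∈ B.quads) ∧
  ∀ m n : ℕ,
    G.exitEdge ((G.nextStrand ^ m) (B.bdry p)) ≠ G.exitEdge ((G.nextStrand ^ n) (B.bdry q))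

/-- The global cyclic order on oriented train-tracks. It is defined for three distinct, pairwise
non-parallel train-tracks, as the counterclockwise cyclic order of their outgoing points on the
boundary of a disc outside of which they do not meet, apart from possible anti-parallel ones. -/
def GlobalOrder (s₁ s₂ s₃ : D) : Prop :=
  (¬ G.SameTrack s₁ s₂ ∧ ¬ G.SameTrack s₂ s₃ ∧ ¬ G.SameTrack s₁ s₃) ∧
  (¬ G.Parallel s₁ s₂ ∧ ¬ G.Parallel s₂ s₃ ∧ ¬ G.Parallel s₁ s₃) ∧
  ∃ (B : G.Disc) (p₁ p₂ p₃ : ℕ),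
    G.LeavesAt B s₁ p₁ ∧ G.LeavesAt B s₂ p₂ ∧ G.LeavesAt B s₃ p₃ ∧
    G.SeparatedOutside B s₁ s₂ p₁ p₂ ∧ G.SeparatedOutside B s₂ s₃ p₂ p₃ ∧
    G.SeparatedOutside B s₁ s₃ p₁ p₃ ∧
    ((p₁ < p₂ ∧ p₂ < p₃) ∨ (p₂ < p₃ ∧ p₃ < p₁) ∨ (p₃ < p₁ ∧ p₁ < p₂))

/-- The strands around the vertex at the origin of `d`. -/
def vertexStrands (d : D) : Set D := {s | G.SameVertex d s}

/-- The strands of the face to the left of `d` that turn around black vertices. -/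
def blackFaceStrands (d : D) : Set D := {s | G.SameFace d s ∧ G.white s = false}

/-- The strands of the face to the left of `d` that turn around white vertices. -/
def whiteFaceStrands (d : D) : Set D := {s | G.SameFace d s ∧ G.white s = true}

/-- The global cyclic order on train-tracks restricts to the cyclic order `loc` on the set `S` of
strands: for strands of `S` in distinct train-tracks, both cyclic orders agree. In particular, a
triple of such strands is comparable in the global order as soon as it is in the local one. -/
def RestrictsTo (S : Set D) (loc : D → D → D → Prop) : Prop :=
  ∀ x ∈ S, ∀ y ∈ S, ∀ z ∈ S,
    ¬ G.SameTrack x y → ¬ G.SameTrack y z → ¬ G.SameTrack x z →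
    (G.GlobalOrder x y z ↔ loc x y z)

/-- The strands around any vertex belong to distinct train-tracks, and the global cyclic order
restricts to their local one, i.e. the counterclockwise order around the vertex. -/
def VertexCondition : Prop :=
  ∀ d, (∀ s ∈ G.vertexStrands d, ∀ t ∈ G.vertexStrands d, s ≠ t → ¬ G.SameTrack s t) ∧
    G.RestrictsTo (G.vertexStrands d) (PlaneMap.OrbitOrder G.rot)

/-- For each face and each colour, two of the strands of the face turning around vertices of this
colour belong to distinct non-parallel train-tracks, and the global cyclic order restricts to the
local order of these strands, i.e. the counterclockwise order around the face. -/
def FaceCondition : Prop :=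
  ∀ d,
    (∃ s ∈ G.blackFaceStrands d, ∃ t ∈ G.blackFaceStrands d,
      ¬ G.SameTrack s t ∧ ¬ G.Parallel s t) ∧
    (∃ s ∈ G.whiteFaceStrands d, ∃ t ∈ G.whiteFaceStrands d,
      ¬ G.SameTrack s t ∧ ¬ G.Parallel s t) ∧
    G.RestrictsTo (G.blackFaceStrands d) (PlaneMap.OrbitOrder G.faceNext) ∧
    G.RestrictsTo (G.whiteFaceStrands d) (PlaneMap.OrbitOrder G.faceNext)

end BipartitePlaneGraph

/-! ### Integration of cochains along walks -/

namespace PlaneMap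

variable {D : Type*} (M : PlaneMap D)

/-! No train-track meets itself, because the two train-tracks crossing at the edge of `d` are those
of the consecutive strands `rot.symm d` and `d`, which the vertex condition makes distinct. The
substance is the absence of parallel bigons, a combinatorial Gauss-Bonnet argument.

To each edge `e` attach the integer function `h e` on the faces of the train-track graph that jumps
across the two forward rays issuing from `e` (`IsEdgePotential`). It exists because closed cochains
on the plane are gradients. It is 1 on the face between the two outgoing strands at `e` and 0 on the
three other faces there; if the rays do not meet again, it is the indicator function of the wedge
between them. The rays telescope around a vertex and around a face: the functions of the edges at a
vertex add up to 1 away from it (`sum_vertex`), those of a face with `2k` sides add up to `k - 1`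
away from it (`sum_face`). These identities replace angle sums.

At a vertex of degree at least three, the global order of the strands `rot.symm x`, `x`, `rot x`
shows that near infinity `h x` and `h (rot x)` are, up to additive constants, indicator functions of
two disjoint sectors that leave room for a third one (`GlobalOrder.exists_sectors`). This rests on
the plane having one end: a potential of a finite chain is constant off a finite set. So `h e` takes
near infinity exactly two values `n e` and `n e + 1`, each infinitely often (`HasLevel`). Evaluating
the two identities near infinity, the levels have sum at most 0 around a vertex and at least 0
around a face. The second inequality needs a black vertex of degree at least three on the face,
which the face condition provides.

Take a parallel bigon from `e` to `e'`, one of whose sides does not meet the other train-track in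
between. The rays beyond `e'` cancel in `F = h e + h e'`, which is therefore the indicator function
of the inside of the bigon; as it vanishes near infinity, `n e + n e' = -1`. Now sum `n d *
(F(vertex) - F(face))` over corners `d`. Grouping by vertices and faces, the sum is at most 0 since
`F` is nonnegative. But `F` jumps only along the two sides of the bigon, where the sum telescopes to
`-(n e + n e') = 1`, a contradiction. -/

theorem faceNext_apply (d : D) : M.faceNext d = M.rot.symm (M.rev d) := rfl

theorem rot_faceNext (d : D) : M.rot (M.faceNext d) = M.rev d := by
  simp [faceNext_apply]

/-- The two hypotheses on `c` are invariance under the two generating moves, spurs and faces: the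
integral of a closed cochain depends only on the homotopy class. -/
theorem Homotopic.sum_eq {A : Type*} [AddCommGroup A] {c : D → A}
    (hrev : ∀ d, c (M.rev d) = -c d) (hface : ∀ d, ((M.faceWalk d).map c).sum = 0)
    {l l' : List D} (h : M.Homotopic l l') : (l.map c).sum = (l'.map c).sum := by
  induction h with
  | refl l => rfl
  | symm _ ih => exact ih.symm
  | trans _ _ ih₁ ih₂ => exact ih₁.trans ih₂
  | spur u d w _ => simp [hrev]
  | face u d w _ => simp [hface]

/-- The list of darts is a walk from the origin of the first dart to the origin of the second. -/
def Joins : D → List D → D → Prop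
  | a, [], b => M.SameVertex a b
  | a, e :: l, b => M.SameVertex a e ∧ Joins (M.rev e) l b

variable {M}

theorem Joins.congr_left {a a' : D} (h : M.SameVertex a' a) {l : List D} {b : D}
    (hl : M.Joins a l b) : M.Joins a' l b := by
  cases l with
  | nil => exact Equiv.Perm.SameCycle.trans h hl
  | cons e l => exact ⟨Equiv.Perm.SameCycle.trans h hl.1, hl.2⟩

theorem Joins.append {l l' : List D} {a b c : D} (h : M.Joins a l b) (h' : M.Joins b l' c) :
    M.Joins a (l ++ l') c := by
  induction l generalizing a with
  | nil => exact h'.congr_left h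
  | cons e l ih => exact ⟨h.1, ih h.2⟩

theorem Joins.reverse {l : List D} {a b : D} (h : M.Joins a l b) :
    M.Joins b (l.map M.rev).reverse a := by
  induction l generalizing a with
  | nil => exact Equiv.Perm.SameCycle.symm h
  | cons e l ih =>
    rw [List.map_cons, List.reverse_cons]
    refine (ih h.2).append ⟨Equiv.Perm.SameCycle.refl _ _, ?_⟩
    rw [M.rev_rev]
    exact Equiv.Perm.SameCycle.symm h.1

theorem Joins.ends {l : List D} {a b : D} (h : M.Joins a l b) :
    M.IsWalk l ∧ (∀ x ∈ l.head?, M.SameVertex a x) ∧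
      ∀ x ∈ l.getLast?, M.SameVertex (M.rev x) b := by
  induction l generalizing a with
  | nil => simp [IsWalk]
  | cons e l ih =>
    obtain ⟨h₁, h₂, h₃⟩ := ih h.2
    refine ⟨?_, ?_, ?_⟩
    · unfold IsWalk
      rw [List.isChain_cons]
      exact ⟨fun y hy => h₂ y hy, h₁⟩
    · simpa using h.1
    · cases l with
      | nil => simpa using show M.SameVertex (M.rev e) b from h.2
      | cons e' l => simpa using h₃

theorem Joins.isClosedWalk {l : List D} {a : D} (h : M.Joins a l a) : M.IsClosedWalk l :=
  ⟨h.ends.1, fun x hx y hy =>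
    Equiv.Perm.SameCycle.trans (h.ends.2.2 x hx) (h.ends.2.1 y hy)⟩

theorem IsPlanar.exists_joins (hM : M.IsPlanar) (a b : D) : ∃ l, M.Joins a l b := by
  induction hM.connected a b with
  | refl => exact ⟨[], Equiv.Perm.SameCycle.refl _ _⟩
  | @tail b c _ hbc ih =>
    obtain ⟨l, hl⟩ := ih
    rcases hbc with rfl | rfl
    · exact ⟨l ++ [b], hl.append ⟨Equiv.Perm.SameCycle.refl _ _, Equiv.Perm.SameCycle.refl _ _⟩⟩
    · refine ⟨l ++ [], hl.append (l' := []) ?_⟩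
      exact ⟨1, by simp⟩

/-- The first cohomology group of a plane map vanishes. -/
theorem IsPlanar.exists_primitive (hM : M.IsPlanar) {A : Type*} [AddCommGroup A] (c : D → A)
    (hrev : ∀ d, c (M.rev d) = -c d) (hface : ∀ d, ((M.faceWalk d).map c).sum = 0) :
    ∃ p : D → A, (∀ d, p (M.rot d) = p d) ∧ ∀ d, p (M.rev d) = p d + c d := by
  have := hM.infinite
  obtain ⟨a⟩ : Nonempty D := inferInstance
  -- Path independence: `l` followed by the reverse of `l'` is a closed walk, hence null-homotopic.
  -- The primitive is then the integral along any walk from the base dart `a`.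
  have key : ∀ l l' b, M.Joins a l b → M.Joins a l' b → (l.map c).sum = (l'.map c).sum := by
    intro l l' b h h'
    have h0 := (hM.simplyConnected _ (h.append h'.reverse).isClosedWalk).sum_eq M hrev hface
    have h1 : ∀ l : List D, ((l.map M.rev).reverse.map c).sum = -(l.map c).sum := by
      intro l
      induction l with
      | nil => simp
      | cons e l ih =>
        rw [List.map_cons, List.reverse_cons, List.map_append, List.sum_append, ih]
        simp [hrev]
    rw [List.map_append, List.sum_append, h1] at h0
    simpa [add_neg_eq_zero] using h0
  choose w hw using hM.exists_joins a
  refine ⟨fun d => ((w d).map c).sum, fun d => ?_, fun d => ?_⟩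
  · refine key _ _ (M.rot d) (hw _) ?_
    have := (hw d).append (l' := []) (c := M.rot d) ⟨1, by simp⟩
    simpa using this
  · have := key _ _ (M.rev d) (hw _) ((hw d).append (l' := [d])
      ⟨Equiv.Perm.SameCycle.refl _ _, Equiv.Perm.SameCycle.refl _ _⟩)
    simpa using this

theorem sum_faceWalk_sub {A : Type*} [AddCommGroup A] (η : D → A) (d : D) :
    ((M.faceWalk d).map (fun d => η (M.faceNext d) - η d)).sum = 0 := by
  have key : ∀ n, (((List.range n).map fun i => (M.faceNext ^ i) d).map
      (fun d => η (M.faceNext d) - η d)).sum = η ((M.faceNext ^ n) d) - η d := by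
    intro n
    induction n with
    | zero => simp
    | succ n ih =>
      rw [List.range_succ, List.map_append, List.map_append, List.sum_append, ih]
      simp [pow_succ']
  have h : (M.faceNext ^ Function.minimalPeriod M.faceNext d) d = d := by
    rw [← Equiv.Perm.iterate_eq_pow]
    exact Function.iterate_minimalPeriod
  rw [faceWalk, key, h, sub_self]

theorem vertexOf_eq_iff {d e : D} : M.vertexOf d = M.vertexOf e ↔ M.SameVertex d e :=
  ⟨fun h => Quotient.exact (s := Equiv.Perm.SameCycle.setoid M.rot) h,
    fun h => Quotient.sound (s := Equiv.Perm.SameCycle.setoid M.rot) h⟩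

theorem faceOf_eq_iff {d e : D} : M.faceOf d = M.faceOf e ↔ M.SameFace d e :=
  ⟨fun h => Quotient.exact (s := Equiv.Perm.SameCycle.setoid M.faceNext) h,
    fun h => Quotient.sound (s := Equiv.Perm.SameCycle.setoid M.faceNext) h⟩

theorem vertexOf_rot (d : D) : M.vertexOf (M.rot d) = M.vertexOf d :=
  vertexOf_eq_iff.2 (Equiv.Perm.SameCycle.symm ⟨1, by simp⟩)

theorem vertexOf_rot_symm (d : D) : M.vertexOf (M.rot.symm d) = M.vertexOf d := by
  rw [← vertexOf_rot, Equiv.apply_symm_apply]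

theorem faceOf_faceNext (d : D) : M.faceOf (M.faceNext d) = M.faceOf d :=
  faceOf_eq_iff.2 (Equiv.Perm.SameCycle.symm ⟨1, by simp⟩)

theorem faceOf_rot_symm (d : D) : M.faceOf (M.rot.symm d) = M.faceOf (M.rev d) := by
  rw [← faceOf_faceNext (M.rev d), faceNext_apply, M.rev_rev]

/-- The quad-graph is connected, its edges being the corners. -/
theorem IsPlanar.vertex_face_induction (hM : M.IsPlanar) {P : M.Vertex ⊕ M.Face → Prop}
    (h : ∀ d, P (.inl (M.vertexOf d)) ↔ P (.inr (M.faceOf d)))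
    {q : M.Vertex ⊕ M.Face} (hq : P q) (r : M.Vertex ⊕ M.Face) : P r := by
  have hrev : ∀ d, P (.inl (M.vertexOf d)) → P (.inl (M.vertexOf (M.rev d))) := by
    intro d hd
    rw [h, ← faceOf_rot_symm, ← h, vertexOf_rot_symm]
    exact hd
  have hv : ∃ d, P (.inl (M.vertexOf d)) := by
    rcases q with q | q <;> induction q using Quotient.inductionOn with | h d => ?_
    · exact ⟨d, hq⟩
    · exact ⟨d, (h d).2 hq⟩
  obtain ⟨d, hd⟩ := hv
  have hall : ∀ e, P (.inl (M.vertexOf e)) := by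
    intro e
    induction hM.connected d e with
    | refl => exact hd
    | tail _ hbc ih =>
      rcases hbc with rfl | rfl
      · exact hrev _ ih
      · rw [vertexOf_rot]; exact ih
  rcases r with r | r <;> induction r using Quotient.inductionOn with | h e => ?_
  · exact hall e
  · exact (h e).1 (hall e)

end PlaneMap

/-! ### Functions on the cycles of a permutation -/

theorem Equiv.Perm.SameCycle.apply_eq_of_invariant {D A : Type*} {σ : Equiv.Perm D} {g : D → A}
    (hg : ∀ d, g (σ d) = g d) {d e : D} (h : σ.SameCycle d e) : g d = g e := by
  have hg' : ∀ d, g (σ⁻¹ d) = g d := fun d => by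
    rw [← hg (σ⁻¹ d), ← Equiv.Perm.mul_apply, mul_inv_cancel, Equiv.Perm.one_apply]
  obtain ⟨i, rfl⟩ := h
  induction i using Int.induction_on with
  | zero => simp
  | succ i ih =>
    rw [add_comm, zpow_add, zpow_one, Equiv.Perm.mul_apply, hg]
    exact ih
  | pred i ih =>
    rw [sub_eq_add_neg, add_comm, zpow_add, zpow_neg_one, Equiv.Perm.mul_apply, hg']
    exact ih

theorem Equiv.Perm.minimalPeriod_pos_of_finite {D : Type*} {σ : Equiv.Perm D} {d : D}
    (h : {e | σ.SameCycle d e}.Finite) : 0 < Function.minimalPeriod σ d := by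
  have hmaps : ∀ i : ℕ, (σ ^ i) d ∈ {e | σ.SameCycle d e} := fun i => ⟨i, by simp⟩
  obtain ⟨i, j, hij, he⟩ := h.exists_lt_map_eq_of_forall_mem hmaps
  apply Function.minimalPeriod_pos_of_mem_periodicPts
  refine ⟨j - i, by omega, ?_⟩
  rw [Function.IsPeriodicPt, Function.IsFixedPt, Equiv.Perm.iterate_eq_pow]
  apply (σ ^ i).injective
  rw [← Equiv.Perm.mul_apply, ← pow_add, Nat.add_sub_cancel' hij.le, he]

theorem Equiv.Perm.pow_minimalPeriod_apply {D : Type*} (σ : Equiv.Perm D) (d : D) :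
    (σ ^ Function.minimalPeriod σ d) d = d := by
  rw [← Equiv.Perm.iterate_eq_pow]
  exact Function.iterate_minimalPeriod

theorem Equiv.Perm.sum_cycle_eq_sum_range {D A : Type*} [AddCommMonoid A] {σ : Equiv.Perm D}
    {d : D} {S : Finset D} (hS : ∀ e, e ∈ S ↔ σ.SameCycle d e) (φ : D → A) :
    ∑ e ∈ S, φ e = ∑ i ∈ Finset.range (Function.minimalPeriod σ d), φ ((σ ^ i) d) := by
  classical
  have hfin : {e | σ.SameCycle d e}.Finite := S.finite_toSet.subset fun e he => (hS e).2 he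
  have hpos := Equiv.Perm.minimalPeriod_pos_of_finite hfin
  symm
  refine Finset.sum_bij (fun i _ => (σ ^ i) d) (fun i _ => (hS _).2 ⟨i, by simp⟩) ?_ ?_ (by simp)
  · intro i hi j hj hij
    simp only [← Equiv.Perm.iterate_eq_pow] at hij
    exact Function.iterate_injOn_Iio_minimalPeriod (Finset.mem_range.1 hi) (Finset.mem_range.1 hj)
      hij
  · intro e he
    obtain ⟨i, hi⟩ := (hS e).1 he
    set n := Function.minimalPeriod σ d with hn
    have hz : ∀ k : ℤ, (σ ^ ((n : ℤ) * k)) d = d := by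
      intro k
      rw [zpow_mul]
      apply Function.IsFixedPt.perm_zpow
      rw [zpow_natCast]
      exact Equiv.Perm.pow_minimalPeriod_apply σ d
    have hmod : 0 ≤ i % n := Int.emod_nonneg _ (by omega)
    refine ⟨(i % n).toNat, ?_, ?_⟩
    · have := Int.emod_lt_of_pos i (show (0 : ℤ) < n by omega)
      simp; omega
    · rw [← hi, ← zpow_natCast, Int.toNat_of_nonneg hmod]
      conv_rhs => rw [← Int.emod_add_mul_ediv i n, zpow_add, Equiv.Perm.mul_apply, hz]

/-- On a finite cycle, a function with zero sum is a difference of consecutive values. -/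
theorem Equiv.Perm.exists_cycle_primitive {D : Type*} {σ : Equiv.Perm D}
    (hfin : ∀ d, {e | σ.SameCycle d e}.Finite) (χ : D → ℚ)
    (hχ : ∀ d, ∑ i ∈ Finset.range (Function.minimalPeriod σ d), χ ((σ ^ i) d) = 0) :
    ∃ g : D → ℚ, ∀ d, g (σ d) = g d + χ d := by
  -- This is the primitive of mean zero on each cycle of length `n`: summation by parts turns `∑ i *
  -- χ ((σ ^ i) d)` into `n * g d` minus the sum of `g` over the cycle. It needs no base point, but
  -- the division requires rational coefficients.
  refine ⟨fun d => (∑ i ∈ Finset.range (Function.minimalPeriod σ d), (i : ℚ) * χ ((σ ^ i) d)) /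
    (Function.minimalPeriod σ d : ℚ), fun d => ?_⟩
  have hpos := Equiv.Perm.minimalPeriod_pos_of_finite (hfin d)
  have hper : Function.minimalPeriod σ (σ d) = Function.minimalPeriod σ d :=
    Function.minimalPeriod_apply (Function.minimalPeriod_pos_iff_mem_periodicPts.1 hpos)
  have hend := Equiv.Perm.pow_minimalPeriod_apply σ d
  have hsum := hχ d
  simp only [hper]
  set n := Function.minimalPeriod σ d with hn
  have hn0 : (n : ℚ) ≠ 0 := by positivity
  have h1 : ∀ k : ℕ, ∑ i ∈ Finset.range k, (i : ℚ) * χ ((σ ^ i) (σ d)) =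
      (∑ i ∈ Finset.range k, (i : ℚ) * χ ((σ ^ i) d)) + (k - 1) * χ ((σ ^ k) d) + χ d
        - (∑ i ∈ Finset.range k, χ ((σ ^ i) d)) := by
    intro k
    induction k with
    | zero => simp
    | succ k ih =>
      rw [Finset.sum_range_succ, ih, Finset.sum_range_succ, Finset.sum_range_succ, pow_succ σ k,
        Equiv.Perm.mul_apply]
      push_cast
      ring
  rw [h1, hend, hsum]
  field_simp
  ring

/-! ### Cohomology of the quad-graph and of the medial graph; the plane has one end -/

namespace PlaneMap

variable {D : Type*} {M : PlaneMap D}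

/-- The condition for a function on the corners to be a difference of values at the vertex and at
the face of each corner: a closed condition around each quadrilateral. -/
def IsCornerClosed (M : PlaneMap D) {A : Type*} [AddCommGroup A] (η : D → A) : Prop :=
  ∀ d, η (M.rot.symm d) + η (M.rot.symm (M.rev d)) = η d + η (M.rev d)

/-- If `p` and `p - η` are to be the values at the vertex and at the face of a corner, invariance
under `faceNext` forces `p (rev d) - p d = η (faceNext d) - η d`. Closedness makes the right-hand
side odd under `rev`, and its sum along a face telescopes, so it has a primitive. -/
theorem IsPlanar.exists_cornerPotential (hM : M.IsPlanar) {A : Type*} [AddCommGroup A] {η : D → A}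
    (h : M.IsCornerClosed η) :
    ∃ H : M.Vertex ⊕ M.Face → A, ∀ d, H (.inl (M.vertexOf d)) - H (.inr (M.faceOf d)) = η d := by
  obtain ⟨p, hp, hp'⟩ := hM.exists_primitive (fun d => η (M.faceNext d) - η d) (fun d => by
    have := h d
    simp only [faceNext_apply, M.rev_rev]
    rw [neg_sub, sub_eq_sub_iff_add_eq_add, this]) (sum_faceWalk_sub η)
  refine ⟨Sum.elim (Quotient.lift p fun d e hde => ?_)
    (Quotient.lift (fun d => p d - η d) fun d e hde => ?_), fun d => ?_⟩
  · exact Equiv.Perm.SameCycle.apply_eq_of_invariant hp hde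
  · refine Equiv.Perm.SameCycle.apply_eq_of_invariant (σ := M.faceNext)
      (g := fun d => p d - η d) (fun d => ?_) hde
    have h1 : p (M.faceNext d) = p (M.rev d) := by rw [← hp, rot_faceNext]
    simp only [h1, hp']
    abel
  · change p d - (p d - η d) = η d
    abel

/-- The first cohomology of the medial graph vanishes, with rational coefficients. -/
theorem IsPlanar.exists_medialPotential (hM : M.IsPlanar) (χ : D → ℚ)
    (hv : ∀ d, ∑ i ∈ Finset.range (Function.minimalPeriod M.rot d), χ ((M.rot ^ i) d) = 0)
    (hf : ∀ d, ∑ i ∈ Finset.range (Function.minimalPeriod M.faceNext d),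
      χ ((M.faceNext ^ i) d) = 0) :
    ∃ ψ : D → ℚ, (∀ d, ψ (M.rev d) = ψ d) ∧ ∀ d, ψ (M.rot d) = ψ d + χ d := by
  obtain ⟨g, hg⟩ := Equiv.Perm.exists_cycle_primitive (σ := M.rot) hM.vertex_finite χ hv
  obtain ⟨k, hk⟩ := Equiv.Perm.exists_cycle_primitive (σ := M.faceNext) hM.face_finite χ hf
  -- The vertex primitive `g` may differ on the two darts of an edge. The defect is corrected by a
  -- function `p` of the origin; it integrates to zero along faces because it is the difference
  -- along `faceNext` of `g + k ∘ faceNext`.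
  obtain ⟨p, hp, hp'⟩ := hM.exists_primitive (fun d => g (M.rev d) - g d) (fun d => by
    simp only [M.rev_rev]; abel) (fun d => by
      rw [← sum_faceWalk_sub (fun d => g d + k (M.faceNext d)) d]
      congr 2
      funext e
      have h1 := hg (M.faceNext e)
      rw [rot_faceNext] at h1
      rw [hk (M.faceNext e), h1]
      ring)
  refine ⟨fun d => g d - p d, fun d => ?_, fun d => ?_⟩
  · simp only [hp']; ring
  · simp only [hp, hg]; ring

/-- Vanishing of the first cohomology with compact supports, by duality with the medial graph: a
linear functional that kills all coboundaries of finitely supported functions is a closed cochain on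
the medial graph, hence a gradient, and a gradient kills every closed `η`. -/
theorem IsPlanar.exists_finite_cornerPotential_rat (hM : M.IsPlanar) {η : D → ℚ}
    (h : M.IsCornerClosed η) (hη : η.support.Finite) :
    ∃ H : M.Vertex ⊕ M.Face → ℚ, H.support.Finite ∧
      ∀ d, H (.inl (M.vertexOf d)) - H (.inr (M.faceOf d)) = η d := by
  classical
  let I : Submodule ℚ (D →₀ ℚ) :=
    { carrier := {z | ∃ H : M.Vertex ⊕ M.Face → ℚ, H.support.Finite ∧
        ∀ d, H (.inl (M.vertexOf d)) - H (.inr (M.faceOf d)) = z d}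
      add_mem' := by
        rintro z z' ⟨H, h1, h2⟩ ⟨H', h1', h2'⟩
        refine ⟨H + H', (h1.union h1').subset (Function.support_add _ _), fun d => ?_⟩
        rw [Finsupp.add_apply, ← h2, ← h2']
        simp only [Pi.add_apply]
        ring
      zero_mem' := ⟨0, by simp, by simp⟩
      smul_mem' := by
        rintro c z ⟨H, h1, h2⟩
        refine ⟨c • H, h1.subset (Function.support_const_smul_subset _ _), fun d => ?_⟩
        rw [Finsupp.smul_apply, ← h2]
        simp only [Pi.smul_apply, smul_eq_mul]
        ring }
  let z : D →₀ ℚ := Finsupp.ofSupportFinite η hη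
  suffices hz : z ∈ I by
    obtain ⟨H, h1, h2⟩ := hz
    exact ⟨H, h1, fun d => h2 d⟩
  by_contra hz
  obtain ⟨F, hFz, hFI⟩ := Submodule.exists_le_ker_of_notMem hz
  set φ : D → ℚ := fun d => F (Finsupp.single d 1) with hφ
  have hF : ∀ y : D →₀ ℚ, F y = ∑ d ∈ y.support, y d * φ d := by
    intro y
    conv_lhs => rw [← Finsupp.sum_single y, Finsupp.sum, map_sum]
    refine Finset.sum_congr rfl fun d _ => ?_
    rw [hφ, ← smul_eq_mul, ← map_smul, Finsupp.smul_single_one]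
  have horb : ∀ (σ : Equiv.Perm D) (d : D) (hfin : {e | σ.SameCycle d e}.Finite)
      (hI : Finsupp.ofSupportFinite (fun e => if σ.SameCycle d e then (1 : ℚ) else 0)
        (hfin.subset fun e he => by simpa using he) ∈ I),
      ∑ i ∈ Finset.range (Function.minimalPeriod σ d), φ ((σ ^ i) d) = 0 := by
    intro σ d hfin hI
    rw [← Equiv.Perm.sum_cycle_eq_sum_range (S := hfin.toFinset) (by simp)]
    have := hFI hI
    rw [LinearMap.mem_ker, hF] at this
    rw [← this]
    refine Finset.sum_congr ?_ ?_
    · ext e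
      simp [Finsupp.ofSupportFinite]
    · intro e he
      simp only [Finsupp.mem_support_iff, Finsupp.ofSupportFinite_coe] at he
      simp only [Finsupp.ofSupportFinite_coe]
      split_ifs with h
      · simp
      · simp [h] at he
  -- Testing `F` on coboundaries of functions supported at one vertex or one face shows that the
  -- sums of `φ` around vertices and faces vanish.
  obtain ⟨ψ, hψ, hψ'⟩ := hM.exists_medialPotential φ
    (fun d => horb M.rot d (hM.vertex_finite d) ⟨fun q => if q = .inl (M.vertexOf d) then 1 else 0,
      (Set.finite_singleton (Sum.inl (M.vertexOf d))).subset fun q hq => by simpa using hq,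
      fun e => by
        simp only [Finsupp.ofSupportFinite_coe]
        simp [vertexOf_eq_iff, SameVertex, Equiv.Perm.sameCycle_comm]⟩)
    (fun d => horb M.faceNext d (hM.face_finite d)
      ⟨fun q => if q = .inr (M.faceOf d) then -1 else 0,
      (Set.finite_singleton (Sum.inr (M.faceOf d))).subset fun q hq => by simpa using hq,
      fun e => by
        simp only [Finsupp.ofSupportFinite_coe]
        simp [faceOf_eq_iff, SameFace, Equiv.Perm.sameCycle_comm]
        split_ifs <;> simp⟩)
  apply hFz
  have hmul : ∀ k : D → ℚ, (fun d => η d * k d).support.Finite := fun k =>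
    hη.subset (Function.support_mul_subset_left _ _)
  have hη' : (fun d => η (M.rot.symm d)).support.Finite :=
    (hη.preimage (M.rot.symm.injective.injOn)).subset fun d hd => hd
  have h1 : F z = (∑ᶠ d, η d * ψ (M.rot d)) - ∑ᶠ d, η d * ψ d := by
    rw [← finsum_sub_distrib (hmul _) (hmul _), hF,
      finsum_eq_sum_of_support_subset (s := z.support)]
    · refine Finset.sum_congr rfl fun d _ => ?_
      rw [hψ']
      change η d * φ d = _
      ring
    · intro d hd
      simp only [Function.mem_support] at hd
      simp only [Finset.mem_coe, Finsupp.mem_support_iff]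
      change η d ≠ 0
      rintro h0
      simp [h0] at hd
  have h2 : (∑ᶠ d, η d * ψ (M.rot d)) = ∑ᶠ d, η (M.rot.symm d) * ψ d := by
    rw [← finsum_comp_equiv M.rot.symm]
    simp
  -- By closedness the first factor is odd under `rev`, while `ψ` is even: the sum equals its
  -- opposite.
  have h3 : (∑ᶠ d, (η (M.rot.symm d) - η d) * ψ d) =
      -∑ᶠ d, (η (M.rot.symm d) - η d) * ψ d := by
    conv_lhs => rw [← finsum_comp_equiv M.rev]
    rw [← finsum_neg_distrib]
    refine finsum_congr fun d => ?_
    rw [hψ]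
    have := h d
    linear_combination ψ d * this
  rw [h1, h2, ← finsum_sub_distrib (hη'.subset (Function.support_mul_subset_left _ _)) (hmul _)]
  simp only [← sub_mul]
  linarith

/-- A corner potential whose differences vanish outside a finite set is eventually constant. -/
theorem IsPlanar.eventually_const (hM : M.IsPlanar) {H : M.Vertex ⊕ M.Face → ℤ}
    (h : {d | H (.inl (M.vertexOf d)) ≠ H (.inr (M.faceOf d))}.Finite) :
    ∃ c, ∀ᶠ q in Filter.cofinite, H q = c := by
  obtain ⟨H', h1, h2⟩ := hM.exists_finite_cornerPotential_rat
    (η := fun d => ((H (.inl (M.vertexOf d)) - H (.inr (M.faceOf d)) : ℤ) : ℚ))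
    (fun d => by
      simp only [vertexOf_rot_symm, faceOf_rot_symm, M.rev_rev]
      push_cast
      ring)
    (h.subset fun d hd => by
      simp only [Function.mem_support, ne_eq, Int.cast_eq_zero, sub_eq_zero] at hd
      exact hd)
  have := hM.infinite
  obtain ⟨a⟩ : Nonempty D := inferInstance
  have h3 : ∀ q, (H q : ℚ) - H' q = H (.inl (M.vertexOf a)) - H' (.inl (M.vertexOf a)) := by
    refine hM.vertex_face_induction (fun d => ?_) (q := .inl (M.vertexOf a)) rfl
    have := h2 d
    push_cast at this
    constructor <;> intro h <;> linarith
  have h4 : ∀ᶠ q in Filter.cofinite, H' q = 0 := by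
    rw [Filter.eventually_cofinite]
    exact h1
  by_cases hex : ∃ q, H' q = 0
  · obtain ⟨q₀, hq₀⟩ := hex
    refine ⟨H q₀, h4.mono fun q hq => ?_⟩
    have := (h3 q).trans (h3 q₀).symm
    rw [hq, hq₀] at this
    exact_mod_cast (by linarith : (H q : ℚ) = H q₀)
  · exact ⟨0, h4.mono fun q hq => absurd ⟨q, hq⟩ hex⟩

end PlaneMap

/-! ### Train-track strands, chains and potentials -/

namespace BipartitePlaneGraph

variable {D : Type*} {G : BipartitePlaneGraph D}

theorem white_rot_symm (d : D) : G.white (G.rot.symm d) = G.white d := by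
  simpa using (G.white_rot (G.rot.symm d)).symm

theorem nextStrand_of_white {s : D} (hs : G.white s = true) :
    G.nextStrand s = G.rot.symm (G.rev (G.rot s)) := by
  simp [nextStrand, hs]

theorem nextStrand_of_black {s : D} (hs : G.white s = false) : G.nextStrand s = G.rev s := by
  simp [nextStrand, hs]

theorem white_nextStrand (s : D) : G.white (G.nextStrand s) = !G.white s := by
  cases hs : G.white s
  · rw [nextStrand_of_black hs, G.white_rev, hs]
  · rw [nextStrand_of_white hs, white_rot_symm, G.white_rev, G.white_rot, hs]

variable (G) in
/-- The edge at which a strand starts, given by its dart with white origin. -/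
def entryEdge (s : D) : D := if G.white s then s else G.rev (G.rot s)

theorem entryEdge_nextStrand (s : D) : G.entryEdge (G.nextStrand s) = G.exitEdge s := by
  rw [entryEdge, white_nextStrand, exitEdge]
  cases hs : G.white s
  · simp [nextStrand_of_black hs]
  · simp [nextStrand_of_white hs, G.rev_rev]

theorem white_exitEdge (s : D) : G.white (G.exitEdge s) = true := by
  rw [exitEdge]
  cases hs : G.white s <;> simp [G.white_rot, G.white_rev, hs]

theorem exitEdge_eq_iff {e : D} (he : G.white e = true) (s : D) :
    G.exitEdge s = e ↔ s = G.rot.symm e ∨ s = G.rev e := by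
  rw [exitEdge]
  cases hs : G.white s
  · simp only [Bool.false_eq_true, if_false]
    constructor
    · rintro rfl; right; rw [G.rev_rev]
    · rintro (rfl | rfl)
      · rw [white_rot_symm, he] at hs; simp at hs
      · rw [G.rev_rev]
  · simp only [if_true]
    constructor
    · rintro rfl; left; simp
    · rintro (rfl | rfl)
      · simp
      · rw [G.white_rev, he] at hs; simp at hs

theorem entryEdge_eq_iff {e : D} (he : G.white e = true) (s : D) :
    G.entryEdge s = e ↔ s = e ∨ s = G.rot.symm (G.rev e) := by
  rw [entryEdge]
  cases hs : G.white s
  · simp only [Bool.false_eq_true, if_false]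
    constructor
    · rintro rfl; right; rw [G.rev_rev]; simp
    · rintro (rfl | rfl)
      · rw [he] at hs; simp at hs
      · simp [G.rev_rev]
  · simp only [if_true]
    constructor
    · rintro rfl; left; rfl
    · rintro (rfl | rfl)
      · rfl
      · rw [white_rot_symm, G.white_rev, he] at hs; simp at hs

theorem nextStrand_rot_symm {e : D} (he : G.white e = true) :
    G.nextStrand (G.rot.symm e) = G.rot.symm (G.rev e) := by
  rw [nextStrand_of_white (by rw [white_rot_symm, he])]
  simp

theorem nextStrand_rev {e : D} (he : G.white e = true) : G.nextStrand (G.rev e) = e := by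
  rw [nextStrand_of_black (by rw [G.white_rev, he]; rfl), G.rev_rev]

theorem ne_of_white_ne {a b : D} (h : G.white a ≠ G.white b) : a ≠ b := fun h' => h (by rw [h'])

variable (G) in
/-- An integer function on the faces of the graph of train-tracks whose jump from right to left
across each strand is given. -/
def IsPotential (H : G.QuadVertex → ℤ) (z : D → ℤ) : Prop :=
  ∀ s, H (G.leftOf s) - H (G.rightOf s) = z s

variable (G) in
/-- The boundary at an edge (given by its white dart) of a chain of strands: the sum over outgoing
strands minus the sum over incoming ones. -/
def boundary (z : D → ℤ) (e : D) : ℤ :=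
  z e + z (G.rot.symm (G.rev e)) - z (G.rot.symm e) - z (G.rev e)

variable (G) in
/-- A chain of strands without boundary. -/
def IsCycle (z : D → ℤ) : Prop := ∀ e, G.white e = true → G.boundary z e = 0

theorem boundary_add (z z' : D → ℤ) (e : D) :
    G.boundary (z + z') e = G.boundary z e + G.boundary z' e := by
  simp only [boundary, Pi.add_apply]; ring

theorem boundary_sub (z z' : D → ℤ) (e : D) :
    G.boundary (z - z') e = G.boundary z e - G.boundary z' e := by
  simp only [boundary, Pi.sub_apply]; ring

theorem leftOf_white {s : D} (hs : G.white s = true) : G.leftOf s = .inl (G.vertexOf s) := by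
  simp [leftOf, hs]

theorem rightOf_white {s : D} (hs : G.white s = true) : G.rightOf s = .inr (G.faceOf s) := by
  simp [rightOf, hs]

theorem leftOf_black {s : D} (hs : G.white s = false) : G.leftOf s = .inr (G.faceOf s) := by
  simp [leftOf, hs]

theorem rightOf_black {s : D} (hs : G.white s = false) : G.rightOf s = .inl (G.vertexOf s) := by
  simp [rightOf, hs]

theorem IsPotential.add {H H' : G.QuadVertex → ℤ} {z z' : D → ℤ} (h : G.IsPotential H z)
    (h' : G.IsPotential H' z') : G.IsPotential (H + H') (z + z') := fun s => by
  simp only [Pi.add_apply, ← h s, ← h' s]; ring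

theorem IsPotential.sub {H H' : G.QuadVertex → ℤ} {z z' : D → ℤ} (h : G.IsPotential H z)
    (h' : G.IsPotential H' z') : G.IsPotential (H - H') (z - z') := fun s => by
  simp only [Pi.sub_apply, ← h s, ← h' s]; ring

theorem IsPotential.white {H : G.QuadVertex → ℤ} {z : D → ℤ} (h : G.IsPotential H z) {d : D}
    (hd : G.white d = true) : H (.inl (G.vertexOf d)) - H (.inr (G.faceOf d)) = z d := by
  rw [← h d, leftOf_white hd, rightOf_white hd]

theorem IsPotential.black {H : G.QuadVertex → ℤ} {z : D → ℤ} (h : G.IsPotential H z) {d : D}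
    (hd : G.white d = false) : H (.inr (G.faceOf d)) - H (.inl (G.vertexOf d)) = z d := by
  rw [← h d, leftOf_black hd, rightOf_black hd]

/-- Strands are dual to the edges of the quad-graph, so a cycle of strands is a closed cochain on
corners. The sign accounts for the orientation: the vertex is to the left of a strand exactly when
it is white. -/
theorem IsCycle.exists_potential {z : D → ℤ} (hz : G.IsCycle z) : ∃ H, G.IsPotential H z := by
  obtain ⟨H, hH⟩ := G.planar.exists_cornerPotential
    (η := fun d => if G.white d then z d else -z d) (fun d => by
      cases hd : G.white d
      · have := hz (G.rev d) (by rw [G.white_rev, hd]; rfl)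
        simp only [boundary, G.rev_rev] at this
        simp [white_rot_symm, G.white_rev, hd]
        linarith
      · have := hz d hd
        simp only [boundary] at this
        simp [white_rot_symm, G.white_rev, hd]
        linarith)
  refine ⟨H, fun s => ?_⟩
  have := hH s
  cases hs : G.white s
  · rw [leftOf_black hs, rightOf_black hs]
    simp only [hs, Bool.false_eq_true, if_false] at this
    linarith
  · rw [leftOf_white hs, rightOf_white hs]
    simpa only [hs, if_true] using this

theorem quadVertex_induction {P : G.QuadVertex → Prop}
    (h : ∀ s, P (G.leftOf s) ↔ P (G.rightOf s)) {q : G.QuadVertex} (hq : P q)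
    (r : G.QuadVertex) : P r := by
  refine G.planar.vertex_face_induction (fun d => ?_) hq r
  have := h d
  cases hd : G.white d
  · rw [leftOf_black hd, rightOf_black hd] at this
    exact this.symm
  · rwa [leftOf_white hd, rightOf_white hd] at this

theorem IsPotential.eventually_const {H : G.QuadVertex → ℤ} {z : D → ℤ} (h : G.IsPotential H z)
    (hz : z.support.Finite) : ∃ c, ∀ᶠ q in Filter.cofinite, H q = c := by
  refine G.planar.eventually_const (hz.subset fun d hd => ?_)
  simp only [Set.mem_ofPred_eq] at hd
  rw [Function.mem_support, ← h d]
  cases hs : G.white d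
  · rw [leftOf_black hs, rightOf_black hs]
    exact fun h0 => hd (by linarith)
  · rw [leftOf_white hs, rightOf_white hs]
    exact fun h0 => hd (by linarith)

/-- A potential is constant on each side along a train-track, where the latter crosses strands on
which the jump vanishes. -/
theorem IsPotential.nextStrand {H : G.QuadVertex → ℤ} {z : D → ℤ} (h : G.IsPotential H z) {u : D}
    (hin : ∀ w, G.exitEdge w = G.exitEdge u → w ≠ u → z w = 0)
    (hout : ∀ w, G.entryEdge w = G.exitEdge u → w ≠ G.nextStrand u → z w = 0) :
    H (G.leftOf (G.nextStrand u)) = H (G.leftOf u) ∧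
      H (G.rightOf (G.nextStrand u)) = H (G.rightOf u) := by
  obtain ⟨e, he⟩ : ∃ e, e = G.exitEdge u := ⟨_, rfl⟩
  have hew : G.white e = true := he ▸ white_exitEdge u
  have hrw : G.white (G.rev e) = false := by rw [G.white_rev, hew]; rfl
  have hsw : G.white (G.rot.symm e) = true := by rw [white_rot_symm, hew]
  have hsr : G.white (G.rot.symm (G.rev e)) = false := by rw [white_rot_symm, hrw]
  rw [← he] at hin hout
  have b1 := h.black hrw
  have b2 := h.black hsr
  have w1 := h.white hew
  have w2 := h.white hsw
  rw [PlaneMap.vertexOf_rot_symm, PlaneMap.faceOf_rot_symm] at b2 w2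
  rw [G.rev_rev] at b2
  rcases (exitEdge_eq_iff hew u).1 he.symm with rfl | rfl
  · have h1 := hin (G.rev e) ((exitEdge_eq_iff hew _).2 (Or.inr rfl))
      (ne_of_white_ne (G := G) (by simp [hrw, hsw]))
    have h2 := hout e ((entryEdge_eq_iff hew _).2 (Or.inl rfl))
      (ne_of_white_ne (G := G) (by simp [white_nextStrand, hew, hsw]))
    rw [nextStrand_rot_symm hew, leftOf_black hsr, rightOf_black hsr, leftOf_white hsw,
      rightOf_white hsw, PlaneMap.vertexOf_rot_symm, PlaneMap.vertexOf_rot_symm,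
      PlaneMap.faceOf_rot_symm, PlaneMap.faceOf_rot_symm, G.rev_rev]
    constructor <;> linarith
  · have h1 := hin (G.rot.symm e) ((exitEdge_eq_iff hew _).2 (Or.inl rfl))
      (ne_of_white_ne (G := G) (by simp [hrw, hsw]))
    have h2 := hout (G.rot.symm (G.rev e)) ((entryEdge_eq_iff hew _).2 (Or.inr rfl))
      (ne_of_white_ne (G := G) (by simp [white_nextStrand, hrw, hsr]))
    rw [nextStrand_rev hew, leftOf_white hew, rightOf_white hew, leftOf_black hrw,
      rightOf_black hrw]
    constructor <;> linarith

/-! ### Forward rays of train-tracks -/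

open Classical in
variable (G) in
/-- The indicator function of the strands following a given one on its train-track, including
itself. -/
noncomputable def ray (s u : D) : ℤ := if ∃ n : ℕ, (G.nextStrand ^ n) s = u then 1 else 0

theorem ray_eq_one {s u : D} (n : ℕ) (h : (G.nextStrand ^ n) s = u) : G.ray s u = 1 :=
  if_pos ⟨n, h⟩

theorem ray_self (s : D) : G.ray s s = 1 := ray_eq_one 0 rfl

theorem ray_eq_zero {s u : D} (h : ∀ n : ℕ, (G.nextStrand ^ n) s ≠ u) : G.ray s u = 0 :=
  if_neg fun ⟨n, hn⟩ => h n hn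

theorem SameTrack.pow (s : D) (n : ℕ) : G.SameTrack s ((G.nextStrand ^ n) s) := ⟨n, by simp⟩

theorem ray_eq_zero_of_not_sameTrack {s u : D} (h : ¬G.SameTrack s u) : G.ray s u = 0 :=
  ray_eq_zero fun n hn => h (hn ▸ SameTrack.pow s n)

theorem NoTrackLoops.pow_injective (hl : G.NoTrackLoops) (s : D) :
    Function.Injective fun n : ℕ => (G.nextStrand ^ n) s := by
  have key : ∀ m n : ℕ, m < n → (G.nextStrand ^ m) s ≠ (G.nextStrand ^ n) s := by
    intro m n hmn h
    refine hl ((G.nextStrand ^ m) s) (n - m) (by omega) ?_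
    rw [← Equiv.Perm.mul_apply, ← pow_add, Nat.sub_add_cancel hmn.le, h]
  intro m n h
  rcases lt_trichotomy m n with hmn | hmn | hmn
  · exact absurd h (key m n hmn)
  · exact hmn
  · exact absurd h.symm (key n m hmn)

theorem ray_add_ite_eq [DecidableEq D] (hl : G.NoTrackLoops) (s u : D) :
    G.ray s u = (if u = s then 1 else 0) + G.ray (G.nextStrand s) u := by
  by_cases hu : u = s
  · subst hu
    rw [ray_self, if_pos rfl, ray_eq_zero, add_zero]
    intro n hn
    rw [← Equiv.Perm.mul_apply, ← pow_succ] at hn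
    exact hl u (n + 1) (by omega) hn
  · rw [if_neg hu, zero_add]
    by_cases h : ∃ n : ℕ, (G.nextStrand ^ n) (G.nextStrand s) = u
    · obtain ⟨n, hn⟩ := h
      rw [ray_eq_one n hn, ray_eq_one (n + 1)]
      rw [pow_succ, Equiv.Perm.mul_apply, hn]
    · rw [ray_eq_zero (s := G.nextStrand s) fun n hn => h ⟨n, hn⟩, ray_eq_zero]
      rintro (_ | n) hn
      · exact hu hn.symm
      · rw [pow_succ, Equiv.Perm.mul_apply] at hn
        exact h ⟨n, hn⟩

theorem ray_nextStrand_right [DecidableEq D] (hl : G.NoTrackLoops) (s u : D) :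
    G.ray s (G.nextStrand u) = G.ray s u + if G.nextStrand u = s then 1 else 0 := by
  by_cases hu : G.nextStrand u = s
  · subst hu
    rw [if_pos rfl, ray_self, ray_eq_zero, zero_add]
    intro n hn
    rw [← Equiv.Perm.mul_apply, ← pow_succ] at hn
    exact hl u (n + 1) (by omega) hn
  · rw [if_neg hu, add_zero]
    by_cases h : ∃ n : ℕ, (G.nextStrand ^ n) s = u
    · obtain ⟨n, hn⟩ := h
      rw [ray_eq_one n hn, ray_eq_one (n + 1)]
      rw [pow_succ', Equiv.Perm.mul_apply, hn]
    · rw [ray_eq_zero (u := u) fun n hn => h ⟨n, hn⟩, ray_eq_zero]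
      rintro (_ | n) hn
      · exact hu hn.symm
      · rw [pow_succ', Equiv.Perm.mul_apply] at hn
        exact h ⟨n, G.nextStrand.injective hn⟩

/-- Without loops, a ray goes through each of its strands once and never ends, so its boundary is
its starting edge alone. -/
theorem boundary_ray [DecidableEq D] (hl : G.NoTrackLoops) (s : D) {e : D}
    (he : G.white e = true) :
    G.boundary (G.ray s) e = if G.entryEdge s = e then 1 else 0 := by
  have h1 := ray_nextStrand_right hl s (G.rev e)
  have h2 := ray_nextStrand_right hl s (G.rot.symm e)
  rw [nextStrand_rev he] at h1
  rw [nextStrand_rot_symm he] at h2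
  have hne : e ≠ G.rot.symm (G.rev e) :=
    ne_of_white_ne (G := G) (by simp [white_rot_symm, G.white_rev])
  rw [boundary, h1, h2, if_congr (entryEdge_eq_iff he s) rfl rfl]
  by_cases h3 : e = s
  · subst h3
    simp [hne.symm]
  · by_cases h4 : G.rot.symm (G.rev e) = s
    · subst h4
      simp [h3]
      ring
    · simp [h3, h4, Ne.symm h3, Ne.symm h4]

theorem boundary_single [DecidableEq D] (u : D) {e : D} (he : G.white e = true) :
    G.boundary (Pi.single u 1) e =
      (if G.entryEdge u = e then 1 else 0) - if G.exitEdge u = e then 1 else 0 := by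
  have hew := he
  have hrw : G.white (G.rev e) = false := by rw [G.white_rev, hew]; rfl
  have hsw : G.white (G.rot.symm e) = true := by rw [white_rot_symm, hew]
  have hsr : G.white (G.rot.symm (G.rev e)) = false := by rw [white_rot_symm, hrw]
  have n1 : e ≠ G.rot.symm (G.rev e) := ne_of_white_ne (G := G) (by simp [hew, hsr])
  have n2 : G.rot.symm e ≠ G.rev e := ne_of_white_ne (G := G) (by simp [hsw, hrw])
  rw [if_congr (entryEdge_eq_iff he u) rfl rfl, if_congr (exitEdge_eq_iff he u) rfl rfl, boundary]
  simp only [Pi.single_apply, eq_comm (a := u)]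
  have key : ∀ (p q : Prop) [Decidable p] [Decidable q], ¬(p ∧ q) →
      (if p ∨ q then (1 : ℤ) else 0) = (if p then 1 else 0) + if q then 1 else 0 := by
    intro p q _ _ h
    by_cases hp : p <;> by_cases hq : q <;> simp_all
  rw [key _ _ (by rintro ⟨h, h'⟩; exact n1 (h.trans h'.symm)),
    key _ _ (by rintro ⟨h, h'⟩; exact n2 (h.trans h'.symm))]
  ring

theorem finite_sides (q : G.QuadVertex) : {s | G.leftOf s = q ∨ G.rightOf s = q}.Finite := by
  rcases q with q | q <;> induction q using Quotient.inductionOn with | h d => ?_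
  · refine (G.planar.vertex_finite d).subset fun s hs => ?_
    have : G.vertexOf s = G.vertexOf d := by
      cases hw : G.white s <;> simp [leftOf, rightOf, hw] at hs <;> exact Sum.inl_injective hs
    exact (PlaneMap.vertexOf_eq_iff.1 this).symm
  · refine (G.planar.face_finite d).subset fun s hs => ?_
    have : G.faceOf s = G.faceOf d := by
      cases hw : G.white s <;> simp [leftOf, rightOf, hw] at hs <;> exact Sum.inr_injective hs
    exact (PlaneMap.faceOf_eq_iff.1 this).symm

/-- A train-track escapes to infinity: its strands are all distinct and each vertex of the
quad-graph has finitely many strands beside it. -/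
theorem NoTrackLoops.tendsto_leftOf (hl : G.NoTrackLoops) (s : D) :
    Filter.Tendsto (fun n : ℕ => G.leftOf ((G.nextStrand ^ n) s)) Filter.cofinite
      Filter.cofinite := by
  have h : Filter.Tendsto G.leftOf Filter.cofinite Filter.cofinite := fun _ hs =>
    Filter.Tendsto.cofinite_of_finite_preimage_singleton
      (fun q => ((finite_sides q).subset fun _ h => Or.inl h)) hs
  exact h.comp (hl.pow_injective s).tendsto_cofinite

/-- Rays of the same train-track coincide up to finitely many strands. -/
theorem SameTrack.finite_ray_sub (hl : G.NoTrackLoops) {s t : D} (h : G.SameTrack s t) :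
    (G.ray s - G.ray t).support.Finite := by
  classical
  have key : ∀ (n : ℕ) (s : D), (G.ray s - G.ray ((G.nextStrand ^ n) s)).support.Finite := by
    intro n
    induction n with
    | zero => intro s; simp
    | succ n ih =>
      intro s
      refine ((Set.finite_singleton s).union (ih (G.nextStrand s))).subset fun u hu => ?_
      rw [Function.mem_support, Pi.sub_apply, ray_add_ite_eq hl, pow_succ,
        Equiv.Perm.mul_apply] at hu
      by_cases hus : u = s
      · exact Or.inl hus
      · right
        rw [Function.mem_support, Pi.sub_apply]
        simpa [hus] using hu
  obtain ⟨i, rfl⟩ := h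
  obtain ⟨n, rfl | rfl⟩ := i.eq_nat_or_neg
  · simpa using key n s
  · have := key n ((G.nextStrand ^ (-n : ℤ)) s)
    rw [zpow_neg, zpow_natCast, ← Equiv.Perm.mul_apply, mul_inv_cancel, Equiv.Perm.one_apply,
      ← Function.support_neg, neg_sub] at this
    simpa using this

/-- The strands `rot.symm d` and `d` are on the two train-tracks crossing at the edge of `d`. They
are different strands since the degree is not one, so the vertex condition separates their
train-tracks. -/
theorem not_sameTrack_rot_symm (hdeg : G.NoDegreeOne) (hvertex : G.VertexCondition) (d : D) :
    ¬G.SameTrack (G.rot.symm d) d := by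
  refine (hvertex d).1 _ ?_ _ (Equiv.Perm.SameCycle.refl _ _) fun h => hdeg d ?_
  · exact (PlaneMap.vertexOf_eq_iff.1 (PlaneMap.vertexOf_rot_symm d)).symm
  · rw [Equiv.symm_apply_eq] at h
    exact h.symm

theorem SameTrack.nextStrand_right (s : D) : G.SameTrack s (G.nextStrand s) := ⟨1, by simp⟩

theorem sameTrack_rev {e : D} (he : G.white e = true) : G.SameTrack (G.rev e) e := by
  have := SameTrack.nextStrand_right (G := G) (G.rev e)
  rwa [nextStrand_rev he] at this

theorem sameTrack_rot_symm {e : D} (he : G.white e = true) :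
    G.SameTrack (G.rot.symm e) (G.rot.symm (G.rev e)) := by
  have := SameTrack.nextStrand_right (G := G) (G.rot.symm e)
  rwa [nextStrand_rot_symm he] at this

theorem not_sameTrack_incoming (hd : ∀ d, ¬G.SameTrack (G.rot.symm d) d) {e : D}
    (he : G.white e = true) : ¬G.SameTrack (G.rot.symm e) (G.rev e) := fun h =>
  hd e (Equiv.Perm.SameCycle.trans h (sameTrack_rev he))

theorem not_sameTrack_outgoing (hd : ∀ d, ¬G.SameTrack (G.rot.symm d) d) {e : D}
    (he : G.white e = true) : ¬G.SameTrack (G.rot.symm (G.rev e)) e := fun h =>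
  hd e (Equiv.Perm.SameCycle.trans (sameTrack_rot_symm he) h)

/-- Train-tracks do not intersect themselves. -/
theorem eq_of_exitEdge_eq (hd : ∀ d, ¬G.SameTrack (G.rot.symm d) d) {s t : D}
    (h : G.SameTrack s t) (he : G.exitEdge s = G.exitEdge t) : s = t := by
  have hw := white_exitEdge (G := G) t
  have hn := not_sameTrack_incoming hd hw
  rcases (exitEdge_eq_iff hw s).1 he with h1 | h1 <;>
    rcases (exitEdge_eq_iff hw t).1 rfl with h2 | h2
  · rw [h1, ← h2]
  · rw [h1, h2] at h
    rw [← h2] at h hn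
    exact absurd h hn
  · rw [h1, h2] at h
    rw [← h2] at h hn
    exact absurd h.symm hn
  · rw [h1, ← h2]

theorem eq_of_entryEdge_eq (hd : ∀ d, ¬G.SameTrack (G.rot.symm d) d) {s t : D}
    (h : G.SameTrack s t) (he : G.entryEdge s = G.entryEdge t) : s = t := by
  obtain ⟨s', rfl⟩ := G.nextStrand.surjective s
  obtain ⟨t', rfl⟩ := G.nextStrand.surjective t
  rw [entryEdge_nextStrand, entryEdge_nextStrand] at he
  congr 1
  refine eq_of_exitEdge_eq hd ?_ he
  exact (SameTrack.nextStrand_right s').trans (h.trans (SameTrack.nextStrand_right t').symm)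

/-! ### The wedge between the two rays issuing from an edge -/

variable (G) in
/-- A family of potentials indexed by the edges: that of an edge `d` (with white origin) jumps across
the two parts of train-tracks following `d`, and vanishes on the three faces of the graph of
train-tracks around `d` that are not between these two parts. -/
structure IsEdgePotential (h : D → G.QuadVertex → ℤ) : Prop where
  isPotential : ∀ d, G.white d = true →
    G.IsPotential (h d) (G.ray (G.rot.symm (G.rev d)) - G.ray d)
  vertexOf_white : ∀ d, G.white d = true → h d (.inl (G.vertexOf d)) = 0
  rev : ∀ d, h (G.rev d) = h d

theorem isCycle_ray_sub_ray (hl : G.NoTrackLoops) (d : D) (hd : G.white d = true) :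
    G.IsCycle (G.ray (G.rot.symm (G.rev d)) - G.ray d) := by
  classical
  intro e he
  rw [boundary_sub, boundary_ray hl _ he, boundary_ray hl _ he,
    (entryEdge_eq_iff hd (G.rot.symm (G.rev d))).2 (Or.inr rfl),
    (entryEdge_eq_iff hd d).2 (Or.inl rfl), sub_self]

theorem exists_isEdgePotential (hl : G.NoTrackLoops) : ∃ h, G.IsEdgePotential h := by
  have key : ∀ d, ∃ H, G.white d = true → G.IsPotential H (G.ray (G.rot.symm (G.rev d)) - G.ray d)
      ∧ H (.inl (G.vertexOf d)) = 0 := by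
    intro d
    by_cases hd : G.white d = true
    · obtain ⟨H, hH⟩ := (isCycle_ray_sub_ray hl d hd).exists_potential
      refine ⟨fun q => H q - H (.inl (G.vertexOf d)), fun _ => ⟨fun s => ?_, sub_self _⟩⟩
      rw [← hH s]
      ring
    · exact ⟨0, fun h => absurd h hd⟩
  choose k hk using key
  refine ⟨fun d => if G.white d then k d else k (G.rev d), fun d hd => ?_, fun d hd => ?_,
    fun d => ?_⟩
  · simpa only [hd, if_true] using (hk d hd).1
  · simpa only [hd, if_true] using (hk d hd).2
  · cases hd : G.white d <;> simp [G.white_rev, hd, G.rev_rev]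

namespace IsEdgePotential

variable {h : D → G.QuadVertex → ℤ}

theorem isPotential_black (hh : G.IsEdgePotential h) {d : D} (hb : G.white d = false) :
    G.IsPotential (h d) (G.ray (G.rot.symm d) - G.ray (G.rev d)) := by
  have := hh.isPotential (G.rev d) (by rw [G.white_rev, hb]; rfl)
  rwa [hh.rev, G.rev_rev] at this

/-- The corner `d` is itself the first strand of one of the two rays, and the other ray, being on
another train-track, avoids it; so exactly one unit is gained from the vertex to the face. -/
theorem faceOf_white (hh : G.IsEdgePotential h) (hd : ∀ d, ¬G.SameTrack (G.rot.symm d) d) {d : D}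
    (hw : G.white d = true) : h d (.inr (G.faceOf d)) = 1 := by
  have h1 := (hh.isPotential d hw).white hw
  rw [hh.vertexOf_white d hw, Pi.sub_apply, ray_self,
    ray_eq_zero_of_not_sameTrack (not_sameTrack_outgoing hd hw)] at h1
  linarith

theorem vertexOf (hh : G.IsEdgePotential h) (hd : ∀ d, ¬G.SameTrack (G.rot.symm d) d) (d : D) :
    h d (.inl (G.vertexOf d)) = 0 := by
  cases hw : G.white d
  · have hr : G.white (G.rev d) = true := by rw [G.white_rev, hw]; rfl
    have h1 := (hh.isPotential_black hw).black (d := G.rot.symm d) (by rw [white_rot_symm, hw])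
    have h2 := not_sameTrack_outgoing hd hr
    rw [G.rev_rev] at h2
    rw [PlaneMap.vertexOf_rot_symm, PlaneMap.faceOf_rot_symm, Pi.sub_apply, ray_self,
      ray_eq_zero_of_not_sameTrack (fun h => h2 h.symm), ← hh.rev d, hh.faceOf_white hd hr] at h1
    rw [← hh.rev d]
    linarith
  · exact hh.vertexOf_white d hw

theorem faceOf_black (hh : G.IsEdgePotential h) (hl : G.NoTrackLoops)
    (hd : ∀ d, ¬G.SameTrack (G.rot.symm d) d) {d : D}
    (hb : G.white d = false) : h d (.inr (G.faceOf d)) = 0 := by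
  classical
  have hr : G.white (G.rev d) = true := by rw [G.white_rev, hb]; rfl
  have h1 := (hh.isPotential_black hb).black hb
  have h2 := not_sameTrack_outgoing hd hr
  rw [G.rev_rev] at h2
  have h3 := nextStrand_of_black hb
  have h4 : G.ray (G.rot.symm d) d = 0 := ray_eq_zero_of_not_sameTrack fun h => hd d h
  have h5 := ray_add_ite_eq hl d d
  rw [ray_self, if_pos rfl, h3] at h5
  rw [hh.vertexOf hd, Pi.sub_apply, h4] at h1
  linarith

/-- The wedges around a vertex tile the plane: a ray bounding one wedge also bounds the neighbouring
one, up to its first strand. What remains of the jumps is the circuit of strands around the vertex,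
and all the functions vanish at the vertex itself. -/
theorem sum_vertex (hh : G.IsEdgePotential h) (hl : G.NoTrackLoops)
    (hd : ∀ d, ¬G.SameTrack (G.rot.symm d) d) {d : D} {S : Finset D}
    (hS : ∀ e, e ∈ S ↔ G.SameVertex d e) {q : G.QuadVertex} (hq : q ≠ .inl (G.vertexOf d)) :
    ∑ e ∈ S, h e q = 1 := by
  classical
  have hSv : ∀ e, e ∈ S ↔ G.vertexOf e = G.vertexOf d := fun e => by
    rw [hS, PlaneMap.vertexOf_eq_iff, PlaneMap.SameVertex, PlaneMap.SameVertex,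
      Equiv.Perm.sameCycle_comm]
  have hSrot : ∀ e, e ∈ S ↔ G.rot e ∈ S := fun e => by
    rw [hSv, hSv, PlaneMap.vertexOf_rot]
  have hwS : ∀ e, e ∈ S → G.white d = G.white e := fun e he =>
    Equiv.Perm.SameCycle.apply_eq_of_invariant G.white_rot ((hS e).1 he)
  have hsum : ∀ s, ∑ e ∈ S, (h e (G.leftOf s) - h e (G.rightOf s)) =
      if s ∈ S then (if G.white d then -1 else 1) else 0 := by
    intro s
    cases hw : G.white d
    · have h1 : ∑ e ∈ S, G.ray (G.rot.symm e) s = ∑ e ∈ S, G.ray e s :=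
        Finset.sum_equiv G.rot.symm (fun e => by rw [hSrot (G.rot.symm e)]; simp) (fun _ _ => rfl)
      have h2 : ∑ e ∈ S, (h e (G.leftOf s) - h e (G.rightOf s)) =
          ∑ e ∈ S, (G.ray (G.rot.symm e) s - G.ray e s + if s = e then 1 else 0) := by
        refine Finset.sum_congr rfl fun e he => ?_
        have hb : G.white e = false := by rw [← hwS e he, hw]
        rw [hh.isPotential_black hb s, Pi.sub_apply, ray_add_ite_eq hl e, nextStrand_of_black hb]
        ring
      rw [h2, Finset.sum_add_distrib, Finset.sum_sub_distrib, h1]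
      simp
    · have h1 : ∑ e ∈ S, G.ray (G.nextStrand e) s = ∑ e ∈ S, G.ray (G.rot.symm (G.rev e)) s :=
        Finset.sum_equiv G.rot hSrot fun e he => by
          rw [nextStrand_of_white (by rw [← hwS e he, hw])]
      have h2 : ∑ e ∈ S, (h e (G.leftOf s) - h e (G.rightOf s)) =
          ∑ e ∈ S, (G.ray (G.rot.symm (G.rev e)) s - G.ray (G.nextStrand e) s -
            if s = e then 1 else 0) := by
        refine Finset.sum_congr rfl fun e he => ?_
        rw [hh.isPotential e (by rw [← hwS e he, hw]) s, Pi.sub_apply, ray_add_ite_eq hl e]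
        ring
      rw [h2, Finset.sum_sub_distrib, Finset.sum_sub_distrib, h1]
      by_cases hs : s ∈ S <;> simp [hs]
  have hconst : ∀ r, ∑ e ∈ S, h e r + (if r = .inl (G.vertexOf d) then 1 else 0) = 1 := by
    refine quadVertex_induction (fun s => ?_) (q := .inl (G.vertexOf d)) ?_
    · have h1 := hsum s
      rw [Finset.sum_sub_distrib] at h1
      suffices h2 : ((if G.leftOf s = .inl (G.vertexOf d) then 1 else 0) : ℤ) -
          (if G.rightOf s = .inl (G.vertexOf d) then 1 else 0) =
          -(if s ∈ S then (if G.white d then -1 else 1) else 0) by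
        constructor <;> intro h3 <;> linarith
      by_cases hs : s ∈ S
      · have h3 := hwS s hs
        have h4 := (hSv s).1 hs
        cases hw : G.white s
        · rw [leftOf_black hw, rightOf_black hw, h4]
          simp [hs, h3, hw]
        · rw [leftOf_white hw, rightOf_white hw, h4]
          simp [hs, h3, hw]
      · have h4 : G.vertexOf s ≠ G.vertexOf d := fun h => hs ((hSv s).2 h)
        cases hw : G.white s
        · rw [leftOf_black hw, rightOf_black hw]
          simp [hs, h4]
        · rw [leftOf_white hw, rightOf_white hw]
          simp [hs, h4]
    · rw [if_pos rfl, Finset.sum_eq_zero, zero_add]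
      intro e he
      rw [← (hSv e).1 he]
      exact hh.vertexOf hd e
  simpa [hq] using hconst q

/-- As around a vertex, the rays cancel between consecutive sides of the face and leave the circuit
of its strands. At the face itself, a white dart contributes 1 and a black one 0; one unit is lost
when leaving it. -/
theorem sum_face (hh : G.IsEdgePotential h) (hl : G.NoTrackLoops)
    (hd : ∀ d, ¬G.SameTrack (G.rot.symm d) d) {d : D} {S : Finset D}
    (hS : ∀ e, e ∈ S ↔ G.SameFace d e) {q : G.QuadVertex} (hq : q ≠ .inr (G.faceOf d)) :
    ∑ e ∈ S, h e q = ∑ e ∈ S, (if G.white e then 0 else 1) - 1 := by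
  classical
  have hSv : ∀ e, e ∈ S ↔ G.faceOf e = G.faceOf d := fun e => by
    rw [hS, PlaneMap.faceOf_eq_iff, PlaneMap.SameFace, PlaneMap.SameFace,
      Equiv.Perm.sameCycle_comm]
  have hSn : ∀ e, e ∈ S ↔ G.faceNext e ∈ S := fun e => by
    rw [hSv, hSv, PlaneMap.faceOf_faceNext]
  have hwn : ∀ e, G.white (G.faceNext e) = !G.white e := fun e => by
    rw [PlaneMap.faceNext_apply, white_rot_symm, G.white_rev]
  have hsum : ∀ s, ∑ e ∈ S, (h e (G.leftOf s) - h e (G.rightOf s)) =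
      if s ∈ S then (if G.white s then -1 else 1) else 0 := by
    intro s
    have h1 : ∑ e ∈ S, (G.ray e s - if s = e then (if G.white e then 1 else 0) else 0) =
        ∑ e ∈ S, (G.ray (G.faceNext e) s -
          if s = G.faceNext e then (if G.white (G.faceNext e) then 1 else 0) else 0) :=
      (Finset.sum_equiv G.faceNext hSn fun e he => rfl).symm
    have h2 : ∑ e ∈ S, (h e (G.leftOf s) - h e (G.rightOf s)) =
        ∑ e ∈ S, ((G.ray (G.faceNext e) s -
          (if s = G.faceNext e then (if G.white (G.faceNext e) then 1 else 0) else 0)) -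
          (G.ray e s - if s = e then (if G.white e then 0 else 1) else 0)) := by
      refine Finset.sum_congr rfl fun e he => ?_
      have hwn' := hwn e
      cases hw : G.white e
      · rw [hw] at hwn'
        rw [hh.isPotential_black hw s, Pi.sub_apply, ray_add_ite_eq hl e, nextStrand_of_black hw,
          ray_add_ite_eq hl (G.faceNext e), nextStrand_of_white hwn', PlaneMap.rot_faceNext,
          G.rev_rev]
        simp [hwn']
      · rw [hw] at hwn'
        have hwn'' : G.white (G.faceNext e) = false := by rw [hwn']; rfl
        rw [hh.isPotential e hw s, hwn'']
        simp [PlaneMap.faceNext_apply]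
    have h3 : (if s ∈ S then (if G.white s then -1 else 1) else 0 : ℤ) =
        ∑ e ∈ S, if s = e then (if G.white e then -1 else 1) else 0 := by simp
    rw [h2, Finset.sum_sub_distrib, ← h1, ← Finset.sum_sub_distrib, h3]
    refine Finset.sum_congr rfl fun e he => ?_
    by_cases hse : s = e
    · subst hse
      cases hw : G.white s <;> simp
    · simp [hse]
  have hcount : ∑ e ∈ S, (if G.white e then (1 : ℤ) else 0) =
      ∑ e ∈ S, (if G.white e then 0 else 1) :=
    (Finset.sum_equiv G.faceNext hSn fun e he => by
      rw [hwn]; cases hw : G.white e <;> simp).symm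
  have hconst : ∀ r, ∑ e ∈ S, h e r - (if r = .inr (G.faceOf d) then 1 else 0) =
      ∑ e ∈ S, (if G.white e then 0 else 1) - 1 := by
    refine quadVertex_induction (fun s => ?_) (q := .inr (G.faceOf d)) ?_
    · have h1 := hsum s
      rw [Finset.sum_sub_distrib] at h1
      suffices h2 : ((if G.leftOf s = .inr (G.faceOf d) then 1 else 0) : ℤ) -
          (if G.rightOf s = .inr (G.faceOf d) then 1 else 0) =
          if s ∈ S then (if G.white s then -1 else 1) else 0 by
        constructor <;> intro h3 <;> linarith
      by_cases hs : s ∈ S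
      · have h4 := (hSv s).1 hs
        cases hw : G.white s
        · rw [leftOf_black hw, rightOf_black hw, h4]
          simp [hs]
        · rw [leftOf_white hw, rightOf_white hw, h4]
          simp [hs]
      · have h4 : G.faceOf s ≠ G.faceOf d := fun h => hs ((hSv s).2 h)
        cases hw : G.white s
        · rw [leftOf_black hw, rightOf_black hw]
          simp [hs, h4]
        · rw [leftOf_white hw, rightOf_white hw]
          simp [hs, h4]
    · rw [if_pos rfl, ← hcount, sub_left_inj]
      refine Finset.sum_congr rfl fun e he => ?_
      rw [← (hSv e).1 he]
      cases hw : G.white e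
      · rw [hh.faceOf_black hl hd hw]; rfl
      · rw [hh.faceOf_white hd hw]; rfl
  simpa [hq] using hconst q

end IsEdgePotential

end BipartitePlaneGraph

/-! ### Connecting chains inside a disc -/

theorem Equiv.Perm.SameCycle.exists_pow_eq_of_finite {D : Type*} {σ : Equiv.Perm D} {d e : D}
    (h : σ.SameCycle d e) (hfin : {e | σ.SameCycle d e}.Finite) : ∃ n : ℕ, (σ ^ n) d = e := by
  classical
  by_contra hne
  have h2 := Equiv.Perm.sum_cycle_eq_sum_range (σ := σ) (d := d) (S := hfin.toFinset) (by simp)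
    (fun x => if x = e then 1 else 0)
  rw [Finset.sum_ite_eq' hfin.toFinset, if_pos (by simpa using h),
    Finset.sum_eq_zero (fun i _ => if_neg fun hi => hne ⟨i, hi⟩)] at h2
  exact one_ne_zero h2

namespace BipartitePlaneGraph

variable {D : Type*} {G : BipartitePlaneGraph D}

theorem exitEdge_mem_quads (B : G.Disc) (s : D) :
    G.exitEdge s ∈ B.quads ↔ if G.white s then G.rot s ∈ B.quads else s ∈ B.quads := by
  rw [exitEdge]
  cases hs : G.white s <;> simp [B.rev_mem]

theorem entryEdge_mem_quads (B : G.Disc) (s : D) :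
    G.entryEdge s ∈ B.quads ↔ if G.white s then s ∈ B.quads else G.rot s ∈ B.quads := by
  rw [entryEdge]
  cases hs : G.white s <;> simp [B.rev_mem]

variable (G) in
/-- The white dart of the edge of a dart. -/
def whiteDart (d : D) : D := if G.white d then d else G.rev d

/-- Two edges of a disc are joined by a chain of strands inside the disc. -/
def Linked (B : G.Disc) (x y : D) : Prop :=
  ∃ Q : D → ℤ, (∀ u, Q u ≠ 0 → u ∈ B.quads ∧ G.rot u ∈ B.quads) ∧
    ∀ e, G.white e = true → ∀ [DecidableEq D], G.boundary Q e =
      (if G.whiteDart x = e then 1 else 0) - if G.whiteDart y = e then 1 else 0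

theorem Linked.refl (B : G.Disc) (x : D) : Linked B x x :=
  ⟨0, by simp, fun e _ _ => by simp [boundary]⟩

theorem Linked.symm {B : G.Disc} {x y : D} (h : Linked B x y) : Linked B y x := by
  obtain ⟨Q, h1, h2⟩ := h
  refine ⟨0 - Q, fun u hu => h1 u (by simpa using hu), fun e he _ => ?_⟩
  rw [boundary_sub, h2 e he]
  simp [boundary]

theorem Linked.trans {B : G.Disc} {x y w : D} (h : Linked B x y) (h' : Linked B y w) :
    Linked B x w := by
  obtain ⟨Q, h1, h2⟩ := h
  obtain ⟨Q', h1', h2'⟩ := h'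
  refine ⟨Q + Q', fun u hu => ?_, fun e he _ => ?_⟩
  · by_cases h0 : Q u = 0
    · exact h1' u (by simpa [h0] using hu)
    · exact h1 u h0
  · rw [boundary_add, h2 e he, h2' e he]
    ring

theorem Linked.rev (B : G.Disc) (x : D) : Linked B x (G.rev x) := by
  have : G.whiteDart (G.rev x) = G.whiteDart x := by
    rw [whiteDart, whiteDart, G.white_rev, G.rev_rev]
    cases G.white x <;> rfl
  refine ⟨0, by simp, fun e _ _ => by rw [this]; simp [boundary]⟩

theorem Linked.rot {B : G.Disc} {x : D} (h1 : x ∈ B.quads) (h2 : G.rot x ∈ B.quads) :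
    Linked B x (G.rot x) := by
  classical
  cases hx : G.white x
  · suffices h : Linked B (G.rot x) x from h.symm
    refine ⟨Pi.single x 1, fun u hu => ?_, fun e he _ => ?_⟩
    · obtain rfl : u = x := by
        by_contra h; simp [h] at hu
      exact ⟨h1, h2⟩
    · convert boundary_single x he using 3
      · simp [whiteDart, entryEdge, G.white_rot, hx]
      · simp [whiteDart, exitEdge, hx]
  · refine ⟨Pi.single x 1, fun u hu => ?_, fun e he _ => ?_⟩
    · obtain rfl : u = x := by
        by_contra h; simp [h] at hu
      exact ⟨h1, h2⟩
    · convert boundary_single x he using 3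
      · simp [whiteDart, entryEdge, hx]
      · simp [whiteDart, exitEdge, G.white_rot, hx]

/-- Turn around the boundary vertex through the inside of the disc. The boundary walk being simple,
no other boundary corner interrupts the rotation before `bdry (2 * i)`. -/
theorem linked_vertex (B : G.Disc) {i : ℕ} (hi : i < B.len) :
    Linked B (G.rot (B.bdry (2 * i + 1))) (B.bdry (2 * i)) := by
  classical
  set x := G.rot (B.bdry (2 * i + 1)) with hx
  have hsame : G.SameVertex x (B.bdry (2 * i)) := by
    rw [← PlaneMap.vertexOf_eq_iff, hx, PlaneMap.vertexOf_rot, PlaneMap.vertexOf_eq_iff]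
    exact (B.vertex_step i hi).symm
  have hex := Equiv.Perm.SameCycle.exists_pow_eq_of_finite hsame (G.planar.vertex_finite x)
  set n := Nat.find hex with hn
  have hnn : (G.rot ^ n) x = B.bdry (2 * i) := Nat.find_spec hex
  have key : ∀ k ≤ n, (G.rot ^ k) x ∈ B.quads ∧ Linked B x ((G.rot ^ k) x) := by
    intro k
    induction k with
    | zero => exact fun _ => ⟨(B.left_odd i hi).1, Linked.refl B x⟩
    | succ k ih =>
      intro hk
      obtain ⟨h1, h2⟩ := ih (by omega)
      have h3 : G.rot ((G.rot ^ k) x) ∈ B.quads := by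
        by_contra h3
        obtain ⟨j, hj, hj'⟩ := B.complete _ (fun h => h3 (h.1 h1))
        obtain ⟨j', rfl | rfl⟩ : ∃ j', j = 2 * j' ∨ j = 2 * j' + 1 := ⟨j / 2, by omega⟩
        · have h4 : j' = i := by
            refine B.vertex_simple j' (by omega) i hi ?_
            rw [hj']
            exact Equiv.Perm.SameCycle.trans ⟨-k, by simp⟩ hsame
          subst h4
          exact Nat.find_min hex (show k < n by omega) hj'.symm
        · refine (B.left_odd j' (by omega)).2 ?_
          rw [hj']
          exact h1
      rw [pow_succ', Equiv.Perm.mul_apply]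
      exact ⟨h3, h2.trans (Linked.rot h1 h3)⟩
  rw [← hnn]
  exact (key n le_rfl).2

theorem disc_bdry_even (B : G.Disc) {k : ℕ} (hk : k ≤ 2 * B.len) (h : k % 2 = 0) :
    B.bdry k ∈ B.quads ∧ G.rot (B.bdry k) ∉ B.quads := by
  by_cases hk' : k = 2 * B.len
  · rw [hk', B.bdry_closed]
    exact B.left_even 0 B.len_pos
  · have := B.left_even (k / 2) (by omega)
    rwa [show 2 * (k / 2) = k by omega] at this

theorem disc_bdry_odd (B : G.Disc) {k : ℕ} (hk : k ≤ 2 * B.len) (h : k % 2 = 1) :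
    G.rot (B.bdry k) ∈ B.quads ∧ B.bdry k ∉ B.quads := by
  have := B.left_odd (k / 2) (by omega)
  rwa [show 2 * (k / 2) + 1 = k by omega] at this

theorem linked_face (B : G.Disc) {i : ℕ} (hi : i < B.len) :
    Linked B (B.bdry (2 * i + 2)) (G.rot (B.bdry (2 * i + 1))) := by
  classical
  set x := B.bdry (2 * i + 2) with hx
  have hxq : x ∈ B.quads := (disc_bdry_even B (by omega) (by omega)).1
  have hsame : G.SameFace x (B.bdry (2 * i + 1)) := (B.face_step i hi).symm
  have hex := Equiv.Perm.SameCycle.exists_pow_eq_of_finite hsame (G.planar.face_finite x)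
  set n := Nat.find hex with hn
  have hnn : (G.faceNext ^ n) x = B.bdry (2 * i + 1) := Nat.find_spec hex
  have key : ∀ k < n, (G.faceNext ^ k) x ∈ B.quads ∧ Linked B x ((G.faceNext ^ k) x) := by
    intro k
    induction k with
    | zero => exact fun _ => ⟨hxq, Linked.refl B x⟩
    | succ k ih =>
      intro hk
      obtain ⟨h1, h2⟩ := ih (by omega)
      rw [pow_succ', Equiv.Perm.mul_apply]
      set w := G.faceNext ((G.faceNext ^ k) x) with hw
      have hrw : G.rot w = G.rev ((G.faceNext ^ k) x) := PlaneMap.rot_faceNext _ _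
      have h4 : G.rot w ∈ B.quads := by rw [hrw, B.rev_mem]; exact h1
      have h3 : w ∈ B.quads := by
        by_contra h3
        obtain ⟨j, hj, hj'⟩ := B.complete _ (fun h => h3 (h.2 h4))
        obtain ⟨j', rfl | rfl⟩ : ∃ j', j = 2 * j' ∨ j = 2 * j' + 1 := ⟨j / 2, by omega⟩
        · refine h3 ?_
          rw [← hj']
          exact (B.left_even j' (by omega)).1
        · have h4 : j' = i := by
            refine B.face_simple j' (by omega) i hi ?_
            rw [hj']
            refine Equiv.Perm.SameCycle.trans (Equiv.Perm.SameCycle.symm ⟨(k + 1 : ℕ), ?_⟩) hsame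
            rw [hw, ← Equiv.Perm.mul_apply, ← pow_succ', zpow_natCast]
          subst h4
          refine Nat.find_min hex hk ?_
          rw [pow_succ', Equiv.Perm.mul_apply, ← hw, hj']
      refine ⟨h3, (h2.trans (Linked.rev B _)).trans ?_⟩
      rw [← hrw]
      exact (Linked.rot h3 h4).symm
  have hn0 : n ≠ 0 := by
    intro h0
    rw [h0, pow_zero, Equiv.Perm.one_apply] at hnn
    exact (disc_bdry_odd B (k := 2 * i + 1) (by omega) (by omega)).2 (hnn ▸ hxq)
  obtain ⟨m, hm⟩ := Nat.exists_eq_succ_of_ne_zero hn0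
  rw [hm, Nat.succ_eq_add_one, pow_succ', Equiv.Perm.mul_apply] at hnn
  rw [← hnn, PlaneMap.rot_faceNext]
  exact (key m (by omega)).2.trans (Linked.rev B _)

/-- The dart, in the disc, of the edge adjacent to a corner of the boundary. -/
def innerDart (B : G.Disc) (k : ℕ) : D := if k % 2 = 0 then B.bdry k else G.rot (B.bdry k)

/-- Connectedness of the disc is obtained by following its boundary on the inner side, alternately
around vertices and faces. -/
theorem linked_innerDart (B : G.Disc) {k : ℕ} (hk : k ≤ 2 * B.len) :
    Linked B (innerDart B 0) (innerDart B k) := by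
  induction k with
  | zero => exact Linked.refl B _
  | succ k ih =>
    refine (ih (by omega)).trans ?_
    obtain ⟨i, rfl | rfl⟩ : ∃ j', k = 2 * j' ∨ k = 2 * j' + 1 := ⟨k / 2, by omega⟩
    · rw [innerDart, innerDart, if_pos (by omega), if_neg (by omega)]
      exact (linked_vertex B (by omega)).symm
    · rw [innerDart, innerDart, if_neg (by omega), if_pos (by omega)]
      exact (linked_face B (by omega)).symm

/-- The vertices of the quad-graph on the boundary of a disc: the corner of index `k` goes from the
`k`-th one to the next one. -/
def discVertex (B : G.Disc) (k : ℕ) : G.QuadVertex :=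
  if k % 2 = 0 then .inr (G.faceOf (B.bdry k)) else .inl (G.vertexOf (B.bdry k))

theorem discVertex_succ (B : G.Disc) {k : ℕ} (hk : k < 2 * B.len) :
    discVertex B (k + 1) =
      if k % 2 = 0 then .inl (G.vertexOf (B.bdry k)) else .inr (G.faceOf (B.bdry k)) := by
  obtain ⟨i, rfl | rfl⟩ : ∃ j', k = 2 * j' ∨ k = 2 * j' + 1 := ⟨k / 2, by omega⟩
  · rw [discVertex, if_neg (by omega), if_pos (by omega)]
    rw [PlaneMap.vertexOf_eq_iff.2 (B.vertex_step i (by omega))]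
  · rw [discVertex, if_pos (by omega), if_neg (by omega)]
    rw [PlaneMap.faceOf_eq_iff.2 (B.face_step i (by omega))]

theorem disc_bdry_injective (B : G.Disc) {j k : ℕ} (hj : j < 2 * B.len) (hk : k < 2 * B.len)
    (h : B.bdry j = B.bdry k) : j = k := by
  have e1 : ∀ j, j < 2 * B.len → (j % 2 = 0 ↔ B.bdry j ∈ B.quads) := fun j hj =>
    ⟨fun h => (disc_bdry_even B hj.le h).1, fun h => by
      by_contra h0
      exact (disc_bdry_odd B hj.le (by omega)).2 h⟩
  have hpar : j % 2 = 0 ↔ k % 2 = 0 := by rw [e1 j hj, e1 k hk, h]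
  by_cases h0 : j % 2 = 0
  · have := B.vertex_simple (j / 2) (by omega) (k / 2) (by omega) (by
      rw [show 2 * (j / 2) = j by omega, show 2 * (k / 2) = k by omega, h]
      exact Equiv.Perm.SameCycle.refl _ _)
    omega
  · have := B.face_simple (j / 2) (by omega) (k / 2) (by omega) (by
      rw [show 2 * (j / 2) + 1 = j by omega, show 2 * (k / 2) + 1 = k by omega, h]
      exact Equiv.Perm.SameCycle.refl _ _)
    omega

/-! ### Outgoing points on the boundary of a disc -/

/-- The index of a boundary corner through which a strand leaves the disc, the train-track staying
outside afterwards. -/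
def IsExit (B : G.Disc) (p : ℕ) : Prop :=
  p < 2 * B.len ∧ ∀ n : ℕ, G.exitEdge ((G.nextStrand ^ n) (B.bdry p)) ∉ B.quads

namespace IsExit

variable {B : G.Disc} {p : ℕ}

/-- The edge inside the disc must be the one where the strand starts. At an even corner it is the
edge of `bdry p`, at an odd one that of `rot (bdry p)`; the colour decides which of them is the
start. -/
theorem white_iff (hp : IsExit B p) : G.white (B.bdry p) = true ↔ p % 2 = 0 := by
  have h := hp.2 0
  rw [pow_zero, Equiv.Perm.one_apply, exitEdge_mem_quads] at h
  constructor
  · intro hw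
    by_contra h0
    rw [if_pos hw] at h
    exact h (disc_bdry_odd B hp.1.le (by omega)).1
  · intro h0
    by_contra hw
    rw [if_neg hw] at h
    exact h (disc_bdry_even B hp.1.le h0).1

theorem rightOf (hp : IsExit B p) : G.rightOf (B.bdry p) = discVertex B p := by
  rw [discVertex, BipartitePlaneGraph.rightOf]
  simp only [hp.white_iff]

theorem leftOf (hp : IsExit B p) : G.leftOf (B.bdry p) = discVertex B (p + 1) := by
  rw [discVertex_succ B hp.1, BipartitePlaneGraph.leftOf]
  simp only [hp.white_iff]

theorem entryEdge (hp : IsExit B p) :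
    G.entryEdge (B.bdry p) = G.whiteDart (innerDart B p) := by
  by_cases h0 : p % 2 = 0
  · have hw := hp.white_iff.2 h0
    simp [BipartitePlaneGraph.entryEdge, whiteDart, innerDart, h0, hw]
  · have hw : G.white (B.bdry p) = false := by
      by_contra h; exact h0 (hp.white_iff.1 (by simpa using h))
    simp [BipartitePlaneGraph.entryEdge, whiteDart, innerDart, h0, hw, G.white_rot]

theorem entryEdge_mem (hp : IsExit B p) : G.entryEdge (B.bdry p) ∈ B.quads := by
  rw [entryEdge_mem_quads]
  by_cases h0 : p % 2 = 0
  · rw [if_pos (hp.white_iff.2 h0)]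
    exact (disc_bdry_even B hp.1.le h0).1
  · rw [if_neg (fun h => h0 (hp.white_iff.1 h))]
    exact (disc_bdry_odd B hp.1.le (by omega)).1

/-- Every boundary corner has an adjacent quadrilateral in the disc, so the ray cannot use a second
one without entering an edge of the disc. -/
theorem ray_bdry (hp : IsExit B p) {k : ℕ} (hk : k < 2 * B.len) :
    G.ray (B.bdry p) (B.bdry k) = if k = p then 1 else 0 := by
  split_ifs with h
  · rw [h, ray_self]
  · refine ray_eq_zero ?_
    rintro (_ | n) hn
    · exact h (disc_bdry_injective B hk hp.1 hn.symm)
    · have h1 := hp.2 (n + 1)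
      have h2 := hp.2 n
      rw [← entryEdge_nextStrand, ← Equiv.Perm.mul_apply, ← pow_succ', hn,
        entryEdge_mem_quads] at h2
      rw [hn, exitEdge_mem_quads] at h1
      have e0 := disc_bdry_even B hk.le
      have e1 := disc_bdry_odd B hk.le
      rcases Nat.mod_two_eq_zero_or_one k with h0 | h0 <;>
        cases hw : G.white (B.bdry k) <;> simp_all

end IsExit

/-- A disc with the indices of three corners through which train-tracks leave it for the last time,
their parts following these corners being disjoint. -/
structure IsTripleExit (B : G.Disc) (p : Fin 3 → ℕ) : Prop where
  isExit : ∀ i, IsExit B (p i)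
  disjoint : ∀ i j, i ≠ j → ∀ m n : ℕ, G.exitEdge ((G.nextStrand ^ m) (B.bdry (p i))) ≠
    G.exitEdge ((G.nextStrand ^ n) (B.bdry (p j)))

namespace IsTripleExit

variable {B : G.Disc} {p : Fin 3 → ℕ}

theorem ray_eq_zero_of_exitEdge (hp : IsTripleExit B p)
    (hd : ∀ d, ¬G.SameTrack (G.rot.symm d) d) (i j : Fin 3) (n : ℕ) {w : D}
    (hw : G.exitEdge w = G.exitEdge ((G.nextStrand ^ n) (B.bdry (p i))))
    (hne : w ≠ (G.nextStrand ^ n) (B.bdry (p i))) : G.ray (B.bdry (p j)) w = 0 := by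
  refine ray_eq_zero fun m hm => ?_
  subst hm
  by_cases hij : i = j
  · subst hij
    exact hne (eq_of_exitEdge_eq hd
      ((SameTrack.pow _ m).symm.trans (SameTrack.pow _ n)) hw)
  · exact hp.disjoint i j hij n m hw.symm

theorem ray_eq_zero_of_entryEdge (hp : IsTripleExit B p)
    (hd : ∀ d, ¬G.SameTrack (G.rot.symm d) d) (i j : Fin 3) (n : ℕ) {w : D}
    (hw : G.entryEdge w = G.exitEdge ((G.nextStrand ^ n) (B.bdry (p i))))
    (hne : w ≠ G.nextStrand ((G.nextStrand ^ n) (B.bdry (p i)))) :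
    G.ray (B.bdry (p j)) w = 0 := by
  refine ray_eq_zero ?_
  rintro (_ | m) hm
  · rw [pow_zero, Equiv.Perm.one_apply] at hm
    subst hm
    exact (hp.isExit i).2 n (hw ▸ (hp.isExit j).entryEdge_mem)
  · rw [pow_succ', Equiv.Perm.mul_apply] at hm
    subst hm
    rw [entryEdge_nextStrand] at hw
    have := hp.ray_eq_zero_of_exitEdge hd i j n hw (fun h => hne (by rw [h]))
    rw [ray_eq_one m rfl] at this
    exact one_ne_zero this

/-- A chain formed by the parts of two train-tracks outside of the disc, connected inside. -/
theorem exists_potential (hp : IsTripleExit B p) (hl : G.NoTrackLoops) (i j : Fin 3) :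
    ∃ (Q : D → ℤ) (H : G.QuadVertex → ℤ),
      (∀ u, Q u ≠ 0 → u ∈ B.quads ∧ G.rot u ∈ B.quads) ∧
      G.IsPotential H (G.ray (B.bdry (p i)) - G.ray (B.bdry (p j)) + Q) := by
  classical
  obtain ⟨Q, h1, h2⟩ := (linked_innerDart B (hp.isExit j).1.le).symm.trans
    (linked_innerDart B (hp.isExit i).1.le)
  have hc : G.IsCycle (G.ray (B.bdry (p i)) - G.ray (B.bdry (p j)) + Q) := by
    intro e he
    rw [boundary_add, boundary_sub, boundary_ray hl _ he, boundary_ray hl _ he, h2 e he,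
      (hp.isExit i).entryEdge, (hp.isExit j).entryEdge]
    ring
  obtain ⟨H, hH⟩ := hc.exists_potential
  exact ⟨Q, H, h1, hH⟩

variable {i j : Fin 3} {Q : D → ℤ} {H : G.QuadVertex → ℤ}

/-- The chain `Q` lies inside and each ray meets the boundary only at its outgoing point, so along
the counterclockwise boundary the potential rises by 1 at `p i`, falls by 1 at `p j`, and is
otherwise constant. -/
theorem potential_discVertex (hp : IsTripleExit B p)
    (hQ : ∀ u, Q u ≠ 0 → u ∈ B.quads ∧ G.rot u ∈ B.quads)
    (hH : G.IsPotential H (G.ray (B.bdry (p i)) - G.ray (B.bdry (p j)) + Q)) {k : ℕ}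
    (hk : k ≤ 2 * B.len) :
    H (discVertex B k) = H (discVertex B 0) + (if p i < k then 1 else 0) -
      if p j < k then 1 else 0 := by
  induction k with
  | zero => simp
  | succ k ih =>
    have hk' : k < 2 * B.len := by omega
    have ih := ih (by omega)
    have hz : (G.ray (B.bdry (p i)) - G.ray (B.bdry (p j)) + Q) (B.bdry k) =
        (if k = p i then 1 else 0) - if k = p j then 1 else 0 := by
      have hQ0 : Q (B.bdry k) = 0 := by
        by_contra h
        have := hQ _ h
        rcases Nat.mod_two_eq_zero_or_one k with h0 | h0
        · exact (disc_bdry_even B hk'.le h0).2 this.2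
        · exact (disc_bdry_odd B hk'.le h0).2 this.1
      rw [Pi.add_apply, Pi.sub_apply, (hp.isExit i).ray_bdry hk', (hp.isExit j).ray_bdry hk', hQ0,
        add_zero]
    have hstep : H (discVertex B (k + 1)) - H (discVertex B k) =
        (if k = p i then 1 else 0) - if k = p j then 1 else 0 := by
      by_cases hki : IsExit B k
      · rw [← hki.leftOf, ← hki.rightOf, hH, hz]
      · have h1 : k ≠ p i := fun h => hki (h ▸ hp.isExit i)
        have h2 : k ≠ p j := fun h => hki (h ▸ hp.isExit j)
        rw [if_neg h1, if_neg h2, sub_self] at hz ⊢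
        rw [discVertex_succ B hk', discVertex]
        cases hw : G.white (B.bdry k)
        · have := hH.black hw
          split_ifs <;> linarith
        · have := hH.white hw
          split_ifs <;> linarith
    have e1 : ∀ x : ℕ, (if x < k + 1 then (1 : ℤ) else 0) =
        (if x < k then 1 else 0) + if k = x then 1 else 0 := by
      intro x
      split_ifs <;> omega
    rw [e1, e1]
    linarith

/-- Past its outgoing point a ray crosses neither the other rays nor the disc, so the values on its
two sides remain those at the boundary. -/
theorem potential_ray (hp : IsTripleExit B p) (hd : ∀ d, ¬G.SameTrack (G.rot.symm d) d)
    (hQ : ∀ u, Q u ≠ 0 → u ∈ B.quads ∧ G.rot u ∈ B.quads)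
    (hH : G.IsPotential H (G.ray (B.bdry (p i)) - G.ray (B.bdry (p j)) + Q)) (l : Fin 3) (n : ℕ) :
    H (G.leftOf ((G.nextStrand ^ n) (B.bdry (p l)))) = H (discVertex B (p l + 1)) ∧
      H (G.rightOf ((G.nextStrand ^ n) (B.bdry (p l)))) = H (discVertex B (p l)) := by
  induction n with
  | zero =>
    rw [pow_zero, Equiv.Perm.one_apply, (hp.isExit l).leftOf, (hp.isExit l).rightOf]
    exact ⟨rfl, rfl⟩
  | succ n ih =>
    rw [pow_succ', Equiv.Perm.mul_apply, ← ih.1, ← ih.2]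
    have he := (hp.isExit l).2 n
    refine hH.nextStrand (fun w hw hne => ?_) fun w hw hne => ?_
    · have hQ0 : Q w = 0 := by
        by_contra h
        have := hQ _ h
        rw [← hw, exitEdge_mem_quads] at he
        split_ifs at he
        exacts [he this.2, he this.1]
      rw [Pi.add_apply, Pi.sub_apply, hp.ray_eq_zero_of_exitEdge hd l i n hw hne,
        hp.ray_eq_zero_of_exitEdge hd l j n hw hne, hQ0]
      rfl
    · have hQ0 : Q w = 0 := by
        by_contra h
        have := hQ _ h
        rw [← hw, entryEdge_mem_quads] at he
        split_ifs at he
        exacts [he this.1, he this.2]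
      rw [Pi.add_apply, Pi.sub_apply, hp.ray_eq_zero_of_entryEdge hd l i n hw hne,
        hp.ray_eq_zero_of_entryEdge hd l j n hw hne, hQ0]
      rfl

end IsTripleExit

/-! ### From a disc to infinity: the sectors of three train-tracks -/

/-- The two faces of the graph of train-tracks adjacent to a strand. -/
def IsSide (s : D) (q : G.QuadVertex) : Prop := G.leftOf s = q ∨ G.rightOf s = q

theorem isSide_iff_vertex (s : D) (v : G.Vertex) : IsSide s (Sum.inl v : G.QuadVertex) ↔
    G.vertexOf s = v := by
  rw [IsSide]
  cases hw : G.white s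
  · rw [leftOf_black hw, rightOf_black hw]; simp
  · rw [leftOf_white hw, rightOf_white hw]; simp

theorem isSide_iff_face (s : D) (f : G.Face) : IsSide s (Sum.inr f : G.QuadVertex) ↔
    G.faceOf s = f := by
  rw [IsSide]
  cases hw : G.white s
  · rw [leftOf_black hw, rightOf_black hw]; simp
  · rw [leftOf_white hw, rightOf_white hw]; simp

theorem exists_isSide (q : G.QuadVertex) : ∃ s, IsSide s q := by
  rcases q with q | q <;> induction q using Quotient.inductionOn with | h d => ?_
  · exact ⟨d, (isSide_iff_vertex d _).2 rfl⟩
  · exact ⟨d, (isSide_iff_face d _).2 rfl⟩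

/-- If no corner around a vertex of the quad-graph is on the boundary of a disc, the quadrilaterals
around this vertex are all in the disc or all outside. -/
theorem all_mem_or_all_notMem (B : G.Disc) {q : G.QuadVertex}
    (h : ∀ s, IsSide s q → (s ∈ B.quads ↔ G.rot s ∈ B.quads)) :
    (∀ s, IsSide s q → s ∈ B.quads) ∨ ∀ s, IsSide s q → s ∉ B.quads := by
  suffices key : ∀ s t, IsSide s q → IsSide t q → s ∈ B.quads → t ∈ B.quads by
    by_cases hex : ∃ s, IsSide s q ∧ s ∈ B.quads
    · obtain ⟨s, hs, hs'⟩ := hex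
      exact Or.inl fun t ht => key s t hs ht hs'
    · exact Or.inr fun s hs hs' => hex ⟨s, hs, hs'⟩
  intro s t hs ht hsq
  rcases q with v | f
  · simp only [isSide_iff_vertex] at *
    have hg : ∀ d, (fun d => (G.vertexOf d = v → d ∈ B.quads)) (G.rot d) =
        (fun d => (G.vertexOf d = v → d ∈ B.quads)) d := by
      intro d
      simp only [PlaneMap.vertexOf_rot]
      exact propext ⟨fun h1 h2 => (h d h2).2 (h1 h2), fun h1 h2 => (h d h2).1 (h1 h2)⟩
    have := Equiv.Perm.SameCycle.apply_eq_of_invariant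
      (g := fun d => (G.vertexOf d = v → d ∈ B.quads)) hg
      (PlaneMap.vertexOf_eq_iff.1 (hs.trans ht.symm))
    exact (this.mp fun _ => hsq) ht
  · simp only [isSide_iff_face] at *
    have hg : ∀ d, (fun d => (G.faceOf d = f → d ∈ B.quads)) (G.faceNext d) =
        (fun d => (G.faceOf d = f → d ∈ B.quads)) d := by
      intro d
      have h0 := h (G.faceNext d)
      rw [PlaneMap.rot_faceNext, B.rev_mem, PlaneMap.faceOf_faceNext] at h0
      simp only [PlaneMap.faceOf_faceNext]
      exact propext ⟨fun h1 h2 => (h0 h2).1 (h1 h2), fun h1 h2 => (h0 h2).2 (h1 h2)⟩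
    have := Equiv.Perm.SameCycle.apply_eq_of_invariant
      (g := fun d => (G.faceOf d = f → d ∈ B.quads)) hg
      (PlaneMap.faceOf_eq_iff.1 (hs.trans ht.symm))
    exact (this.mp fun _ => hsq) ht

theorem exists_discVertex_eq (B : G.Disc) {q : G.QuadVertex} {s : D} (hs : IsSide s q)
    (h : ¬(s ∈ B.quads ↔ G.rot s ∈ B.quads)) : ∃ k ≤ 2 * B.len, q = discVertex B k := by
  obtain ⟨k, hk, rfl⟩ := B.complete s h
  rcases q with v | f
  · rw [isSide_iff_vertex] at hs
    subst hs
    rcases Nat.mod_two_eq_zero_or_one k with h0 | h0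
    · exact ⟨k + 1, hk, by rw [discVertex_succ B hk, if_pos h0]⟩
    · exact ⟨k, hk.le, by rw [discVertex, if_neg (by omega)]⟩
  · rw [isSide_iff_face] at hs
    subst hs
    rcases Nat.mod_two_eq_zero_or_one k with h0 | h0
    · exact ⟨k, hk.le, by rw [discVertex, if_pos h0]⟩
    · exact ⟨k + 1, hk, by rw [discVertex_succ B hk, if_neg (by omega)]⟩

/-- A property of vertices of the quad-graph that holds on the boundary of a disc and on both sides
of some strands, and that is preserved by crossing the other strands outside the disc, holds
outside a finite set. -/
theorem eventually_of_disc (B : G.Disc) {P : G.QuadVertex → Prop} {R : D → Prop}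
    (h1 : ∀ k ≤ 2 * B.len, P (discVertex B k))
    (h2 : ∀ s, R s → P (G.leftOf s) ∧ P (G.rightOf s))
    (h3 : ∀ s, ¬R s → s ∉ B.quads → (P (G.leftOf s) ↔ P (G.rightOf s))) :
    ∀ᶠ q in Filter.cofinite, P q := by
  have hstep : ∀ s (q q' : G.QuadVertex), IsSide s q → IsSide s q' →
      (P (G.leftOf s) ↔ P (G.rightOf s)) ∨ s ∈ B.quads ∨ P q' →
      ((∀ s, IsSide s q → s ∈ B.quads) ∨ P q) → (∀ s, IsSide s q' → s ∈ B.quads) ∨ P q' := by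
    intro s q q' hs hs' h h'
    by_cases hb : ∀ s, IsSide s q' → (s ∈ B.quads ↔ G.rot s ∈ B.quads)
    · rcases all_mem_or_all_notMem B hb with hin | hout
      · exact Or.inl hin
      · right
        have hsq := hout s hs'
        have hq : P q := by
          rcases h' with h' | h'
          · exact absurd (h' s hs) hsq
          · exact h'
        rcases h with h | h | h
        · rcases hs with rfl | rfl <;> rcases hs' with rfl | rfl
          exacts [hq, h.1 hq, h.2 hq, hq]
        · exact absurd h hsq
        · exact h
    · push Not at hb
      obtain ⟨t, ht, ht'⟩ := hb
      obtain ⟨k, hk, rfl⟩ := exists_discVertex_eq B ht (by tauto)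
      exact Or.inr (h1 k hk)
  -- The alternative "all quadrilaterals around `q` are in the disc, or `P q`" is stable under
  -- crossing any strand, since one can only pass from outside to inside through the boundary, where
  -- `P` holds. The first case concerns finitely many `q`.
  have hall : ∀ q, (∀ s, IsSide s q → s ∈ B.quads) ∨ P q := by
    refine quadVertex_induction (fun s => ?_) (q := discVertex B 0) (Or.inr (h1 0 (by omega)))
    have hcase : ∀ q', IsSide s q' → (P (G.leftOf s) ↔ P (G.rightOf s)) ∨ s ∈ B.quads ∨ P q' := by
      intro q' hq'
      by_cases hR : R s
      · rcases hq' with rfl | rfl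
        exacts [Or.inr (Or.inr (h2 s hR).1), Or.inr (Or.inr (h2 s hR).2)]
      · by_cases hs : s ∈ B.quads
        · exact Or.inr (Or.inl hs)
        · exact Or.inl (h3 s hR hs)
    exact ⟨hstep s _ _ (Or.inl rfl) (Or.inr rfl) (hcase _ (Or.inr rfl)),
      hstep s _ _ (Or.inr rfl) (Or.inl rfl) (hcase _ (Or.inl rfl))⟩
  rw [Filter.eventually_cofinite]
  refine ((B.quads_finite.image G.leftOf).union (B.quads_finite.image G.rightOf)).subset
    fun q hq => ?_
  obtain ⟨s, hs⟩ := exists_isSide q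
  have hsq := (hall q).resolve_right hq s hs
  rcases hs with hs | hs
  · exact Or.inl ⟨s, hsq, hs⟩
  · exact Or.inr ⟨s, hsq, hs⟩

theorem LeavesAt.isExit {B : G.Disc} {s : D} {p : ℕ} (h : G.LeavesAt B s p) : IsExit B p :=
  ⟨h.1, h.2.2⟩

/-- Three train-tracks in cyclic order divide the neighbourhood of infinity into three sectors: the
first one between the first two train-tracks, the second one between the last two. The indicator
functions of the first two sectors are given by potentials. -/
theorem GlobalOrder.exists_sectors (hl : G.NoTrackLoops)
    (hd : ∀ d, ¬G.SameTrack (G.rot.symm d) d) {a b c : D} (h : G.GlobalOrder a b c) :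
    ∃ (H₁ H₂ : G.QuadVertex → ℤ) (z₁ z₂ : D → ℤ), G.IsPotential H₁ z₁ ∧ G.IsPotential H₂ z₂ ∧
      (z₁ - (G.ray a - G.ray b)).support.Finite ∧ (z₂ - (G.ray b - G.ray c)).support.Finite ∧
      (∀ᶠ q in Filter.cofinite,
        (H₁ q = 0 ∧ H₂ q = 0) ∨ (H₁ q = 1 ∧ H₂ q = 0) ∨ (H₁ q = 0 ∧ H₂ q = 1)) ∧
      (∃ᶠ q in Filter.cofinite, H₁ q = 0 ∧ H₂ q = 0) ∧
      (∃ᶠ q in Filter.cofinite, H₁ q = 1 ∧ H₂ q = 0) ∧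
      (∃ᶠ q in Filter.cofinite, H₁ q = 0 ∧ H₂ q = 1) := by
  obtain ⟨-, -, B, p₁, p₂, p₃, l₁, l₂, l₃, s₁₂, s₂₃, s₁₃, hord⟩ := h
  have hp : IsTripleExit B ![p₁, p₂, p₃] := by
    refine ⟨fun i => ?_, fun i j hij m n => ?_⟩
    · fin_cases i
      exacts [l₁.isExit, l₂.isExit, l₃.isExit]
    · fin_cases i <;> fin_cases j <;> simp only [ne_eq, not_true_eq_false] at hij
      exacts [s₁₂.2 m n, s₁₃.2 m n, (s₁₂.2 n m).symm, s₂₃.2 m n, (s₁₃.2 n m).symm,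
        (s₂₃.2 n m).symm]
  obtain ⟨Q₁, K₁, hQ₁, hK₁⟩ := hp.exists_potential hl 0 1
  obtain ⟨Q₂, K₂, hQ₂, hK₂⟩ := hp.exists_potential hl 1 2
  have v₁ := fun {k} => hp.potential_discVertex (k := k) hQ₁ hK₁
  have v₂ := fun {k} => hp.potential_discVertex (k := k) hQ₂ hK₂
  have r₁ := hp.potential_ray hd hQ₁ hK₁
  have r₂ := hp.potential_ray hd hQ₂ hK₂
  have hlt₁ := l₁.1
  have hlt₂ := l₂.1
  have hlt₃ := l₃.1
  -- Normalisation: both potentials are made to vanish just after `p₃`, in the sector from the third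
  -- train-track to the first.
  set α := K₁ (discVertex B (p₃ + 1)) with hα
  set β := K₂ (discVertex B (p₃ + 1)) with hβ
  rw [v₁ (by omega)] at hα
  rw [v₂ (by omega)] at hβ
  simp only [Matrix.cons_val_zero, Matrix.cons_val_one, Matrix.cons_val] at v₁ v₂ hα hβ
  have fin_aux : ∀ (Q : D → ℤ) {s t s' t' : D}, (∀ u, Q u ≠ 0 → u ∈ B.quads ∧ G.rot u ∈ B.quads) →
      G.SameTrack s s' → G.SameTrack t t' →
      ((G.ray s' - G.ray t' + Q) - (G.ray s - G.ray t)).support.Finite := by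
    intro Q s t s' t' hQ hs ht
    refine ((B.quads_finite.union (hs.finite_ray_sub hl)).union (ht.finite_ray_sub hl)).subset ?_
    intro u hu
    by_contra h
    simp only [Set.mem_union, Function.mem_support, Pi.sub_apply, not_or, not_not] at h
    have hQ0 : Q u = 0 := by
      by_contra h'
      exact h.1.1 (hQ u h').1
    apply hu
    simp only [Pi.sub_apply, Pi.add_apply, hQ0]
    linarith [h.1.2, h.2]
  have freq : ∀ (s : D) (P : G.QuadVertex → Prop),
      (∀ n : ℕ, P (G.leftOf ((G.nextStrand ^ n) s))) → ∃ᶠ q in Filter.cofinite, P q := fun s P hP =>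
    (hl.tendsto_leftOf s).frequently (Filter.Frequently.of_forall hP)
  refine ⟨fun q => K₁ q - α, fun q => K₂ q - β, _, _, fun s => ?_, fun s => ?_,
    fin_aux Q₁ hQ₁ l₁.2.1 l₂.2.1, fin_aux Q₂ hQ₂ l₂.2.1 l₃.2.1, ?_, ?_, ?_, ?_⟩
  · have := hK₁ s
    simp only [Matrix.cons_val_zero, Matrix.cons_val_one] at this
    linarith
  · have := hK₂ s
    simp only [Matrix.cons_val_one, Matrix.cons_val] at this
    linarith
  · have hval : ∀ k ≤ 2 * B.len, (K₁ (discVertex B k) - α = 0 ∧ K₂ (discVertex B k) - β = 0) ∨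
        (K₁ (discVertex B k) - α = 1 ∧ K₂ (discVertex B k) - β = 0) ∨
        (K₁ (discVertex B k) - α = 0 ∧ K₂ (discVertex B k) - β = 1) := by
      intro k hk
      rw [v₁ hk, v₂ hk, hα, hβ]
      split_ifs <;> omega
    refine eventually_of_disc B (R := fun s => ∃ (i : Fin 3) (n : ℕ),
      (G.nextStrand ^ n) (B.bdry (![p₁, p₂, p₃] i)) = s) hval ?_ ?_
    · rintro s ⟨i, n, rfl⟩
      simp only [(r₁ i n).1, (r₁ i n).2, (r₂ i n).1, (r₂ i n).2]
      exact ⟨hval _ (hp.isExit i).1, hval _ (hp.isExit i).1.le⟩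
    · intro s hR hs
      have hz : ∀ i, G.ray (B.bdry (![p₁, p₂, p₃] i)) s = 0 := fun i =>
        ray_eq_zero fun n hn => hR ⟨i, n, hn⟩
      have hQ0₁ : Q₁ s = 0 := by
        by_contra h
        exact hs (hQ₁ s h).1
      have hQ0₂ : Q₂ s = 0 := by
        by_contra h
        exact hs (hQ₂ s h).1
      have e₁ := hK₁ s
      have e₂ := hK₂ s
      rw [Pi.add_apply, Pi.sub_apply, hz, hz, hQ0₁] at e₁
      rw [Pi.add_apply, Pi.sub_apply, hz, hz, hQ0₂] at e₂
      simp only [show K₁ (G.leftOf s) = K₁ (G.rightOf s) by linarith,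
        show K₂ (G.leftOf s) = K₂ (G.rightOf s) by linarith]
  · refine freq (B.bdry p₃) _ fun n => ?_
    have e₁ := (r₁ 2 n).1
    have e₂ := (r₂ 2 n).1
    simp only [Matrix.cons_val] at e₁ e₂
    simp only [e₁, e₂]
    exact ⟨sub_self _, sub_self _⟩
  · refine freq (B.bdry p₁) _ fun n => ?_
    have e₁ := (r₁ 0 n).1
    have e₂ := (r₂ 0 n).1
    simp only [Matrix.cons_val_zero] at e₁ e₂
    dsimp only
    rw [e₁, e₂, v₁ (by omega), v₂ (by omega), hα, hβ]
    split_ifs <;> omega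
  · refine freq (B.bdry p₂) _ fun n => ?_
    have e₁ := (r₁ 1 n).1
    have e₂ := (r₂ 1 n).1
    simp only [Matrix.cons_val_one, Matrix.cons_val_zero] at e₁ e₂
    dsimp only
    rw [e₁, e₂, v₁ (by omega), v₂ (by omega), hα, hβ]
    split_ifs <;> omega

/-! ### Levels of the wedges at infinity -/

/-- Outside a finite set, the function takes the values `n` and `n + 1` only, both of them infinitely
often. -/
def HasLevel {Q : Type*} (H : Q → ℤ) (n : ℤ) : Prop :=
  (∀ᶠ q in Filter.cofinite, H q = n ∨ H q = n + 1) ∧ (∃ᶠ q in Filter.cofinite, H q = n) ∧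
    ∃ᶠ q in Filter.cofinite, H q = n + 1

theorem HasLevel.unique {Q : Type*} {H : Q → ℤ} {n n' : ℤ} (h : HasLevel H n)
    (h' : HasLevel H n') : n = n' := by
  obtain ⟨q, hq, hq'⟩ := (h.2.1.and_eventually h'.1).exists
  obtain ⟨r, hr, hr'⟩ := (h'.2.1.and_eventually h.1).exists
  omega

theorem HasLevel.one_sub {Q : Type*} {H K : Q → ℤ} {n : ℤ} (h : HasLevel H n)
    (hK : ∀ᶠ q in Filter.cofinite, H q + K q = 1) : HasLevel K (-n) := by
  refine ⟨?_, ?_, ?_⟩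
  · filter_upwards [h.1, hK] with q h1 h2
    omega
  · exact (h.2.2.and_eventually hK).mono fun q hq => by omega
  · exact (h.2.1.and_eventually hK).mono fun q hq => by omega

theorem IsPotential.eventually_eq_add {H K : G.QuadVertex → ℤ} {z w : D → ℤ}
    (hH : G.IsPotential H z) (hK : G.IsPotential K w) (h : (z - w).support.Finite) :
    ∃ c, ∀ᶠ q in Filter.cofinite, H q = K q + c := by
  obtain ⟨c, hc⟩ := (hH.sub hK).eventually_const h
  refine ⟨c, hc.mono fun q hq => ?_⟩
  rw [Pi.sub_apply] at hq
  linarith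

theorem orbitOrder_rot (hdeg : G.NoDegreeOne) {x : D} (hx : G.rot (G.rot x) ≠ x) :
    PlaneMap.OrbitOrder G.rot (G.rot.symm x) x (G.rot x) := by
  refine ⟨1, 2, one_pos, one_lt_two, ?_, by simp, by simp [pow_two]⟩
  have h0 := Equiv.Perm.minimalPeriod_pos_of_finite (G.planar.vertex_finite (G.rot.symm x))
  have h1 := Equiv.Perm.pow_minimalPeriod_apply G.rot (G.rot.symm x)
  by_contra hlt
  obtain h2 | h2 : Function.minimalPeriod G.rot (G.rot.symm x) = 1 ∨
      Function.minimalPeriod G.rot (G.rot.symm x) = 2 := by omega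
  · rw [h2, pow_one] at h1
    exact hdeg _ h1
  · rw [h2, pow_two, Equiv.Perm.mul_apply] at h1
    apply hx
    have := congrArg G.rot h1
    simpa using this

namespace IsEdgePotential

variable {h : D → G.QuadVertex → ℤ}

/-- Whatever the colour of `x`, the wedge goes from the train-track of `rot.symm x` to that of `x`,
up to finitely many strands. This is the form comparable with the sectors of a global order. -/
theorem exists_chain (hh : G.IsEdgePotential h) (hl : G.NoTrackLoops) (x : D) :
    ∃ z, G.IsPotential (h x) z ∧ (z - (G.ray (G.rot.symm x) - G.ray x)).support.Finite := by
  cases hx : G.white x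
  · refine ⟨_, hh.isPotential_black hx, ?_⟩
    have h1 : G.SameTrack x (G.rev x) := by
      have := SameTrack.nextStrand_right (G := G) x
      rwa [nextStrand_of_black hx] at this
    refine (h1.finite_ray_sub hl).subset fun u hu => ?_
    simp only [Function.mem_support, Pi.sub_apply] at hu ⊢
    intro h0
    apply hu
    linarith
  · refine ⟨_, hh.isPotential x hx, ?_⟩
    refine ((sameTrack_rot_symm hx).finite_ray_sub hl).subset fun u hu => ?_
    simp only [Function.mem_support, Pi.sub_apply] at hu ⊢
    intro h0
    apply hu
    linarith

/-- Near infinity the pair of functions is a constant pair `(n, n')` plus `(0, 0)`, `(1, 0)` or `(0,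
1)`, each infinitely often: two disjoint sectors among the three cut out by the train-tracks of
`rot.symm x`, `x` and `rot x`. -/
theorem exists_sectors (hh : G.IsEdgePotential h) (hl : G.NoTrackLoops)
    (hd : ∀ d, ¬G.SameTrack (G.rot.symm d) d) (hdeg : G.NoDegreeOne) (hvertex : G.VertexCondition)
    {x : D} (hx : G.rot (G.rot x) ≠ x) :
    ∃ (n n' : ℤ), HasLevel (h x) n ∧ HasLevel (h (G.rot x)) n' ∧
      (∀ᶠ q in Filter.cofinite, h x q + h (G.rot x) q ≤ n + n' + 1) ∧
      ∃ᶠ q in Filter.cofinite, h x q + h (G.rot x) q = n + n' := by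
  have hlocal := orbitOrder_rot hdeg hx
  have hmem : ∀ y, G.SameVertex x y → y ∈ G.vertexStrands x := fun y hy => hy
  have m1 := hmem (G.rot.symm x) (PlaneMap.vertexOf_eq_iff.1 (PlaneMap.vertexOf_rot_symm x).symm)
  have m2 := hmem x (Equiv.Perm.SameCycle.refl _ _)
  have m3 := hmem (G.rot x) (PlaneMap.vertexOf_eq_iff.1 (PlaneMap.vertexOf_rot x).symm)
  have hglob : G.GlobalOrder (G.rot.symm x) x (G.rot x) := by
    refine ((hvertex x).2 _ m1 _ m2 _ m3 (hd x) ?_ ?_).2 hlocal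
    · have := hd (G.rot x)
      rwa [Equiv.symm_apply_apply] at this
    · refine (hvertex x).1 _ m1 _ m3 fun h0 => hx ?_
      rw [← h0, Equiv.apply_symm_apply]
  obtain ⟨H₁, H₂, z₁, z₂, hH₁, hH₂, hz₁, hz₂, hev, f00, f10, f01⟩ := hglob.exists_sectors hl hd
  have hfin : ∀ {z w r : D → ℤ}, (z - r).support.Finite → (w - r).support.Finite →
      (z - w).support.Finite := by
    intro z w r h1 h2
    refine (h1.union h2).subset fun u hu => ?_
    by_contra h0
    simp only [Set.mem_union, Function.mem_support, Pi.sub_apply, not_or, not_not] at h0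
    apply hu
    rw [Pi.sub_apply]
    linarith [h0.1, h0.2]
  obtain ⟨y₁, hy₁, hy₁'⟩ := hh.exists_chain hl x
  obtain ⟨y₂, hy₂, hy₂'⟩ := hh.exists_chain hl (G.rot x)
  rw [Equiv.symm_apply_apply] at hy₂'
  obtain ⟨c₁, hc₁⟩ := hy₁.eventually_eq_add hH₁ (hfin hy₁' hz₁)
  obtain ⟨c₂, hc₂⟩ := hy₂.eventually_eq_add hH₂ (hfin hy₂' hz₂)
  refine ⟨c₁, c₂, ⟨?_, ?_, ?_⟩, ⟨?_, ?_, ?_⟩, ?_, ?_⟩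
  · filter_upwards [hc₁, hev] with q h1 h2
    omega
  · exact (f00.and_eventually hc₁).mono fun q hq => by omega
  · exact (f10.and_eventually hc₁).mono fun q hq => by omega
  · filter_upwards [hc₂, hev] with q h1 h2
    omega
  · exact (f00.and_eventually hc₂).mono fun q hq => by omega
  · exact (f01.and_eventually hc₂).mono fun q hq => by omega
  · filter_upwards [hc₁, hc₂, hev] with q h1 h2 h3
    omega
  · exact (f00.and_eventually (hc₁.and hc₂)).mono fun q hq => by omega

theorem add_rot_of_degree_two (hh : G.IsEdgePotential h) (hl : G.NoTrackLoops)
    (hd : ∀ d, ¬G.SameTrack (G.rot.symm d) d) (hdeg : G.NoDegreeOne) {x : D}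
    (hx : G.rot (G.rot x) = x) : ∀ᶠ q in Filter.cofinite, h x q + h (G.rot x) q = 1 := by
  classical
  have hS : ∀ e, e ∈ ({x, G.rot x} : Finset D) ↔ G.SameVertex x e := by
    intro e
    simp only [Finset.mem_insert, Finset.mem_singleton]
    constructor
    · rintro (rfl | rfl)
      · exact Equiv.Perm.SameCycle.refl _ _
      · exact PlaneMap.vertexOf_eq_iff.1 (PlaneMap.vertexOf_rot x).symm
    · intro he
      have hg : ∀ y, (fun y => y = x ∨ y = G.rot x) (G.rot y) =
          (fun y => y = x ∨ y = G.rot x) y := by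
        intro y
        refine propext ⟨?_, ?_⟩
        · rintro (hy | hy)
          · right; rw [← hx] at hy; exact G.rot.injective hy
          · left; exact G.rot.injective hy
        · rintro (rfl | rfl)
          · exact Or.inr rfl
          · exact Or.inl hx
      exact (Equiv.Perm.SameCycle.apply_eq_of_invariant
        (g := fun y => y = x ∨ y = G.rot x) hg he).mp (Or.inl rfl)
  have hne : ∀ᶠ q in Filter.cofinite, q ≠ (.inl (G.vertexOf x) : G.QuadVertex) :=
    Filter.eventually_cofinite_ne _
  filter_upwards [hne] with q hq
  rw [← hh.sum_vertex hl hd hS hq, Finset.sum_pair (hdeg x).symm]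

/-- Degree at least three gives a level directly. At a vertex of degree two the functions of the two
edges add up to 1, so a missing level propagates across it; by connectedness all vertices would have
degree two and there would be at most two faces, making the graph finite. -/
theorem exists_hasLevel (hh : G.IsEdgePotential h) (hl : G.NoTrackLoops)
    (hd : ∀ d, ¬G.SameTrack (G.rot.symm d) d) (hdeg : G.NoDegreeOne) (hvertex : G.VertexCondition)
    (d : D) : ∃ n, HasLevel (h d) n := by
  by_contra hbad
  have hrev : ∀ d, (¬∃ n, HasLevel (h d) n) → ¬∃ n, HasLevel (h (G.rev d)) n := by
    intro d h0
    rwa [hh.rev]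
  have htwo : ∀ d, (¬∃ n, HasLevel (h d) n) → G.rot (G.rot d) = d := by
    intro d h0
    by_contra hx
    obtain ⟨n, n', h1, -⟩ := hh.exists_sectors hl hd hdeg hvertex hx
    exact h0 ⟨n, h1⟩
  have hrot : ∀ d, (¬∃ n, HasLevel (h d) n) → ¬∃ n, HasLevel (h (G.rot d)) n := by
    rintro d h0 ⟨n, hn⟩
    refine h0 ⟨-n, hn.one_sub ?_⟩
    filter_upwards [hh.add_rot_of_degree_two hl hd hdeg (htwo d h0)] with q hq
    rw [add_comm]
    exact hq
  have hall : ∀ e, ¬∃ n, HasLevel (h e) n := by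
    intro e
    induction G.planar.connected d e with
    | refl => exact hbad
    | tail _ hbc ih =>
      rcases hbc with rfl | rfl
      exacts [hrev _ ih, hrot _ ih]
  have hface : ∀ e, G.faceOf e = G.faceOf d ∨ G.faceOf (G.rev e) = G.faceOf d := by
    intro e
    induction G.planar.connected d e with
    | refl => exact Or.inl rfl
    | @tail b c _ hbc ih =>
      rcases hbc with rfl | rfl
      · rw [G.rev_rev]
        exact ih.symm
      · rcases ih with ih | ih
        · right
          rw [← PlaneMap.faceOf_faceNext, PlaneMap.faceNext_apply, G.rev_rev,
            Equiv.symm_apply_apply]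
          exact ih
        · left
          have h1 : G.rot.symm b = G.rot b := by
            rw [Equiv.symm_apply_eq]
            exact (htwo b (hall b)).symm
          rw [← h1, PlaneMap.faceOf_rot_symm]
          exact ih
  have hfin := G.planar.face_finite d
  refine @not_finite D G.planar.infinite
    (Set.finite_univ_iff.1 ((hfin.union (hfin.image G.rev)).subset fun e _ => ?_))
  rcases hface e with h1 | h1
  · exact Or.inl (PlaneMap.faceOf_eq_iff.1 h1.symm)
  · exact Or.inr ⟨G.rev e, PlaneMap.faceOf_eq_iff.1 h1.symm, G.rev_rev e⟩

/-- Evaluate the sum equal to 1 at a point near infinity where one term exceeds its level: the sum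
of the levels is less than 1. -/
theorem sum_level_vertex (hh : G.IsEdgePotential h) (hl : G.NoTrackLoops)
    (hd : ∀ d, ¬G.SameTrack (G.rot.symm d) d) {n : D → ℤ} (hn : ∀ d, HasLevel (h d) (n d)) {d : D}
    {S : Finset D} (hS : ∀ e, e ∈ S ↔ G.SameVertex d e) : ∑ e ∈ S, n e ≤ 0 := by
  have h1 : ∀ᶠ q in Filter.cofinite, q ≠ (.inl (G.vertexOf d) : G.QuadVertex) :=
    Filter.eventually_cofinite_ne _
  have h2 : ∀ᶠ q in Filter.cofinite, ∀ e ∈ S, n e ≤ h e q :=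
    (Filter.eventually_all_finset S).2 fun e _ => (hn e).1.mono fun q hq => by omega
  obtain ⟨q, hq, hq1, hq2⟩ := ((hn d).2.2.and_eventually (h1.and h2)).exists
  have h3 := hh.sum_vertex hl hd hS hq1
  have h4 : ∑ e ∈ S, n e < ∑ e ∈ S, h e q :=
    Finset.sum_lt_sum hq2 ⟨d, (hS d).2 (Equiv.Perm.SameCycle.refl _ _), by omega⟩
  omega

/-- Group the sides of the face in pairs at its `k` black corners. Near infinity each pair exceeds
its levels by at most 1, and some pair infinitely often by 0; since the total is `k - 1`, the sum of
the levels is greater than `-1`. -/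
theorem sum_level_face (hh : G.IsEdgePotential h) (hl : G.NoTrackLoops)
    (hd : ∀ d, ¬G.SameTrack (G.rot.symm d) d) (hdeg : G.NoDegreeOne) (hvertex : G.VertexCondition)
    (hface : G.FaceCondition) {n : D → ℤ} (hn : ∀ d, HasLevel (h d) (n d)) {d : D}
    {S : Finset D} (hS : ∀ e, e ∈ S ↔ G.SameFace d e) : 0 ≤ ∑ e ∈ S, n e := by
  classical
  have hSf : ∀ e, e ∈ S ↔ G.faceOf e = G.faceOf d := fun e => by
    rw [hS, PlaneMap.faceOf_eq_iff, PlaneMap.SameFace, PlaneMap.SameFace,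
      Equiv.Perm.sameCycle_comm]
  have hwn : ∀ e, G.white (G.faceNext e) = !G.white e := fun e => by
    rw [PlaneMap.faceNext_apply, white_rot_symm, G.white_rev]
  have hpair : ∀ φ : D → ℤ, (∀ e, φ (G.rev e) = φ e) →
      ∑ e ∈ S, φ e = ∑ e ∈ S.filter (fun e => G.white e = false), (φ e + φ (G.rot e)) := by
    intro φ hφ
    have h1 : ∑ e ∈ S, (if G.white e = false then 0 else φ e) =
        ∑ e ∈ S, if G.white e = false then φ (G.rot e) else 0 := by
      refine Finset.sum_equiv G.faceNext (fun e => ?_) fun e _ => ?_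
      · rw [hSf, hSf, PlaneMap.faceOf_faceNext]
      · rw [hwn, PlaneMap.rot_faceNext, hφ]
        cases G.white e <;> simp
    rw [Finset.sum_filter]
    calc ∑ e ∈ S, φ e = ∑ e ∈ S, ((if G.white e = false then φ e else 0) +
          if G.white e = false then 0 else φ e) :=
          Finset.sum_congr rfl fun e _ => by split_ifs <;> simp
      _ = _ := by
          rw [Finset.sum_add_distrib, h1, ← Finset.sum_add_distrib]
          exact Finset.sum_congr rfl fun e _ => by split_ifs <;> simp
  have hnrev : ∀ e, n (G.rev e) = n e := fun e => by
    have := hn (G.rev e)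
    rw [hh.rev] at this
    exact this.unique (hn e)
  have hle : ∀ x, ∀ᶠ q in Filter.cofinite, h x q + h (G.rot x) q ≤ n x + n (G.rot x) + 1 := by
    intro x
    by_cases hx : G.rot (G.rot x) = x
    · have h1 := hh.add_rot_of_degree_two hl hd hdeg hx
      have h2 := (hn (G.rot x)).unique ((hn x).one_sub h1)
      filter_upwards [h1] with q hq
      omega
    · obtain ⟨k, k', h1, h2, h3, -⟩ := hh.exists_sectors hl hd hdeg hvertex hx
      rw [(hn x).unique h1, (hn (G.rot x)).unique h2]
      exact h3
  -- At a vertex of degree two the bound is always attained, so a black corner of higher degree is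
  -- needed. If there were none, consecutive white strands of the face would follow each other on
  -- one train-track around the black vertices, contradicting the face condition.
  have hex : ∃ x ∈ S.filter (fun e => G.white e = false), G.rot (G.rot x) ≠ x := by
    by_contra hall
    push Not at hall
    obtain ⟨s, hs, t, ht, hst, -⟩ := (hface d).2.1
    have hnext : ∀ y, G.faceOf y = G.faceOf d → G.white y = true →
        G.SameTrack (G.faceNext (G.faceNext y)) y := by
      intro y hy hw
      have h1 := hall (G.faceNext y) (Finset.mem_filter.2
        ⟨(hSf _).2 (by rw [PlaneMap.faceOf_faceNext, hy]), by rw [hwn, hw]; rfl⟩)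
      have h2 : G.nextStrand (G.faceNext (G.faceNext y)) = G.rev y := by
        rw [nextStrand_of_white (by rw [hwn, hwn, hw]; rfl), PlaneMap.rot_faceNext, G.rev_rev,
          Equiv.symm_apply_eq, ← PlaneMap.rot_faceNext, h1]
      have h3 := SameTrack.nextStrand_right (G := G) (G.faceNext (G.faceNext y))
      rw [h2] at h3
      exact Equiv.Perm.SameCycle.trans h3 (sameTrack_rev hw)
    -- The property attached to a black strand is that of the next strand, which is white, so that
    -- it can be transported one dart at a time around the face.
    have hg : ∀ y, (fun y => G.faceOf y = G.faceOf d →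
          G.SameTrack s (if G.white y then y else G.faceNext y)) (G.faceNext y) =
        (fun y => G.faceOf y = G.faceOf d →
          G.SameTrack s (if G.white y then y else G.faceNext y)) y := by
      intro y
      simp only [PlaneMap.faceOf_faceNext]
      refine propext (forall_congr' fun hy => ?_)
      cases hw : G.white y
      · simp [hwn, hw]
      · have h1 := hnext y hy hw
        simp only [hwn, hw, Bool.not_true, Bool.false_eq_true, if_false, if_true]
        exact ⟨fun h => Equiv.Perm.SameCycle.trans h h1,
          fun h => Equiv.Perm.SameCycle.trans h (Equiv.Perm.SameCycle.symm h1)⟩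
    have h1 := Equiv.Perm.SameCycle.apply_eq_of_invariant
      (g := fun y => G.faceOf y = G.faceOf d →
          G.SameTrack s (if G.white y then y else G.faceNext y)) hg
      (Equiv.Perm.SameCycle.trans (Equiv.Perm.SameCycle.symm hs.1) ht.1)
    have h2 := h1.mp (fun _ => by rw [if_pos hs.2]; exact Equiv.Perm.SameCycle.refl _ _)
      (PlaneMap.faceOf_eq_iff.2 ht.1.symm)
    rw [if_pos ht.2] at h2
    exact hst h2
  obtain ⟨x, hx, hx'⟩ := hex
  obtain ⟨k, k', h1, h2, -, h3⟩ := hh.exists_sectors hl hd hdeg hvertex hx'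
  rw [← (hn x).unique h1, ← (hn (G.rot x)).unique h2] at h3
  have h4 : ∀ᶠ q in Filter.cofinite, q ≠ (.inr (G.faceOf d) : G.QuadVertex) :=
    Filter.eventually_cofinite_ne _
  have h5 : ∀ᶠ q in Filter.cofinite, ∀ e ∈ S.filter (fun e => G.white e = false),
      h e q + h (G.rot e) q ≤ n e + n (G.rot e) + 1 :=
    (Filter.eventually_all_finset _).2 fun e _ => hle e
  obtain ⟨q, hq, hq1, hq2⟩ := (h3.and_eventually (h4.and h5)).exists
  have h6 := hh.sum_face hl hd hS hq1
  rw [hpair (fun e => h e q) (fun e => by rw [hh.rev])] at h6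
  have h7 : ∑ e ∈ S.filter (fun e => G.white e = false), (h e q + h (G.rot e) q) <
      ∑ e ∈ S.filter (fun e => G.white e = false), (n e + n (G.rot e) + 1) :=
    Finset.sum_lt_sum hq2 ⟨x, hx, by omega⟩
  rw [h6, Finset.sum_add_distrib, ← hpair n hnrev, Finset.sum_filter] at h7
  have h8 : ∑ e ∈ S, (if G.white e then (0 : ℤ) else 1) =
      ∑ e ∈ S, (if G.white e = false then 1 else 0) :=
    Finset.sum_congr rfl fun e _ => by cases G.white e <;> simp
  omega

end IsEdgePotential

/-! ### Crossings and finite summation -/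

theorem white_eq_not_of_exitEdge_eq {u u' : D} (h : G.exitEdge u = G.exitEdge u') (hne : u ≠ u') :
    G.white u' = !G.white u := by
  have he := white_exitEdge (G := G) u'
  have h1 := (exitEdge_eq_iff he u).1 h
  have h2 := (exitEdge_eq_iff he u').1 rfl
  set e := G.exitEdge u'
  rcases h1 with h1 | h1 <;> rcases h2 with h2 | h2
  · exact absurd (h1.trans h2.symm) hne
  · rw [h1, h2, white_rot_symm, G.white_rev]
  · rw [h1, h2, white_rot_symm, G.white_rev, Bool.not_not]
  · exact absurd (h1.trans h2.symm) hne

/-- The faces of the graph of train-tracks around the intersection of two train-tracks. -/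
theorem sides_crossing {u u' : D} (h : G.exitEdge u = G.exitEdge u') (hu : G.white u = true)
    (hu' : G.white u' = false) :
    G.leftOf (G.nextStrand u) = G.rightOf (G.nextStrand u') ∧ G.rightOf u = G.leftOf u' ∧
      G.leftOf u = G.leftOf (G.nextStrand u') ∧ G.rightOf u' = G.rightOf (G.nextStrand u) := by
  obtain ⟨e, he⟩ : ∃ e, e = G.rev u' := ⟨_, rfl⟩
  have hew : G.white e = true := by rw [he, G.white_rev, hu']; rfl
  have h2 : u' = G.rev e := by rw [he, G.rev_rev]
  have h1 : u = G.rot.symm e := by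
    rw [exitEdge, exitEdge, if_pos hu, hu'] at h
    rw [he, Equiv.eq_symm_apply, h]
    rfl
  have hb : G.white (G.rot.symm (G.rev e)) = false := by
    rw [white_rot_symm, G.white_rev, hew]; rfl
  subst h2
  subst h1
  rw [nextStrand_rot_symm hew, nextStrand_rev hew, leftOf_black hb, rightOf_black hb,
    leftOf_white hew, rightOf_white hew, leftOf_white hu, rightOf_white hu, leftOf_black hu',
    rightOf_black hu', PlaneMap.faceOf_rot_symm, PlaneMap.faceOf_rot_symm,
    PlaneMap.vertexOf_rot_symm, PlaneMap.vertexOf_rot_symm, G.rev_rev]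
  exact ⟨rfl, rfl, rfl, rfl⟩

variable (G) in
/-- The sign of a strand: positive around white vertices. -/
def colourSign (u : D) : ℤ := if G.white u then 1 else -1

namespace IsEdgePotential

variable {h : D → G.QuadVertex → ℤ}

theorem incoming (hh : G.IsEdgePotential h) (hl : G.NoTrackLoops)
    (hd : ∀ d, ¬G.SameTrack (G.rot.symm d) d) (u : D) :
    h (G.exitEdge u) (G.leftOf u) = 0 ∧ h (G.exitEdge u) (G.rightOf u) = 0 := by
  have he := white_exitEdge (G := G) u
  have h1 := (exitEdge_eq_iff he u).1 rfl
  set e := G.exitEdge u with hdef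
  have hb : G.white (G.rev e) = false := by rw [G.white_rev, he]; rfl
  have k1 := hh.vertexOf hd e
  have k2 := hh.vertexOf hd (G.rev e)
  have k3 := hh.faceOf_black hl hd hb
  rw [hh.rev] at k2 k3
  clear_value e
  rcases h1 with h1 | h1 <;> subst h1
  · have hw : G.white (G.rot.symm e) = true := by rw [white_rot_symm, he]
    rw [leftOf_white hw, rightOf_white hw, PlaneMap.vertexOf_rot_symm, PlaneMap.faceOf_rot_symm]
    exact ⟨k1, k3⟩
  · rw [leftOf_black hb, rightOf_black hb]
    exact ⟨k3, k2⟩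

theorem outgoing (hh : G.IsEdgePotential h) (hd : ∀ d, ¬G.SameTrack (G.rot.symm d) d) (u : D) :
    h (G.exitEdge u) (G.leftOf (G.nextStrand u)) = (if G.white u then 1 else 0) ∧
      h (G.exitEdge u) (G.rightOf (G.nextStrand u)) = if G.white u then 0 else 1 := by
  have he := white_exitEdge (G := G) u
  have h1 := (exitEdge_eq_iff he u).1 rfl
  set e := G.exitEdge u with hdef
  have hb : G.white (G.rot.symm (G.rev e)) = false := by
    rw [white_rot_symm, G.white_rev, he]; rfl
  have k1 := hh.vertexOf hd e
  have k2 := hh.vertexOf hd (G.rev e)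
  have k3 := hh.faceOf_white hd he
  rw [hh.rev] at k2
  clear_value e
  rcases h1 with h1 | h1 <;> subst h1
  · rw [nextStrand_rot_symm he, leftOf_black hb, rightOf_black hb, PlaneMap.vertexOf_rot_symm,
      PlaneMap.faceOf_rot_symm, G.rev_rev, white_rot_symm, he]
    exact ⟨k3, k2⟩
  · rw [nextStrand_rev he, leftOf_white he, rightOf_white he, G.white_rev, he]
    exact ⟨k1, k3⟩

/-- The edge potential seen from the two incoming strands `u`, `u'`: the colour of `u` tells on
which side its continuation bounds the wedge. -/
theorem isPotential_crossing (hh : G.IsEdgePotential h) {u u' : D}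
    (he : G.exitEdge u = G.exitEdge u') (hne : u ≠ u') :
    G.IsPotential (h (G.exitEdge u)) (fun w => G.colourSign u *
      (G.ray (G.nextStrand u) w - G.ray (G.nextStrand u') w)) := by
  have hw := white_exitEdge (G := G) u
  have h1 := (exitEdge_eq_iff hw u).1 rfl
  have h2 := (exitEdge_eq_iff hw u').1 he.symm
  have h3 := hh.isPotential _ hw
  set e := G.exitEdge u
  clear_value e
  intro s
  rw [h3 s, Pi.sub_apply, colourSign]
  rcases h1 with h1 | h1 <;> rcases h2 with h2 | h2
  · exact absurd (h1.trans h2.symm) hne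
  · rw [h1, h2, nextStrand_rot_symm hw, nextStrand_rev hw, white_rot_symm, if_pos hw]
    ring
  · rw [h1, h2, nextStrand_rot_symm hw, nextStrand_rev hw, G.white_rev, hw]
    simp
  · exact absurd (h1.trans h2.symm) hne

end IsEdgePotential

/-- The weight is constant on the fibres of `ρ`, and a fibre of nonzero weight lies entirely in `Δ`,
so its sum can be evaluated by `hfib`. -/
theorem sum_fiber_nonneg {Q : Type*} (ρ : D → Q) (n : D → ℤ) (w : Q → ℤ) (hw : ∀ q, 0 ≤ w q)
    (hfib : ∀ S : Finset D, ∀ d, (∀ e, e ∈ S ↔ ρ e = ρ d) → 0 ≤ ∑ e ∈ S, n e) (Δ : Finset D)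
    (hΔ : ∀ d, w (ρ d) ≠ 0 → d ∈ Δ) : 0 ≤ ∑ d ∈ Δ, n d * w (ρ d) := by
  classical
  rw [← Finset.sum_fiberwise_of_maps_to (t := Δ.image ρ) (g := ρ)
    (fun d hd => Finset.mem_image_of_mem ρ hd)]
  refine Finset.sum_nonneg fun q hq => ?_
  obtain ⟨d, -, rfl⟩ := Finset.mem_image.1 hq
  have h1 : ∑ e ∈ Δ.filter (fun e => ρ e = ρ d), n e * w (ρ e) =
      (∑ e ∈ Δ.filter (fun e => ρ e = ρ d), n e) * w (ρ d) := by
    rw [Finset.sum_mul]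
    exact Finset.sum_congr rfl fun e he => by rw [(Finset.mem_filter.1 he).2]
  rw [h1]
  by_cases h0 : w (ρ d) = 0
  · rw [h0, mul_zero]
  · refine mul_nonneg (hfib _ d fun e => ?_) (hw _)
    rw [Finset.mem_filter]
    exact ⟨fun h => h.2, fun h => ⟨hΔ e (h ▸ h0), h⟩⟩

theorem ray_sub_ray_pow [DecidableEq D] (hl : G.NoTrackLoops) (s u : D) (n : ℕ) :
    G.ray s u - G.ray ((G.nextStrand ^ n) s) u =
      ∑ i ∈ Finset.range n, if u = (G.nextStrand ^ i) s then 1 else 0 := by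
  induction n with
  | zero => simp
  | succ n ih =>
    rw [Finset.sum_range_succ, ← ih, ray_add_ite_eq hl ((G.nextStrand ^ n) s), pow_succ',
      Equiv.Perm.mul_apply]
    ring

open Classical in
/-- The indicator function of a train-track is a cycle. -/
theorem isCycle_track (s : D) : G.IsCycle (fun u => if G.SameTrack s u then 1 else 0) := by
  intro e he
  have h1 : G.SameTrack s (G.rev e) ↔ G.SameTrack s e :=
    ⟨fun h => Equiv.Perm.SameCycle.trans h (sameTrack_rev he),
      fun h => Equiv.Perm.SameCycle.trans h (Equiv.Perm.SameCycle.symm (sameTrack_rev he))⟩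
  have h2 : G.SameTrack s (G.rot.symm e) ↔ G.SameTrack s (G.rot.symm (G.rev e)) :=
    ⟨fun h => Equiv.Perm.SameCycle.trans h (sameTrack_rot_symm he),
      fun h => Equiv.Perm.SameCycle.trans h (Equiv.Perm.SameCycle.symm (sameTrack_rot_symm he))⟩
  simp only [boundary, h1, h2]
  ring

/-! ### Bigons and their indicator function -/

/-- Two train-tracks with a common edge `exitEdge s = exitEdge t` and another one
`exitEdge (nextStrand ^ m s) = exitEdge (nextStrand ^ n t)`, the second train-track being disjoint
from the first one in between. -/
structure IsBigon (s t : D) (m n : ℕ) : Prop where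
  not_sameTrack : ¬G.SameTrack s t
  exitEdge_eq : G.exitEdge s = G.exitEdge t
  pos_left : 0 < m
  pos_right : 0 < n
  exitEdge_pow_eq : G.exitEdge ((G.nextStrand ^ m) s) = G.exitEdge ((G.nextStrand ^ n) t)
  disjoint : ∀ i, 0 < i → i < n → ∀ w, G.SameTrack s w →
    G.exitEdge w ≠ G.exitEdge ((G.nextStrand ^ i) t)

/-- Minimise the length `n` of the second side. A further crossing inside that side, at position `k`
on the first train-track, would give a parallel bigon with a shorter second side: one ending at the
same edge if `k < m`, one starting at the same edge otherwise. -/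
theorem HasParallelBigon.exists_isBigon (h : G.HasParallelBigon) :
    ∃ s t m n, IsBigon (G := G) s t m n := by
  classical
  have hex : ∃ n s t m, ¬G.SameTrack s t ∧ G.exitEdge s = G.exitEdge t ∧ 0 < m ∧ 0 < n ∧
      G.exitEdge ((G.nextStrand ^ m) s) = G.exitEdge ((G.nextStrand ^ n) t) := by
    obtain ⟨s, t, h1, h2, m, n, h3, h4, h5, -⟩ := h
    exact ⟨n, s, t, m, h1, h2, h3, h4, h5⟩
  obtain ⟨s, t, m, h1, h2, h3, h4, h5⟩ := Nat.find_spec hex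
  refine ⟨s, t, m, Nat.find hex, h1, h2, h3, h4, h5, ?_⟩
  rintro i hi hin w ⟨k, rfl⟩ hw
  by_cases hk : k < m
  · refine Nat.find_min hex (m := Nat.find hex - i) (by omega)
      ⟨(G.nextStrand ^ k) s, (G.nextStrand ^ i) t, (m - k).toNat, ?_, hw, by omega, by omega, ?_⟩
    · intro h
      exact h1 (Equiv.Perm.SameCycle.trans ⟨k, rfl⟩
        (Equiv.Perm.SameCycle.trans h (Equiv.Perm.SameCycle.symm (SameTrack.pow t i))))
    · rw [← zpow_natCast, Int.toNat_of_nonneg (by omega), ← Equiv.Perm.mul_apply, ← zpow_add,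
        ← Equiv.Perm.mul_apply, ← pow_add, Nat.sub_add_cancel hin.le, sub_add_cancel, zpow_natCast]
      exact h5
  · refine Nat.find_min hex hin ⟨s, t, k.toNat, h1, h2, by omega, hi, ?_⟩
    rw [← zpow_natCast, Int.toNat_of_nonneg (by omega)]
    exact hw

namespace IsBigon

variable {s t : D} {m n : ℕ}

/-- A potential that jumps along the two train-tracks only is constant on both sides along the
second side of the bigon. -/
theorem const_right (hB : IsBigon (G := G) s t m n) (hd : ∀ d, ¬G.SameTrack (G.rot.symm d) d)
    {H : G.QuadVertex → ℤ} {z : D → ℤ} (hH : G.IsPotential H z)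
    (hz : ∀ w, z w ≠ 0 → G.SameTrack s w ∨ G.SameTrack t w) {i : ℕ} (hi : i < n) :
    H (G.leftOf ((G.nextStrand ^ (i + 1)) t)) = H (G.leftOf (G.nextStrand t)) ∧
      H (G.rightOf ((G.nextStrand ^ (i + 1)) t)) = H (G.rightOf (G.nextStrand t)) := by
  induction i with
  | zero => simp
  | succ i ih =>
    have ih := ih (by omega)
    rw [← ih.1, ← ih.2, pow_succ' _ (i + 1), Equiv.Perm.mul_apply]
    have key : ∀ w, G.exitEdge w = G.exitEdge ((G.nextStrand ^ (i + 1)) t) →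
        w ≠ (G.nextStrand ^ (i + 1)) t → ¬(G.SameTrack s w ∨ G.SameTrack t w) := by
      rintro w hw hne (h | h)
      · exact hB.disjoint (i + 1) (by omega) hi w h hw
      · exact hne (eq_of_exitEdge_eq hd (Equiv.Perm.SameCycle.trans
          (Equiv.Perm.SameCycle.symm h) (SameTrack.pow t (i + 1))) hw)
    refine hH.nextStrand (fun w hw hne => ?_) fun w hw hne => ?_
    · by_contra h0
      exact key w hw hne (hz w h0)
    · by_contra h0
      obtain ⟨w, rfl⟩ := G.nextStrand.surjective w
      rw [entryEdge_nextStrand] at hw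
      have h1 := Equiv.Perm.SameCycle.symm (SameTrack.nextStrand_right (G := G) w)
      refine key w hw (fun h => hne (by rw [h])) ((hz _ h0).imp (fun h => ?_) fun h => ?_)
      · exact Equiv.Perm.SameCycle.trans h h1
      · exact Equiv.Perm.SameCycle.trans h h1

theorem ne_start (hB : IsBigon (G := G) s t m n) : s ≠ t := by
  rintro rfl
  exact hB.not_sameTrack (Equiv.Perm.SameCycle.refl _ _)

theorem ne_of_sameTrack (hB : IsBigon (G := G) s t m n) {u u' : D} (h : G.SameTrack s u)
    (h' : G.SameTrack t u') : u ≠ u' := by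
  rintro rfl
  exact hB.not_sameTrack (Equiv.Perm.SameCycle.trans h (Equiv.Perm.SameCycle.symm h'))

theorem white_start (hB : IsBigon (G := G) s t m n) : G.white s = !G.white t :=
  white_eq_not_of_exitEdge_eq hB.exitEdge_eq.symm hB.ne_start.symm

theorem white_end (hB : IsBigon (G := G) s t m n) :
    G.white ((G.nextStrand ^ m) s) = !G.white ((G.nextStrand ^ n) t) :=
  white_eq_not_of_exitEdge_eq hB.exitEdge_pow_eq.symm
    (hB.ne_of_sameTrack (SameTrack.pow s m) (SameTrack.pow t n)).symm

/-- The two train-tracks cross each other in opposite directions at both ends of the bigon. -/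
theorem white_right (hB : IsBigon (G := G) s t m n) (hd : ∀ d, ¬G.SameTrack (G.rot.symm d) d) :
    G.white ((G.nextStrand ^ n) t) = !G.white t := by
  classical
  -- This potential tells the left of the first train-track from its right. The second side of the
  -- bigon stays on one side of it, so it must leave on the side from which it will return.
  obtain ⟨H, hH⟩ := (isCycle_track (G := G) s).exists_potential
  have hs : ∀ i : ℕ, H (G.leftOf ((G.nextStrand ^ i) s)) = H (G.leftOf s) ∧
      H (G.rightOf ((G.nextStrand ^ i) s)) = H (G.leftOf s) - 1 := by
    intro i
    suffices h1 : H (G.leftOf ((G.nextStrand ^ i) s)) = H (G.leftOf s) by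
      have h2 := hH ((G.nextStrand ^ i) s)
      dsimp only at h2
      rw [if_pos (SameTrack.pow s i)] at h2
      exact ⟨h1, by linarith⟩
    induction i with
    | zero => rfl
    | succ i ih =>
      rw [← ih, pow_succ', Equiv.Perm.mul_apply]
      refine (hH.nextStrand (fun w hw hne => if_neg fun h => hne ?_)
        fun w hw hne => if_neg fun h => hne ?_).1
      · exact eq_of_exitEdge_eq hd (Equiv.Perm.SameCycle.trans
          (Equiv.Perm.SameCycle.symm h) (SameTrack.pow s i)) hw
      · rw [← entryEdge_nextStrand] at hw
        refine eq_of_entryEdge_eq hd (Equiv.Perm.SameCycle.trans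
          (Equiv.Perm.SameCycle.symm h) ?_) hw
        exact (SameTrack.pow s i).trans (SameTrack.nextStrand_right _)
  have ht := hB.const_right hd hH (fun w hw => Or.inl (by by_contra h; exact hw (if_neg h)))
    (i := n - 1) (by have := hB.pos_right; omega)
  rw [Nat.sub_add_cancel hB.pos_right] at ht
  have hz : ∀ i : ℕ, H (G.leftOf ((G.nextStrand ^ i) t)) = H (G.rightOf ((G.nextStrand ^ i) t)) := by
    intro i
    have h1 := hH ((G.nextStrand ^ i) t)
    dsimp only at h1
    rw [if_neg fun h => hB.ne_of_sameTrack h (SameTrack.pow t i) rfl] at h1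
    linarith
  have hz1 := hz 1
  have hzn := hz n
  have hs1 := hs 1
  have hsm := hs m
  rw [pow_one] at hz1 hs1
  have w1 := hB.white_start
  have w2 := hB.white_end
  cases h1 : G.white t <;> cases h2 : G.white ((G.nextStrand ^ n) t)
  · exfalso
    rw [h1] at w1
    rw [h2] at w2
    have c1 := (sides_crossing hB.exitEdge_eq w1 h1).1
    have c2 := (sides_crossing hB.exitEdge_pow_eq w2 h2).2.1
    rw [c1] at hs1
    rw [c2] at hsm
    omega
  · rfl
  · rfl
  · exfalso
    rw [h1] at w1
    rw [h2] at w2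
    have c1 := (sides_crossing hB.exitEdge_eq.symm h1 w1).1
    have c2 := (sides_crossing hB.exitEdge_pow_eq.symm h2 w2).2.1
    rw [← c1] at hs1
    rw [← c2] at hsm
    omega

end IsBigon

theorem SameTrack.of_nextStrand {s u : D} (h : G.SameTrack (G.nextStrand s) u) :
    G.SameTrack s u :=
  Equiv.Perm.SameCycle.trans (SameTrack.nextStrand_right s) h

theorem pow_nextStrand (s : D) (i : ℕ) :
    (G.nextStrand ^ i) (G.nextStrand s) = (G.nextStrand ^ (i + 1)) s := by
  rw [pow_succ, Equiv.Perm.mul_apply]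

theorem exitEdge_of_black {u : D} (hu : G.white u = false) : G.exitEdge u = G.rev u := by
  rw [exitEdge, hu]
  rfl

/-- An alternating sum along a train-track of a function on edges telescopes. -/
theorem sum_colourSign_mul {c : D → ℤ} (hc : ∀ d, c (G.rev d) = c d) (t : D) (n : ℕ) :
    ∑ i ∈ Finset.range n, G.colourSign ((G.nextStrand ^ (i + 1)) t) *
      c ((G.nextStrand ^ (i + 1)) t) =
      (if G.white t then 0 else c t) -
        if G.white ((G.nextStrand ^ n) t) then 0 else c ((G.nextStrand ^ n) t) := by
  induction n with
  | zero => simp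
  | succ n ih =>
    rw [Finset.sum_range_succ, ih, pow_succ' _ n, Equiv.Perm.mul_apply]
    generalize (G.nextStrand ^ n) t = p
    rw [colourSign, white_nextStrand]
    cases hp : G.white p
    · rw [nextStrand_of_black hp, hc]
      simp
    · simp
      ring

variable (G) in
/-- The chain formed by the two sides of a bigon, with opposite signs. -/
noncomputable def bigonChain (s t : D) (m n : ℕ) (u : D) : ℤ :=
  G.colourSign t * ((G.ray (G.nextStrand t) u - G.ray ((G.nextStrand ^ n) (G.nextStrand t)) u) -
    (G.ray (G.nextStrand s) u - G.ray ((G.nextStrand ^ m) (G.nextStrand s)) u))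

theorem bigonChain_eq_sum [DecidableEq D] (hl : G.NoTrackLoops) (s t : D) (m n : ℕ) (u : D) :
    G.bigonChain s t m n u = G.colourSign t *
      (∑ i ∈ Finset.range n, (if u = (G.nextStrand ^ (i + 1)) t then 1 else 0) -
        ∑ i ∈ Finset.range m, if u = (G.nextStrand ^ (i + 1)) s then 1 else 0) := by
  rw [bigonChain, ray_sub_ray_pow hl, ray_sub_ray_pow hl]
  simp only [pow_nextStrand]

theorem bigonChain_eq_zero (hl : G.NoTrackLoops) {s t : D} {m n : ℕ} {u : D}
    (ht : ∀ i < n, u ≠ (G.nextStrand ^ (i + 1)) t) (hs : ∀ i < m, u ≠ (G.nextStrand ^ (i + 1)) s) :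
    G.bigonChain s t m n u = 0 := by
  classical
  rw [bigonChain_eq_sum hl, Finset.sum_eq_zero fun i hi => if_neg (ht i (Finset.mem_range.1 hi)),
    Finset.sum_eq_zero fun i hi => if_neg (hs i (Finset.mem_range.1 hi))]
  simp

theorem finite_support_bigonChain (hl : G.NoTrackLoops) (s t : D) (m n : ℕ) :
    (G.bigonChain s t m n).support.Finite := by
  refine (((Set.finite_Iio n).image fun i => (G.nextStrand ^ (i + 1)) t).union
    ((Set.finite_Iio m).image fun i => (G.nextStrand ^ (i + 1)) s)).subset fun u hu => ?_
  by_contra h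
  refine hu (bigonChain_eq_zero hl (fun i hi h' => h (Or.inl ⟨i, hi, h'.symm⟩))
    fun i hi h' => h (Or.inr ⟨i, hi, h'.symm⟩))

namespace IsBigon

variable {s t : D} {m n : ℕ} {h : D → G.QuadVertex → ℤ}

/-- The crossings at the two ends have opposite signs, so the rays beyond the second end cancel and
only the two sides of the bigon remain. -/
theorem isPotential (hB : IsBigon (G := G) s t m n) (hh : G.IsEdgePotential h)
    (hd : ∀ d, ¬G.SameTrack (G.rot.symm d) d) :
    G.IsPotential (h (G.exitEdge t) + h (G.exitEdge ((G.nextStrand ^ n) t)))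
      (G.bigonChain s t m n) := by
  have h1 := hh.isPotential_crossing hB.exitEdge_eq.symm hB.ne_start.symm
  have h2 := hh.isPotential_crossing hB.exitEdge_pow_eq.symm
    (hB.ne_of_sameTrack (SameTrack.pow s m) (SameTrack.pow t n)).symm
  have h3 : G.colourSign ((G.nextStrand ^ n) t) = -G.colourSign t := by
    rw [colourSign, colourSign, hB.white_right hd]
    cases G.white t <;> simp
  convert h1.add h2 using 1
  ext u
  simp only [bigonChain, Pi.add_apply, h3, pow_nextStrand, pow_succ', Equiv.Perm.mul_apply]
  ring

/-- Along the second side both edge potentials are constant; read the one of the first edge just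
after it, and the one of the last edge just before it, where it is 0. -/
theorem right_sides (hB : IsBigon (G := G) s t m n) (hh : G.IsEdgePotential h)
    (hl : G.NoTrackLoops) (hd : ∀ d, ¬G.SameTrack (G.rot.symm d) d) {i : ℕ} (hi : i < n) :
    (h (G.exitEdge t) + h (G.exitEdge ((G.nextStrand ^ n) t)))
        (G.leftOf ((G.nextStrand ^ (i + 1)) t)) = (if G.white t then 1 else 0) ∧
      (h (G.exitEdge t) + h (G.exitEdge ((G.nextStrand ^ n) t)))
        (G.rightOf ((G.nextStrand ^ (i + 1)) t)) = if G.white t then 0 else 1 := by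
  have key : ∀ u u' w : D, G.colourSign u *
      (G.ray (G.nextStrand u) w - G.ray (G.nextStrand u') w) ≠ 0 →
      G.SameTrack u' w ∨ G.SameTrack u w := by
    intro u u' w hw
    by_contra h0
    rw [not_or] at h0
    refine hw ?_
    rw [ray_eq_zero_of_not_sameTrack fun h => h0.1 h.of_nextStrand,
      ray_eq_zero_of_not_sameTrack fun h => h0.2 h.of_nextStrand, sub_zero, mul_zero]
  have h1 := hh.isPotential_crossing hB.exitEdge_eq.symm hB.ne_start.symm
  have h2 := hh.isPotential_crossing hB.exitEdge_pow_eq.symm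
    (hB.ne_of_sameTrack (SameTrack.pow s m) (SameTrack.pow t n)).symm
  have hpos := hB.pos_right
  have e1 := hB.const_right hd h1 (fun w hw => key _ _ w hw) hi
  have k2 : ∀ w, G.colourSign ((G.nextStrand ^ n) t) *
      (G.ray (G.nextStrand ((G.nextStrand ^ n) t)) w -
        G.ray (G.nextStrand ((G.nextStrand ^ m) s)) w) ≠ 0 →
      G.SameTrack s w ∨ G.SameTrack t w := fun w hw => (key _ _ w hw).imp
    (fun h => Equiv.Perm.SameCycle.trans (SameTrack.pow s m) h)
    (fun h => Equiv.Perm.SameCycle.trans (SameTrack.pow t n) h)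
  have e2 := hB.const_right hd h2 k2 hi
  have e3 := hB.const_right hd h2 k2 (i := n - 1) (by omega)
  rw [Nat.sub_add_cancel hpos] at e3
  have e4 := hh.incoming hl hd ((G.nextStrand ^ n) t)
  have e5 := hh.outgoing hd t
  rw [Pi.add_apply, Pi.add_apply, e1.1, e1.2, e2.1, e2.2, ← e3.1, ← e3.2, e4.1, e4.2, e5.1, e5.2,
    add_zero, add_zero]
  exact ⟨rfl, rfl⟩

/-- The second train-track may cross the first one elsewhere, but the chain carries only its segment
between the ends, which meets the first train-track nowhere else. The argument covers the part
beyond the bigon as well as its first side. -/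
theorem const_left (hB : IsBigon (G := G) s t m n) (hh : G.IsEdgePotential h)
    (hl : G.NoTrackLoops) (hd : ∀ d, ¬G.SameTrack (G.rot.symm d) d) {i : ℕ} (hi : 0 < i)
    (him : i ≠ m) :
    (h (G.exitEdge t) + h (G.exitEdge ((G.nextStrand ^ n) t)))
        (G.leftOf ((G.nextStrand ^ (i + 1)) s)) =
        (h (G.exitEdge t) + h (G.exitEdge ((G.nextStrand ^ n) t)))
          (G.leftOf ((G.nextStrand ^ i) s)) ∧
      (h (G.exitEdge t) + h (G.exitEdge ((G.nextStrand ^ n) t)))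
        (G.rightOf ((G.nextStrand ^ (i + 1)) s)) =
        (h (G.exitEdge t) + h (G.exitEdge ((G.nextStrand ^ n) t)))
          (G.rightOf ((G.nextStrand ^ i) s)) := by
  have inj : ∀ a b : ℕ, G.exitEdge ((G.nextStrand ^ a) s) = G.exitEdge ((G.nextStrand ^ b) s) →
      a = b := fun a b hab => hl.pow_injective s (eq_of_exitEdge_eq hd (Equiv.Perm.SameCycle.trans
        (Equiv.Perm.SameCycle.symm (SameTrack.pow s a)) (SameTrack.pow s b)) hab)
  have key : ∀ j ≤ n, G.exitEdge ((G.nextStrand ^ j) t) ≠ G.exitEdge ((G.nextStrand ^ i) s) := by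
    intro j hj hij
    rcases Nat.eq_zero_or_pos j with rfl | hj0
    · have := inj 0 i (hB.exitEdge_eq.trans hij)
      omega
    · rcases hj.eq_or_lt with rfl | hjn
      · exact him (inj m i (hB.exitEdge_pow_eq.trans hij)).symm
      · exact hB.disjoint j hj0 hjn _ (SameTrack.pow s i) hij.symm
  rw [pow_succ' _ i, Equiv.Perm.mul_apply]
  refine (hB.isPotential hh hd).nextStrand (fun w hw hne => ?_) fun w hw hne => ?_
  · refine bigonChain_eq_zero hl (fun j hj hwj => ?_) fun j hj hwj => ?_
    · exact key (j + 1) hj (hwj ▸ hw)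
    · rw [hwj] at hw hne
      exact hne (by rw [inj _ _ hw])
  · refine bigonChain_eq_zero hl (fun j hj hwj => ?_) fun j hj hwj => ?_
    · rw [hwj, pow_succ', Equiv.Perm.mul_apply, entryEdge_nextStrand] at hw
      exact key j hj.le hw
    · rw [hwj, pow_succ', Equiv.Perm.mul_apply] at hw hne
      rw [entryEdge_nextStrand] at hw
      exact hne (by rw [inj _ _ hw])

theorem bigonChain_left (hB : IsBigon (G := G) s t m n) (hl : G.NoTrackLoops) :
    G.bigonChain s t m n (G.nextStrand s) = -G.colourSign t := by
  have h1 : ∀ k, ¬G.SameTrack ((G.nextStrand ^ k) (G.nextStrand t)) (G.nextStrand s) := by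
    intro k h
    exact hB.not_sameTrack (Equiv.Perm.SameCycle.symm (Equiv.Perm.SameCycle.trans (SameTrack.pow t
      (k + 1)) (Equiv.Perm.SameCycle.trans (pow_nextStrand (G := G) t k ▸ h)
      (Equiv.Perm.SameCycle.symm (SameTrack.nextStrand_right s)))))
  rw [bigonChain, ray_eq_zero_of_not_sameTrack (s := G.nextStrand t) (h1 0), ray_eq_zero_of_not_sameTrack (h1 n),
    ray_self, ray_eq_zero fun k hk => ?_]
  · ring
  · rw [← Equiv.Perm.mul_apply, ← pow_add] at hk
    exact hl _ (k + m) (by have := hB.pos_left; omega) hk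

theorem left_sides (hB : IsBigon (G := G) s t m n) (hh : G.IsEdgePotential h)
    (hl : G.NoTrackLoops) (hd : ∀ d, ¬G.SameTrack (G.rot.symm d) d) {i : ℕ} (hi : i < m) :
    (h (G.exitEdge t) + h (G.exitEdge ((G.nextStrand ^ n) t)))
        (G.leftOf ((G.nextStrand ^ (i + 1)) s)) = (if G.white t then 0 else 1) ∧
      (h (G.exitEdge t) + h (G.exitEdge ((G.nextStrand ^ n) t)))
        (G.rightOf ((G.nextStrand ^ (i + 1)) s)) = if G.white t then 1 else 0 := by
  induction i with
  | zero =>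
    have h1 := hB.right_sides hh hl hd hB.pos_right
    have h2 := hB.isPotential hh hd (G.nextStrand s)
    rw [hB.bigonChain_left hl, colourSign] at h2
    rw [zero_add, pow_one] at h1 ⊢
    have w1 := hB.white_start
    cases hw : G.white t
    · rw [hw] at w1 h1 h2
      rw [(sides_crossing hB.exitEdge_eq w1 hw).1] at h2 ⊢
      simp only [Bool.false_eq_true, if_false] at h1 h2 ⊢
      constructor <;> linarith
    · rw [hw] at w1 h1 h2
      rw [← (sides_crossing hB.exitEdge_eq.symm hw w1).1] at h2 ⊢
      simp only [if_true] at h1 h2 ⊢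
      constructor <;> linarith
  | succ i ih =>
    have h1 := hB.const_left hh hl hd (i := i + 1) (by omega) (by omega)
    rw [h1.1, h1.2]
    exact ih (by omega)

theorem eq_zero_or_one (hB : IsBigon (G := G) s t m n) (hh : G.IsEdgePotential h)
    (hl : G.NoTrackLoops) (hd : ∀ d, ¬G.SameTrack (G.rot.symm d) d) (q : G.QuadVertex) :
    (h (G.exitEdge t) + h (G.exitEdge ((G.nextStrand ^ n) t))) q = 0 ∨
      (h (G.exitEdge t) + h (G.exitEdge ((G.nextStrand ^ n) t))) q = 1 := by
  have h0 := hB.right_sides hh hl hd hB.pos_right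
  refine quadVertex_induction (G := G)
    (P := fun q => (h (G.exitEdge t) + h (G.exitEdge ((G.nextStrand ^ n) t))) q = 0 ∨
      (h (G.exitEdge t) + h (G.exitEdge ((G.nextStrand ^ n) t))) q = 1)
    (fun u => ?_) (q := G.leftOf ((G.nextStrand ^ (0 + 1)) t)) ?_ q
  · by_cases ht : ∃ i < n, u = (G.nextStrand ^ (i + 1)) t
    · obtain ⟨i, hi, rfl⟩ := ht
      rw [(hB.right_sides hh hl hd hi).1, (hB.right_sides hh hl hd hi).2]
      cases G.white t <;> simp
    by_cases hs : ∃ i < m, u = (G.nextStrand ^ (i + 1)) s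
    · obtain ⟨i, hi, rfl⟩ := hs
      rw [(hB.left_sides hh hl hd hi).1, (hB.left_sides hh hl hd hi).2]
      cases G.white t <;> simp
    have h1 := hB.isPotential hh hd u
    rw [bigonChain_eq_zero hl (fun i hi h => ht ⟨i, hi, h⟩) (fun i hi h => hs ⟨i, hi, h⟩),
      sub_eq_zero] at h1
    rw [h1]
  · rw [h0.1]
    cases G.white t <;> simp

/-- Past the last edge the first train-track is outside the bigon: there it borders the outer side
of the end of the second side, and it never crosses the chain again. -/
theorem outer_side (hB : IsBigon (G := G) s t m n) (hh : G.IsEdgePotential h)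
    (hl : G.NoTrackLoops) (hd : ∀ d, ¬G.SameTrack (G.rot.symm d) d) (k : ℕ) :
    (h (G.exitEdge t) + h (G.exitEdge ((G.nextStrand ^ n) t)))
      (G.leftOf ((G.nextStrand ^ (m + 1 + k)) s)) = 0 := by
  induction k with
  | zero =>
    have h1 := hB.right_sides hh hl hd (i := n - 1) (by have := hB.pos_right; omega)
    rw [Nat.sub_add_cancel hB.pos_right] at h1
    have h2 := hB.isPotential hh hd (G.nextStrand ((G.nextStrand ^ m) s))
    rw [bigonChain_eq_zero hl, sub_eq_zero] at h2
    · rw [add_zero, pow_succ', Equiv.Perm.mul_apply]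
      have w1 := hB.white_end
      have w2 := hB.white_right hd
      cases hw : G.white t
      · rw [hw] at w2 h1
        rw [w2] at w1
        rw [← (sides_crossing hB.exitEdge_pow_eq.symm w2 w1).2.2.1, h1.1]
        rfl
      · rw [hw] at w2 h1
        rw [w2] at w1
        rw [h2, ← (sides_crossing hB.exitEdge_pow_eq w1 w2).2.2.2, h1.2]
        rfl
    · intro i _ hi
      refine hB.ne_of_sameTrack ?_ (SameTrack.pow t (i + 1)) hi
      exact (SameTrack.pow s m).trans (SameTrack.nextStrand_right _)
    · intro i hi hi'
      rw [← Equiv.Perm.mul_apply, ← pow_succ'] at hi'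
      have := hl.pow_injective s hi'
      omega
  | succ k ih => rw [← ih, ← add_assoc, (hB.const_left hh hl hd (by omega) (by omega)).1]

/-- The chain is finite, so its potential is constant near infinity; the first train-track goes to
infinity through places where the value is 0. -/
theorem eventually_eq_zero (hB : IsBigon (G := G) s t m n) (hh : G.IsEdgePotential h)
    (hl : G.NoTrackLoops) (hd : ∀ d, ¬G.SameTrack (G.rot.symm d) d) :
    ∀ᶠ q in Filter.cofinite,
      (h (G.exitEdge t) + h (G.exitEdge ((G.nextStrand ^ n) t))) q = 0 := by
  obtain ⟨c, hc⟩ := (hB.isPotential hh hd).eventually_const (finite_support_bigonChain hl s t m n)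
  have h1 := (hl.tendsto_leftOf ((G.nextStrand ^ (m + 1)) s)).eventually hc
  obtain ⟨k, hk⟩ := h1.exists
  rw [← Equiv.Perm.mul_apply, ← pow_add, add_comm k, hB.outer_side hh hl hd] at hk
  rwa [← hk] at hc

/-- Near infinity the two edge potentials are opposite, and the opposite of values `n`, `n + 1` is
`-n - 1`, `-n`. -/
theorem level_add (hB : IsBigon (G := G) s t m n) (hh : G.IsEdgePotential h)
    (hl : G.NoTrackLoops) (hd : ∀ d, ¬G.SameTrack (G.rot.symm d) d) {c : D → ℤ}
    (hc : ∀ d, HasLevel (h d) (c d)) :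
    c (G.exitEdge t) + c (G.exitEdge ((G.nextStrand ^ n) t)) = -1 := by
  have h0 := hB.eventually_eq_zero hh hl hd
  have h2 := hc (G.exitEdge ((G.nextStrand ^ n) t))
  have h1 : HasLevel (h (G.exitEdge t)) (-c (G.exitEdge ((G.nextStrand ^ n) t)) - 1) := by
    refine ⟨?_, (h2.2.2.and_eventually h0).mono fun q hq => ?_,
      (h2.2.1.and_eventually h0).mono fun q hq => ?_⟩
    · filter_upwards [h0, h2.1] with q hq hq'
      rw [Pi.add_apply] at hq
      omega
    · have := hq.2
      rw [Pi.add_apply] at this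
      omega
    · have := hq.2
      rw [Pi.add_apply] at this
      omega
  have := (hc (G.exitEdge t)).unique h1
  omega

/-- A black strand and the white one that follows it carry the same edge with opposite signs, so the
sum along each side telescopes. As the colours are opposite at the ends of each side and between the
two sides, each end edge survives exactly once. -/
theorem sum_level_mul_bigonChain (hB : IsBigon (G := G) s t m n) (hl : G.NoTrackLoops)
    (hd : ∀ d, ¬G.SameTrack (G.rot.symm d) d) {c : D → ℤ} (hc : ∀ d, c (G.rev d) = c d)
    {Δ : Finset D} (ht : ∀ i < n, (G.nextStrand ^ (i + 1)) t ∈ Δ)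
    (hs : ∀ i < m, (G.nextStrand ^ (i + 1)) s ∈ Δ) :
    ∑ d ∈ Δ, G.colourSign d * c d * G.bigonChain s t m n d =
      -(c (G.exitEdge t) + c (G.exitEdge ((G.nextStrand ^ n) t))) := by
  classical
  have key : ∀ (p : D) (k : ℕ), (∀ i < k, (G.nextStrand ^ (i + 1)) p ∈ Δ) →
      ∑ d ∈ Δ, G.colourSign d * c d *
        ∑ i ∈ Finset.range k, (if d = (G.nextStrand ^ (i + 1)) p then 1 else 0) =
      (if G.white p then 0 else c p) -
        if G.white ((G.nextStrand ^ k) p) then 0 else c ((G.nextStrand ^ k) p) := by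
    intro p k hk
    rw [← sum_colourSign_mul hc]
    simp only [Finset.mul_sum]
    rw [Finset.sum_comm]
    refine Finset.sum_congr rfl fun i hi => ?_
    simp [hk i (Finset.mem_range.1 hi)]
  have h1 : ∑ d ∈ Δ, G.colourSign d * c d * G.bigonChain s t m n d = G.colourSign t *
      (∑ d ∈ Δ, G.colourSign d * c d *
        ∑ i ∈ Finset.range n, (if d = (G.nextStrand ^ (i + 1)) t then 1 else 0) -
      ∑ d ∈ Δ, G.colourSign d * c d *
        ∑ i ∈ Finset.range m, (if d = (G.nextStrand ^ (i + 1)) s then 1 else 0)) := by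
    rw [← Finset.sum_sub_distrib, Finset.mul_sum]
    refine Finset.sum_congr rfl fun d _ => ?_
    rw [bigonChain_eq_sum hl]
    ring
  rw [h1, key t n ht, key s m hs, colourSign]
  have w1 := hB.white_start
  have w2 := hB.white_end
  have w3 := hB.white_right hd
  cases hw : G.white t <;> rw [hw] at w1 w3 <;> rw [w3] at w2 ⊢ <;> rw [w1, w2]
  · rw [← hB.exitEdge_pow_eq, exitEdge_of_black hw, exitEdge_of_black w2, hc, hc]
    simp
  · rw [← hB.exitEdge_eq, exitEdge_of_black w1, exitEdge_of_black w3, hc, hc]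
    simp
    ring

end IsBigon

/-! ### Gauss-Bonnet inequality and conclusion -/

/-- A discrete Gauss-Bonnet argument: the sum over the edges of the jump of a nonnegative potential
between the adjacent faces and vertices, weighted by levels, is nonnegative. -/
theorem sum_level_mul_nonpos {h : D → G.QuadVertex → ℤ} (hh : G.IsEdgePotential h)
    (hl : G.NoTrackLoops) (hd : ∀ d, ¬G.SameTrack (G.rot.symm d) d) (hdeg : G.NoDegreeOne)
    (hvertex : G.VertexCondition) (hface : G.FaceCondition) {c : D → ℤ}
    (hc : ∀ d, HasLevel (h d) (c d)) {F : G.QuadVertex → ℤ} {z : D → ℤ} (hF : G.IsPotential F z)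
    (hF0 : ∀ q, 0 ≤ F q) {Δ : Finset D}
    (hΔ : ∀ d, F (G.leftOf d) ≠ 0 ∨ F (G.rightOf d) ≠ 0 → d ∈ Δ) :
    ∑ d ∈ Δ, G.colourSign d * c d * z d ≤ 0 := by
  have h1 : 0 ≤ ∑ d ∈ Δ, c d * F (.inr (G.faceOf d)) := by
    refine sum_fiber_nonneg G.faceOf c (fun f => F (.inr f)) (fun _ => hF0 _) (fun S d hS => ?_) Δ
      fun d h0 => hΔ d ?_
    · refine hh.sum_level_face hl hd hdeg hvertex hface hc (d := d) fun e => ?_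
      rw [hS, PlaneMap.faceOf_eq_iff]
      exact Equiv.Perm.sameCycle_comm
    · cases hw : G.white d
      · exact Or.inl (by rwa [leftOf_black hw])
      · exact Or.inr (by rwa [rightOf_white hw])
  have h2 : 0 ≤ ∑ d ∈ Δ, -c d * F (.inl (G.vertexOf d)) := by
    refine sum_fiber_nonneg G.vertexOf (fun d => -c d) (fun f => F (.inl f)) (fun _ => hF0 _)
      (fun S d hS => ?_) Δ fun d h0 => hΔ d ?_
    · have := hh.sum_level_vertex hl hd hc (d := d) (S := S) fun e => by
        rw [hS, PlaneMap.vertexOf_eq_iff]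
        exact Equiv.Perm.sameCycle_comm
      rw [Finset.sum_neg_distrib]
      linarith
    · cases hw : G.white d
      · exact Or.inr (by rwa [rightOf_black hw])
      · exact Or.inl (by rwa [leftOf_white hw])
  -- For either colour, `colourSign d * z d` is the value of `F` at the vertex minus its value at
  -- the face.
  have h3 : ∑ d ∈ Δ, G.colourSign d * c d * z d =
      -(∑ d ∈ Δ, c d * F (.inr (G.faceOf d)) + ∑ d ∈ Δ, -c d * F (.inl (G.vertexOf d))) := by
    rw [← Finset.sum_add_distrib, ← Finset.sum_neg_distrib]
    refine Finset.sum_congr rfl fun d _ => ?_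
    rw [colourSign]
    cases hw : G.white d
    · rw [← hF.black hw]
      simp
      ring
    · rw [← hF.white hw]
      simp
      ring
  linarith

theorem not_hasSelfIntersection (hd : ∀ d, ¬G.SameTrack (G.rot.symm d) d) :
    ¬G.HasSelfIntersection := by
  rintro ⟨s, t, hne, hst, he⟩
  exact hne (eq_of_exitEdge_eq hd hst he)

theorem not_hasParallelBigon (hl : G.NoTrackLoops) (hdeg : G.NoDegreeOne)
    (hvertex : G.VertexCondition) (hface : G.FaceCondition) : ¬G.HasParallelBigon := by
  classical
  intro hp
  have hd := not_sameTrack_rot_symm hdeg hvertex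
  obtain ⟨h, hh⟩ := exists_isEdgePotential hl
  choose c hc using hh.exists_hasLevel hl hd hdeg hvertex
  have hrev : ∀ d, c (G.rev d) = c d := fun d =>
    HasLevel.unique (hh.rev d ▸ hc (G.rev d)) (hc d)
  obtain ⟨s, t, m, n, hB⟩ := hp.exists_isBigon
  have h1 := hB.eventually_eq_zero hh hl hd
  rw [Filter.eventually_cofinite] at h1
  have h2 := h1.biUnion fun q _ => finite_sides q
  have ht := fun i (hi : i < n) => Finset.mem_union_right h2.toFinset (Finset.mem_union_left
    ((Finset.range m).image fun i => (G.nextStrand ^ (i + 1)) s)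
    (Finset.mem_image_of_mem (fun i => (G.nextStrand ^ (i + 1)) t) (Finset.mem_range.2 hi)))
  have hs := fun i (hi : i < m) => Finset.mem_union_right h2.toFinset (Finset.mem_union_right
    ((Finset.range n).image fun i => (G.nextStrand ^ (i + 1)) t)
    (Finset.mem_image_of_mem (fun i => (G.nextStrand ^ (i + 1)) s) (Finset.mem_range.2 hi)))
  -- The finite set `Δ` contains every corner touching the inside of the bigon, as the inequality
  -- requires, and the strands of both sides, as the telescoping requires. The two evaluations give
  -- `1 ≤ 0`.
  have h3 := sum_level_mul_nonpos hh hl hd hdeg hvertex hface hc (Δ := h2.toFinset ∪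
    ((Finset.range n).image (fun i => (G.nextStrand ^ (i + 1)) t) ∪
      (Finset.range m).image fun i => (G.nextStrand ^ (i + 1)) s)) (hB.isPotential hh hd)
    (fun q => by rcases hB.eq_zero_or_one hh hl hd q with h | h <;> simp [h])
    (fun d hd' => Finset.mem_union_left _ ((Set.Finite.mem_toFinset h2).2 (by
      simp only [Set.mem_iUnion]
      rcases hd' with hd' | hd'
      · exact ⟨_, hd', Or.inl rfl⟩
      · exact ⟨_, hd', Or.inr rfl⟩)))
  rw [hB.sum_level_mul_bigonChain hl hd hrev ht hs, hB.level_add hh hl hd hc] at h3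
  omega

end BipartitePlaneGraph

theorem corollary3p7 {D : Type*} (G : BipartitePlaneGraph D)
    (hloop : G.NoTrackLoops) (hdeg : G.NoDegreeOne)
    (hvertex : G.VertexCondition) (hface : G.FaceCondition) :
    G.IsMinimal :=
  ⟨BipartitePlaneGraph.not_hasSelfIntersection
    (BipartitePlaneGraph.not_sameTrack_rot_symm hdeg hvertex),
    BipartitePlaneGraph.not_hasParallelBigon hloop hdeg hvertex hface⟩
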